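/- All algebras are over $\mathbb C$, not necessarily unital, with non-degenerate product; $M(X)$ is the multiplier algebra of $X$. Let $(A,\Delta)$ be an algebraic quantum group: a regular multiplier Hopf algebra (that is, $\Delta:A\to M(A\otimes A)$ is a coassociative homomorphism such that the four maps sending $a\otimes a'$ to $\Delta(a)(1\otimes a')$, $(a\otimes 1)\Delta(a')$, $\Delta(a)(a'\otimes 1)$, $(1\otimes a)\Delta(a')$ are bijections of $A\otimes A$ onto $A\otimes A$) with a left integral, i.e. a non-zero linear functional $\varphi$ on $A$ such that $(\iota\otimes\varphi)\Delta(a)=\varphi(a)1$ for all $a\in A$. Let $B=\widehat A=\{\varphi(\,\cdot\,c): c\in A\}$ be the dual, paired with $A$ by $\langle a,b\rangle=b(a)$, with the product dual to the coproduct of $A$: for $b=\varphi(\,\cdot\,c)$ and $b'=\varphi(\,\cdot\,c')$, $$\langle a,bb'\rangle=\langle\Delta(a),b\otimes b'\rangle=(\varphi\otimes\varphi)(\Delta(a)(c\otimes c')).$$ For a pairing of an algebra $X$ with a vector space $Y$ on which $X$ acts by $\langle x',x\triangleright y\rangle=\langle x'x,y\rangle$ and $\langle x',y\triangleleft x\rangle=\langle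 xx',y\rangle$, the pairing is extended to $M(X)\times Y$ by $\langle m,x\triangleright y\rangle=\langle mx,y\rangle$ and $\langle m,y\triangleleft x\rangle=\langle xm,y\rangle$. These extensions are used below for $X=B\otimes B$, $Y=A\otimes A$ and for $X=B\otimes A$, $Y=A\otimes B$. Then: 1. There is a unique homomorphism $\Delta:B\to M(B\otimes B)$ (the coproduct of $B$) such that $\langle a\otimes a',\Delta(b)\rangle=\langle aa',b\rangle$ for all $a,a'\in A$ and $b\in B$. 2. There is a unique element $V\in M(B\otimes A)$ (the duality) such that $\langle V,a\otimes b\rangle=\langle a,b\rangle$ for all $a\in A$ and $b\in B$. 3. The homomorphisms $\iota\otimes\Delta:B\otimes A\to M(B\otimes A\otimes A)$ and $\Delta\otimes\iota:B\otimes A\to M(B\otimes B\otimes A)$ are non-degenerate (a homomorphism $\alpha:X\to M(Y)$ is non-degenerate if $\alpha(X)Y=Y=Y\alpha(X)$, with products of subspaces meaning linear spans; it then extends uniquely to a unital homomorphism $M(X)\to M(Y)$), and their extensions to $M(B\otimes A)$ satisfy $$(\iota\otimes\Delta)V=V_{12}V_{13}\ \text{ in } M(B\otimes A\otimes A),\qquad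 (\Delta\otimes\iota)V=V_{13}V_{23}\ \text{ in } M(B\otimes B\otimes A).$$ Here the leg numbering notation is used: $V_{12}=V\otimes 1$, $V_{23}=1\otimes V$, and $V_{13}$ is obtained from $V\otimes 1$ by flipping the last two tensor factors. -/

import Mathlib

open scoped TensorProduct

noncomputable section

set_option linter.unusedSectionVars false

namespace MultiplierHopf

/-! ### Non-degenerate algebras and multiplier algebras

An algebra over `ℂ`, not assumed to be unital, is a type `X` with
`[NonUnitalRing X] [Module ℂ X] [IsScalarTower ℂ X X] [SMulCommClass ℂ X X]`. -/

/-- The product of `X` is non-degenerate. -/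
class NondegenerateMul (X : Type*) [NonUnitalRing X] : Prop where
  eq_zero_of_mul_right : ∀ x : X, (∀ y, x * y = 0) → x = 0
  eq_zero_of_mul_left : ∀ x : X, (∀ y, y * x = 0) → x = 0

section Multipliers

variable (X : Type*) [NonUnitalRing X] [Module ℂ X] [IsScalarTower ℂ X X] [SMulCommClass ℂ X X]

/-- The multiplier algebra `M(X)`: pairs `(L, R)` of linear maps, `L x = m x` and `R x = x m`,
with `m (x y) = (m x) y`, `(x y) m = x (y m)` and `(x m) y = x (m y)`. The second component lives
in the opposite algebra, so that the product is the one of multipliers: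
`(m n) x = m (n x)` and `x (m n) = (x m) n`. -/
def multiplierAlgebra : Subalgebra ℂ (Module.End ℂ X × (Module.End ℂ X)ᵐᵒᵖ) where
  carrier := {p | (∀ x y, p.1 (x * y) = p.1 x * y) ∧
    (∀ x y, p.2.unop (x * y) = x * p.2.unop y) ∧ ∀ x y, p.2.unop x * y = x * p.1 y}
  mul_mem' := by
    rintro p q ⟨h1, h2, h3⟩ ⟨k1, k2, k3⟩
    exact ⟨fun x y => by simp [h1, k1], fun x y => by simp [h2, k2],
      fun x y => by simp [h3, k3]⟩
  add_mem' := by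
    rintro p q ⟨h1, h2, h3⟩ ⟨k1, k2, k3⟩
    exact ⟨fun x y => by simp [h1, k1, add_mul], fun x y => by simp [h2, k2, mul_add],
      fun x y => by simp [h3, k3, add_mul, mul_add]⟩
  algebraMap_mem' := fun r =>
    ⟨fun x y => by simp [Algebra.algebraMap_eq_smul_one, smul_mul_assoc],
      fun x y => by simp [Algebra.algebraMap_eq_smul_one, mul_smul_comm],
      fun x y => by simp [Algebra.algebraMap_eq_smul_one, mul_smul_comm, smul_mul_assoc]⟩

/-- The multiplier algebra `M(X)` as a type. -/
def Mult : Type _ := ↥(multiplierAlgebra X)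

instance : Ring (Mult X) := inferInstanceAs (Ring ↥(multiplierAlgebra X))

instance : Algebra ℂ (Mult X) := inferInstanceAs (Algebra ℂ ↥(multiplierAlgebra X))

instance : NonUnitalNonAssocSemiring (Mult X) := inferInstance

instance : Module ℂ (Mult X) := inferInstance

instance : DistribMulAction ℂ (Mult X) := inferInstance

variable {X}

/-- `m.lmul x` is the element `m x` of `X`. -/
def Mult.lmul (m : Mult X) : X →ₗ[ℂ] X := m.1.1

/-- `m.rmul x` is the element `x m` of `X`. -/
def Mult.rmul (m : Mult X) : X →ₗ[ℂ] X := m.1.2.unop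

theorem Mult.lmul_mul_apply (m : Mult X) (x y : X) : m.lmul (x * y) = m.lmul x * y := m.2.1 x y

theorem Mult.rmul_mul_apply (m : Mult X) (x y : X) : m.rmul (x * y) = x * m.rmul y := m.2.2.1 x y

theorem Mult.rmul_mul (m : Mult X) (x y : X) : m.rmul x * y = x * m.lmul y := m.2.2.2 x y

theorem Mult.ext {m n : Mult X} (h1 : ∀ x, m.lmul x = n.lmul x) (h2 : ∀ x, m.rmul x = n.rmul x) :
    m = n :=
  Subtype.ext (Prod.ext (LinearMap.ext h1) (MulOpposite.unop_injective (LinearMap.ext h2)))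

/-- The multiplier with the given left and right multiplication maps. -/
def Mult.mk (L R : X →ₗ[ℂ] X) (h1 : ∀ x y, L (x * y) = L x * y)
    (h2 : ∀ x y, R (x * y) = x * R y) (h3 : ∀ x y, R x * y = x * L y) : Mult X :=
  ⟨(L, MulOpposite.op R), h1, h2, h3⟩

@[simp] theorem Mult.lmul_mk (L R : X →ₗ[ℂ] X) (h1 h2 h3) (x : X) :
    (Mult.mk L R h1 h2 h3).lmul x = L x := rfl

@[simp] theorem Mult.rmul_mk (L R : X →ₗ[ℂ] X) (h1 h2 h3) (x : X) :
    (Mult.mk L R h1 h2 h3).rmul x = R x := rfl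

@[simp] theorem Mult.lmul_mul (m n : Mult X) (x : X) : (m * n).lmul x = m.lmul (n.lmul x) := rfl

@[simp] theorem Mult.rmul_mul' (m n : Mult X) (x : X) : (m * n).rmul x = n.rmul (m.rmul x) := rfl

@[simp] theorem Mult.lmul_one (x : X) : (1 : Mult X).lmul x = x := rfl

@[simp] theorem Mult.rmul_one (x : X) : (1 : Mult X).rmul x = x := rfl

@[simp] theorem Mult.lmul_zero (x : X) : (0 : Mult X).lmul x = 0 := rfl

@[simp] theorem Mult.rmul_zero (x : X) : (0 : Mult X).rmul x = 0 := rfl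

@[simp] theorem Mult.lmul_add (m n : Mult X) (x : X) :
    (m + n).lmul x = m.lmul x + n.lmul x := rfl

@[simp] theorem Mult.rmul_add (m n : Mult X) (x : X) :
    (m + n).rmul x = m.rmul x + n.rmul x := rfl

@[simp] theorem Mult.lmul_smul (r : ℂ) (m : Mult X) (x : X) :
    (r • m).lmul x = r • m.lmul x := rfl

@[simp] theorem Mult.rmul_smul (r : ℂ) (m : Mult X) (x : X) :
    (r • m).rmul x = r • m.rmul x := rfl

variable (X) in
/-- The canonical homomorphism `X → M(X)` (injective when the product is non-degenerate). -/
def incl : X →ₙₐ[ℂ] Mult X where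
  toFun x := Mult.mk (LinearMap.mulLeft ℂ x) (LinearMap.mulRight ℂ x)
    (fun y z => by simp [mul_assoc]) (fun y z => by simp [mul_assoc])
    (fun y z => by simp [mul_assoc])
  map_smul' r x := Mult.ext (fun y => smul_mul_assoc r x y) (fun y => mul_smul_comm r y x)
  map_zero' := Mult.ext (fun y => zero_mul y) (fun y => mul_zero y)
  map_add' x y := Mult.ext (fun z => add_mul x y z) (fun z => mul_add z x y)
  map_mul' x y := Mult.ext (fun z => mul_assoc x y z) (fun z => (mul_assoc z x y).symm)

@[simp] theorem lmul_incl (x y : X) : (incl X x).lmul y = x * y := rfl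

@[simp] theorem rmul_incl (x y : X) : (incl X x).rmul y = y * x := rfl

end Multipliers

/-! ### Tensor products and leg numbering -/

section Tensor

variable {X : Type*} [NonUnitalRing X] [Module ℂ X] [IsScalarTower ℂ X X] [SMulCommClass ℂ X X]
variable {Y : Type*} [NonUnitalRing Y] [Module ℂ Y] [IsScalarTower ℂ Y Y] [SMulCommClass ℂ Y Y]
variable {Z : Type*} [NonUnitalRing Z] [Module ℂ Z] [IsScalarTower ℂ Z Z] [SMulCommClass ℂ Z Z]
variable {W : Type*} [NonUnitalRing W] [Module ℂ W] [IsScalarTower ℂ W W] [SMulCommClass ℂ W W]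

instance instNonUnitalRingTensor : NonUnitalRing (X ⊗[ℂ] Y) :=
  Algebra.TensorProduct.instNonUnitalRing

instance instIsScalarTowerTensor : IsScalarTower ℂ (X ⊗[ℂ] Y) (X ⊗[ℂ] Y) := inferInstance

instance instSMulCommClassTensor : SMulCommClass ℂ (X ⊗[ℂ] Y) (X ⊗[ℂ] Y) := inferInstance

/-- The multiplier `m ⊗ n` of `X ⊗ Y`, for `m ∈ M(X)` and `n ∈ M(Y)`. -/
def tmul (m : Mult X) (n : Mult Y) : Mult (X ⊗[ℂ] Y) :=
  Mult.mk (TensorProduct.map m.lmul n.lmul) (TensorProduct.map m.rmul n.rmul)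
    (fun s t => by
      induction s with
      | zero => simp
      | add s s' h h' => simp only [add_mul, map_add, h, h']
      | tmul x y =>
        induction t with
        | zero => simp
        | add t t' h h' => simp only [mul_add, map_add, h, h']
        | tmul x' y' => simp [m.lmul_mul_apply, n.lmul_mul_apply])
    (fun s t => by
      induction s with
      | zero => simp
      | add s s' h h' => simp only [add_mul, map_add, h, h']
      | tmul x y =>
        induction t with
        | zero => simp
        | add t t' h h' => simp only [mul_add, map_add, h, h']
        | tmul x' y' => simp [m.rmul_mul_apply, n.rmul_mul_apply])
    (fun s t => by
      induction s with
      | zero => simp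
      | add s s' h h' => simp only [add_mul, map_add, h, h']
      | tmul x y =>
        induction t with
        | zero => simp
        | add t t' h h' => simp only [mul_add, map_add, h, h']
        | tmul x' y' => simp [m.rmul_mul, n.rmul_mul])

@[simp] theorem lmul_tmul (m : Mult X) (n : Mult Y) (x : X) (y : Y) :
    (tmul m n).lmul (x ⊗ₜ[ℂ] y) = m.lmul x ⊗ₜ[ℂ] n.lmul y := rfl

@[simp] theorem rmul_tmul (m : Mult X) (n : Mult Y) (x : X) (y : Y) :
    (tmul m n).rmul (x ⊗ₜ[ℂ] y) = m.rmul x ⊗ₜ[ℂ] n.rmul y := rfl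

theorem Mult.ext_tmul {m n : Mult (X ⊗[ℂ] Y)}
    (h1 : ∀ x y, m.lmul (x ⊗ₜ[ℂ] y) = n.lmul (x ⊗ₜ[ℂ] y))
    (h2 : ∀ x y, m.rmul (x ⊗ₜ[ℂ] y) = n.rmul (x ⊗ₜ[ℂ] y)) : m = n := by
  have e1 : m.lmul = n.lmul := TensorProduct.ext' h1
  have e2 : m.rmul = n.rmul := TensorProduct.ext' h2
  exact Mult.ext (fun x => by rw [e1]) (fun x => by rw [e2])

/-- The tensor product `f ⊗ g : X ⊗ Y → M(Z ⊗ W)` of two homomorphisms `f : X → M(Z)` and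
`g : Y → M(W)`, given by `x ⊗ y ↦ f x ⊗ g y`. -/
def tensorHom (f : X →ₙₐ[ℂ] Mult Z) (g : Y →ₙₐ[ℂ] Mult W) :
    X ⊗[ℂ] Y →ₙₐ[ℂ] Mult (Z ⊗[ℂ] W) :=
  let F : X ⊗[ℂ] Y →ₗ[ℂ] Mult (Z ⊗[ℂ] W) := TensorProduct.lift
    (LinearMap.mk₂ ℂ (fun x y => tmul (f x) (g y))
      (fun x x' y => Mult.ext_tmul (by simp [TensorProduct.add_tmul])
        (by simp [TensorProduct.add_tmul]))
      (fun r x y => Mult.ext_tmul (by simp [TensorProduct.smul_tmul'])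
        (by simp [TensorProduct.smul_tmul']))
      (fun x y y' => Mult.ext_tmul (by simp [TensorProduct.tmul_add])
        (by simp [TensorProduct.tmul_add]))
      (fun r x y => Mult.ext_tmul (by simp) (by simp)))
  { F with
    map_zero' := F.map_zero
    map_mul' := fun s t => by
      change F (s * t) = F s * F t
      induction s with
      | zero => simp
      | add s s' h h' => simp only [add_mul, map_add, h, h']
      | tmul x y =>
        induction t with
        | zero => simp
        | add t t' h h' => simp only [mul_add, map_add, h, h']
        | tmul x' y' =>
          have hF : ∀ x y, F (x ⊗ₜ[ℂ] y) = tmul (f x) (g y) := fun _ _ => rfl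
          rw [Algebra.TensorProduct.tmul_mul_tmul, hF, hF, hF, map_mul, map_mul]
          exact Mult.ext_tmul (by simp) (by simp) }

@[simp] theorem tensorHom_tmul (f : X →ₙₐ[ℂ] Mult Z) (g : Y →ₙₐ[ℂ] Mult W) (x : X) (y : Y) :
    tensorHom f g (x ⊗ₜ[ℂ] y) = tmul (f x) (g y) := rfl

/-- The isomorphism `M(X) ≅ M(Y)` induced by an isomorphism `e : X ≅ Y` of algebras. -/
def Mult.congr (e : X ≃ₗ[ℂ] Y) (he : ∀ x x', e (x * x') = e x * e x') :
    Mult X →ₐ[ℂ] Mult Y where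
  toFun m := Mult.mk (e.toLinearMap ∘ₗ m.lmul ∘ₗ e.symm.toLinearMap)
    (e.toLinearMap ∘ₗ m.rmul ∘ₗ e.symm.toLinearMap)
    (fun x y => by
      obtain ⟨x, rfl⟩ := e.surjective x
      obtain ⟨y, rfl⟩ := e.surjective y
      simp [← he, m.lmul_mul_apply])
    (fun x y => by
      obtain ⟨x, rfl⟩ := e.surjective x
      obtain ⟨y, rfl⟩ := e.surjective y
      simp [← he, m.rmul_mul_apply])
    (fun x y => by
      obtain ⟨x, rfl⟩ := e.surjective x
      obtain ⟨y, rfl⟩ := e.surjective y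
      simp [← he, m.rmul_mul])
  map_one' := Mult.ext (fun x => by simp) (fun x => by simp)
  map_mul' m n := Mult.ext (fun x => by simp) (fun x => by simp)
  map_zero' := Mult.ext (fun x => e.map_zero) (fun x => e.map_zero)
  map_add' m n := Mult.ext (fun x => by simp) (fun x => by simp)
  commutes' r := Mult.ext (fun x => by simp [Algebra.algebraMap_eq_smul_one])
    (fun x => by simp [Algebra.algebraMap_eq_smul_one])

theorem assoc_mul (s t : (X ⊗[ℂ] Y) ⊗[ℂ] Z) :
    TensorProduct.assoc ℂ X Y Z (s * t) =
      TensorProduct.assoc ℂ X Y Z s * TensorProduct.assoc ℂ X Y Z t := by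
  induction s with
  | zero => simp
  | add s s' h h' => simp only [add_mul, map_add, h, h']
  | tmul p z =>
    induction t with
    | zero => simp
    | add t t' h h' => simp only [mul_add, map_add, h, h']
    | tmul q z' =>
      induction p with
      | zero => simp
      | add s s' h h' => simp only [add_mul, map_add, h, h', TensorProduct.add_tmul]
      | tmul x y =>
        induction q with
        | zero => simp
        | add t t' h h' => simp only [mul_add, map_add, h, h', TensorProduct.add_tmul]
        | tmul x' y' => simp

/-- The identification `M((X ⊗ Y) ⊗ Z) = M(X ⊗ (Y ⊗ Z))`. -/
def multAssoc : Mult ((X ⊗[ℂ] Y) ⊗[ℂ] Z) →ₐ[ℂ] Mult (X ⊗[ℂ] (Y ⊗[ℂ] Z)) :=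
  Mult.congr (TensorProduct.assoc ℂ X Y Z) assoc_mul

theorem congr_comm_mul (s t : X ⊗[ℂ] (Y ⊗[ℂ] Z)) :
    TensorProduct.congr (LinearEquiv.refl ℂ X) (TensorProduct.comm ℂ Y Z) (s * t) =
      TensorProduct.congr (LinearEquiv.refl ℂ X) (TensorProduct.comm ℂ Y Z) s *
      TensorProduct.congr (LinearEquiv.refl ℂ X) (TensorProduct.comm ℂ Y Z) t := by
  induction s with
  | zero => simp
  | add s s' h h' => simp only [add_mul, map_add, h, h']
  | tmul x p =>
    induction t with
    | zero => simp
    | add t t' h h' => simp only [mul_add, map_add, h, h']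
    | tmul x' q =>
      induction p with
      | zero => simp
      | add s s' h h' => simp only [add_mul, map_add, h, h', TensorProduct.tmul_add]
      | tmul y z =>
        induction q with
        | zero => simp
        | add t t' h h' => simp only [mul_add, map_add, h, h', TensorProduct.tmul_add]
        | tmul y' z' => simp

/-- The map `ι ⊗ ζ : M(X ⊗ (Y ⊗ Z)) → M(X ⊗ (Z ⊗ Y))`, with `ζ` the flip. -/
def multFlip : Mult (X ⊗[ℂ] (Y ⊗[ℂ] Z)) →ₐ[ℂ] Mult (X ⊗[ℂ] (Z ⊗[ℂ] Y)) :=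
  Mult.congr (TensorProduct.congr (LinearEquiv.refl ℂ X) (TensorProduct.comm ℂ Y Z))
    congr_comm_mul

variable (Z) in
/-- `E₁₂ = E ⊗ 1`. -/
def leg12 (E : Mult (X ⊗[ℂ] Y)) : Mult (X ⊗[ℂ] (Y ⊗[ℂ] Z)) := multAssoc (tmul E 1)

variable (Z) in
/-- `E₁₃ = (ι ⊗ ζ)(E₁₂)`. -/
def leg13 (E : Mult (X ⊗[ℂ] Y)) : Mult (X ⊗[ℂ] (Z ⊗[ℂ] Y)) := multFlip (leg12 Z E)

variable (Z) in
/-- `E₂₃ = 1 ⊗ E`. -/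
def leg23 (E : Mult (X ⊗[ℂ] Y)) : Mult (Z ⊗[ℂ] (X ⊗[ℂ] Y)) := tmul 1 E

end Tensor

/-! ### Non-degeneracy of tensor products and extension to multiplier algebras -/

section Extension

/-- A jointly injective family of linear maps on `X` stays jointly injective on `X ⊗ Y`. -/
theorem rTensor_separating {X X' Y ι : Type*} [AddCommGroup X] [Module ℂ X] [AddCommGroup X']
    [Module ℂ X'] [AddCommGroup Y] [Module ℂ Y] (f : ι → X →ₗ[ℂ] X')
    (hf : ∀ x, (∀ i, f i x = 0) → x = 0) (t : X ⊗[ℂ] Y) (ht : ∀ i, (f i).rTensor Y t = 0) :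
    t = 0 := by
  classical
  let b := Module.Basis.ofVectorSpace ℂ Y
  have key : ∀ (i : ι) (s : X ⊗[ℂ] Y) (j),
      TensorProduct.equivFinsuppOfBasisRight b ((f i).rTensor Y s) j =
        f i (TensorProduct.equivFinsuppOfBasisRight b s j) := by
    intro i s j
    induction s with
    | zero => simp
    | add s s' h h' => simp only [map_add, Finsupp.add_apply, h, h']
    | tmul x y => simp
  apply (TensorProduct.equivFinsuppOfBasisRight b).injective
  ext j
  rw [map_zero]
  exact hf _ fun i => by rw [← key, ht, map_zero]; rfl

theorem lTensor_separating {X X' Y ι : Type*} [AddCommGroup X] [Module ℂ X] [AddCommGroup X']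
    [Module ℂ X'] [AddCommGroup Y] [Module ℂ Y] (f : ι → X →ₗ[ℂ] X')
    (hf : ∀ x, (∀ i, f i x = 0) → x = 0) (t : Y ⊗[ℂ] X) (ht : ∀ i, (f i).lTensor Y t = 0) :
    t = 0 := by
  apply (TensorProduct.comm ℂ Y X).injective
  rw [map_zero]
  refine rTensor_separating f hf _ fun i => ?_
  have : (f i).rTensor Y (TensorProduct.comm ℂ Y X t)
      = TensorProduct.comm ℂ Y X' ((f i).lTensor Y t) := by
    generalize t = t
    induction t with
    | zero => simp
    | add s s' h h' => simp only [map_add, h, h']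
    | tmul x y => simp
  rw [this, ht, map_zero]

variable {X : Type*} [NonUnitalRing X] [Module ℂ X] [IsScalarTower ℂ X X] [SMulCommClass ℂ X X]
variable {Y : Type*} [NonUnitalRing Y] [Module ℂ Y] [IsScalarTower ℂ Y Y] [SMulCommClass ℂ Y Y]

instance [NondegenerateMul X] [NondegenerateMul Y] : NondegenerateMul (X ⊗[ℂ] Y) where
  eq_zero_of_mul_right t ht := by
    refine rTensor_separating (fun x : X => LinearMap.mulRight ℂ x)
      (fun x h => NondegenerateMul.eq_zero_of_mul_right x h) t fun x => ?_
    refine lTensor_separating (fun y : Y => LinearMap.mulRight ℂ y)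
      (fun y h => NondegenerateMul.eq_zero_of_mul_right y h) _ fun y => ?_
    rw [← ht (x ⊗ₜ y)]
    generalize t = t
    induction t with
    | zero => simp
    | add s s' h h' => simp only [map_add, add_mul, h, h']
    | tmul x y => simp
  eq_zero_of_mul_left t ht := by
    refine rTensor_separating (fun x : X => LinearMap.mulLeft ℂ x)
      (fun x h => NondegenerateMul.eq_zero_of_mul_left x h) t fun x => ?_
    refine lTensor_separating (fun y : Y => LinearMap.mulLeft ℂ y)
      (fun y h => NondegenerateMul.eq_zero_of_mul_left y h) _ fun y => ?_
    rw [← ht (x ⊗ₜ y)]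
    generalize t = t
    induction t with
    | zero => simp
    | add s s' h h' => simp only [map_add, mul_add, h, h']
    | tmul x y => simp

/-- A homomorphism `α : X → M(Y)` is non-degenerate if `α(X) Y = Y = Y α(X)`. -/
structure IsNondegenerateHom (α : X →ₙₐ[ℂ] Mult Y) : Prop where
  span_lmul : Submodule.span ℂ {z : Y | ∃ x y, z = (α x).lmul y} = ⊤
  span_rmul : Submodule.span ℂ {z : Y | ∃ x y, z = (α x).rmul y} = ⊤

namespace IsNondegenerateHom

variable {α : X →ₙₐ[ℂ] Mult Y}

/-- The map `X ⊗ Y → Y`, `x ⊗ y ↦ α(x) y`. -/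
def lact (α : X →ₙₐ[ℂ] Mult Y) : X ⊗[ℂ] Y →ₗ[ℂ] Y :=
  TensorProduct.lift (LinearMap.mk₂ ℂ (fun x y => (α x).lmul y) (by simp) (by simp) (by simp)
    (by simp))

/-- The map `X ⊗ Y → Y`, `x ⊗ y ↦ y α(x)`. -/
def ract (α : X →ₙₐ[ℂ] Mult Y) : X ⊗[ℂ] Y →ₗ[ℂ] Y :=
  TensorProduct.lift (LinearMap.mk₂ ℂ (fun x y => (α x).rmul y) (by simp) (by simp) (by simp)
    (by simp))

@[simp] theorem lact_tmul (x : X) (y : Y) : lact α (x ⊗ₜ[ℂ] y) = (α x).lmul y := rfl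

@[simp] theorem ract_tmul (x : X) (y : Y) : ract α (x ⊗ₜ[ℂ] y) = (α x).rmul y := rfl

theorem lact_surjective (h : IsNondegenerateHom α) : Function.Surjective (lact α) := by
  rw [← LinearMap.range_eq_top, eq_top_iff, ← h.span_lmul, Submodule.span_le]
  rintro z ⟨x, y, rfl⟩
  exact ⟨x ⊗ₜ y, rfl⟩

theorem ract_surjective (h : IsNondegenerateHom α) : Function.Surjective (ract α) := by
  rw [← LinearMap.range_eq_top, eq_top_iff, ← h.span_rmul, Submodule.span_le]
  rintro z ⟨x, y, rfl⟩
  exact ⟨x ⊗ₜ y, rfl⟩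

/-- `(y α(x)) (α(m x') y') = (y α(x m)) (α(x') y')`. -/
theorem ract_mul_lact (m : Mult X) (s t : X ⊗[ℂ] Y) :
    ract α s * lact α (m.lmul.rTensor Y t) = ract α (m.rmul.rTensor Y s) * lact α t := by
  induction s with
  | zero => simp
  | add s s' h h' => simp only [map_add, add_mul, h, h']
  | tmul x y =>
    induction t with
    | zero => simp
    | add t t' h h' => simp only [map_add, mul_add, h, h']
    | tmul x' y' =>
      simp only [LinearMap.rTensor_tmul, lact_tmul, ract_tmul, Mult.rmul_mul]
      rw [← Mult.lmul_mul, ← Mult.lmul_mul, ← map_mul, ← map_mul, m.rmul_mul]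

variable [NondegenerateMul Y]

theorem lact_ker (h : IsNondegenerateHom α) (m : Mult X) (t : X ⊗[ℂ] Y) (ht : lact α t = 0) :
    lact α (m.lmul.rTensor Y t) = 0 := by
  refine NondegenerateMul.eq_zero_of_mul_left _ fun y => ?_
  obtain ⟨s, rfl⟩ := h.ract_surjective y
  rw [ract_mul_lact, ht, mul_zero]

theorem ract_ker (h : IsNondegenerateHom α) (m : Mult X) (t : X ⊗[ℂ] Y) (ht : ract α t = 0) :
    ract α (m.rmul.rTensor Y t) = 0 := by
  refine NondegenerateMul.eq_zero_of_mul_right _ fun y => ?_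
  obtain ⟨s, rfl⟩ := h.lact_surjective y
  rw [← ract_mul_lact, ht, zero_mul]

/-- The left multiplication `α(x) y ↦ α(m x) y` by the extension of `α` at `m`. -/
def extendL (h : IsNondegenerateHom α) (m : Mult X) : Y →ₗ[ℂ] Y :=
  (LinearMap.ker (lact α)).liftQ (lact α ∘ₗ m.lmul.rTensor Y)
    (fun t ht => h.lact_ker m t ht) ∘ₗ
    ((lact α).quotKerEquivOfSurjective h.lact_surjective).symm.toLinearMap

/-- The right multiplication `y α(x) ↦ y α(x m)` by the extension of `α` at `m`. -/
def extendR (h : IsNondegenerateHom α) (m : Mult X) : Y →ₗ[ℂ] Y :=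
  (LinearMap.ker (ract α)).liftQ (ract α ∘ₗ m.rmul.rTensor Y)
    (fun t ht => h.ract_ker m t ht) ∘ₗ
    ((ract α).quotKerEquivOfSurjective h.ract_surjective).symm.toLinearMap

theorem extendL_lact (h : IsNondegenerateHom α) (m : Mult X) (t : X ⊗[ℂ] Y) :
    h.extendL m (lact α t) = lact α (m.lmul.rTensor Y t) := by
  have : ((lact α).quotKerEquivOfSurjective h.lact_surjective).symm (lact α t)
      = Submodule.Quotient.mk t := by
    rw [LinearEquiv.symm_apply_eq]; rfl
  simp only [extendL, LinearMap.comp_apply, LinearEquiv.coe_coe, this]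
  rfl

theorem extendR_ract (h : IsNondegenerateHom α) (m : Mult X) (t : X ⊗[ℂ] Y) :
    h.extendR m (ract α t) = ract α (m.rmul.rTensor Y t) := by
  have : ((ract α).quotKerEquivOfSurjective h.ract_surjective).symm (ract α t)
      = Submodule.Quotient.mk t := by
    rw [LinearEquiv.symm_apply_eq]; rfl
  simp only [extendR, LinearMap.comp_apply, LinearEquiv.coe_coe, this]
  rfl

theorem lact_mul (t : X ⊗[ℂ] Y) (y : Y) :
    lact α t * y = lact α ((LinearMap.mulRight ℂ y).lTensor X t) := by
  induction t with
  | zero => simp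
  | add t t' h h' => simp only [map_add, add_mul, h, h']
  | tmul x y' => simp [Mult.lmul_mul_apply]

theorem mul_ract (t : X ⊗[ℂ] Y) (y : Y) :
    y * ract α t = ract α ((LinearMap.mulLeft ℂ y).lTensor X t) := by
  induction t with
  | zero => simp
  | add t t' h h' => simp only [map_add, mul_add, h, h']
  | tmul x y' => simp [Mult.rmul_mul_apply]

/-- The unique extension `M(X) → M(Y)` of a non-degenerate homomorphism `α : X → M(Y)`. At a
multiplier `m` it is given by `α(x) y ↦ α(m x) y` and `y α(x) ↦ y α(x m)`. -/
def extend (h : IsNondegenerateHom α) : Mult X →ₐ[ℂ] Mult Y where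
  toFun m := Mult.mk (h.extendL m) (h.extendR m)
    (fun y y' => by
      obtain ⟨t, rfl⟩ := h.lact_surjective y
      rw [lact_mul, extendL_lact, extendL_lact, lact_mul]
      congr 1
      rw [← LinearMap.comp_apply, ← LinearMap.comp_apply, LinearMap.rTensor_comp_lTensor,
        LinearMap.lTensor_comp_rTensor])
    (fun y y' => by
      obtain ⟨t, rfl⟩ := h.ract_surjective y'
      rw [mul_ract, extendR_ract, extendR_ract, mul_ract]
      congr 1
      rw [← LinearMap.comp_apply, ← LinearMap.comp_apply, LinearMap.rTensor_comp_lTensor,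
        LinearMap.lTensor_comp_rTensor])
    (fun y y' => by
      obtain ⟨s, rfl⟩ := h.ract_surjective y
      obtain ⟨t, rfl⟩ := h.lact_surjective y'
      rw [extendR_ract, extendL_lact, ract_mul_lact])
  map_one' := by
    refine Mult.ext (fun y => ?_) (fun y => ?_)
    · obtain ⟨t, rfl⟩ := h.lact_surjective y
      rw [Mult.lmul_mk, extendL_lact]
      exact congrArg _ (LinearMap.rTensor_id_apply Y X t)
    · obtain ⟨t, rfl⟩ := h.ract_surjective y
      rw [Mult.rmul_mk, extendR_ract]
      exact congrArg _ (LinearMap.rTensor_id_apply Y X t)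
  map_mul' m n := by
    refine Mult.ext (fun y => ?_) (fun y => ?_)
    · obtain ⟨t, rfl⟩ := h.lact_surjective y
      simp only [Mult.lmul_mk, Mult.lmul_mul, extendL_lact]
      exact congrArg _ (LinearMap.rTensor_comp_apply Y m.lmul n.lmul t)
    · obtain ⟨t, rfl⟩ := h.ract_surjective y
      simp only [Mult.rmul_mk, Mult.rmul_mul', extendR_ract]
      exact congrArg _ (LinearMap.rTensor_comp_apply Y n.rmul m.rmul t)
  map_zero' := by
    refine Mult.ext (fun y => ?_) (fun y => ?_)
    · obtain ⟨t, rfl⟩ := h.lact_surjective y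
      rw [Mult.lmul_mk, extendL_lact]
      change lact α ((0 : X →ₗ[ℂ] X).rTensor Y t) = 0
      simp
    · obtain ⟨t, rfl⟩ := h.ract_surjective y
      rw [Mult.rmul_mk, extendR_ract]
      change ract α ((0 : X →ₗ[ℂ] X).rTensor Y t) = 0
      simp
  map_add' m n := by
    refine Mult.ext (fun y => ?_) (fun y => ?_)
    · obtain ⟨t, rfl⟩ := h.lact_surjective y
      simp only [Mult.lmul_mk, Mult.lmul_add, extendL_lact]
      rw [← map_add, ← LinearMap.add_apply, ← LinearMap.rTensor_add]; rfl
    · obtain ⟨t, rfl⟩ := h.ract_surjective y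
      simp only [Mult.rmul_mk, Mult.rmul_add, extendR_ract]
      rw [← map_add, ← LinearMap.add_apply, ← LinearMap.rTensor_add]; rfl
  commutes' r := by
    refine Mult.ext (fun y => ?_) (fun y => ?_)
    · obtain ⟨t, rfl⟩ := h.lact_surjective y
      rw [Mult.lmul_mk, extendL_lact]
      change lact α ((r • (LinearMap.id : X →ₗ[ℂ] X)).rTensor Y t) = r • lact α t
      simp [LinearMap.rTensor_smul]
    · obtain ⟨t, rfl⟩ := h.ract_surjective y
      rw [Mult.rmul_mk, extendR_ract]
      change ract α ((r • (LinearMap.id : X →ₗ[ℂ] X)).rTensor Y t) = r • ract α t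
      simp [LinearMap.rTensor_smul]

theorem extend_lmul (h : IsNondegenerateHom α) (m : Mult X) (x : X) (y : Y) :
    (h.extend m).lmul ((α x).lmul y) = (α (m.lmul x)).lmul y :=
  h.extendL_lact m (x ⊗ₜ y)

theorem extend_rmul (h : IsNondegenerateHom α) (m : Mult X) (x : X) (y : Y) :
    (h.extend m).rmul ((α x).rmul y) = (α (m.rmul x)).rmul y :=
  h.extendR_ract m (x ⊗ₜ y)

end IsNondegenerateHom

end Extension

/-! ### Algebraic quantum groups -/

section QuantumGroup

/-- A regular multiplier Hopf algebra: an algebra `A` with a non-degenerate product and a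
homomorphism `Δ : A → M(A ⊗ A)`, coassociative, such that each of the four maps
`a ⊗ b ↦ Δ(a)(1 ⊗ b)`, `a ⊗ b ↦ (a ⊗ 1)Δ(b)`, `a ⊗ b ↦ Δ(a)(b ⊗ 1)`, `a ⊗ b ↦ (1 ⊗ a)Δ(b)`
is a bijection from `A ⊗ A` to `A ⊗ A` (so that, in particular, all these products lie in
`A ⊗ A`). Coassociativity is the equation
`(a ⊗ 1 ⊗ 1) (Δ ⊗ ι)(Δ(b)(1 ⊗ c)) = (ι ⊗ Δ)((a ⊗ 1)Δ(b)) (1 ⊗ 1 ⊗ c)` in `M(A ⊗ A ⊗ A)`. -/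
structure RegularMultiplierHopfAlgebra (A : Type*) [NonUnitalRing A] [Module ℂ A]
    [IsScalarTower ℂ A A] [SMulCommClass ℂ A A] [NondegenerateMul A] where
  /-- The coproduct `Δ`. -/
  comul : A →ₙₐ[ℂ] Mult (A ⊗[ℂ] A)
  exists_equiv_comul_mul_right : ∃ T : (A ⊗[ℂ] A) ≃ₗ[ℂ] (A ⊗[ℂ] A), ∀ a b,
    incl (A ⊗[ℂ] A) (T (a ⊗ₜ[ℂ] b)) = comul a * tmul 1 (incl A b)
  exists_equiv_left_mul_comul : ∃ T : (A ⊗[ℂ] A) ≃ₗ[ℂ] (A ⊗[ℂ] A), ∀ a b,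
    incl (A ⊗[ℂ] A) (T (a ⊗ₜ[ℂ] b)) = tmul (incl A a) 1 * comul b
  exists_equiv_comul_mul_left : ∃ T : (A ⊗[ℂ] A) ≃ₗ[ℂ] (A ⊗[ℂ] A), ∀ a b,
    incl (A ⊗[ℂ] A) (T (a ⊗ₜ[ℂ] b)) = comul a * tmul (incl A b) 1
  exists_equiv_right_mul_comul : ∃ T : (A ⊗[ℂ] A) ≃ₗ[ℂ] (A ⊗[ℂ] A), ∀ a b,
    incl (A ⊗[ℂ] A) (T (a ⊗ₜ[ℂ] b)) = tmul 1 (incl A a) * comul b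
  coassoc : ∀ (a b c : A) (s t : A ⊗[ℂ] A),
    incl (A ⊗[ℂ] A) s = comul b * tmul 1 (incl A c) →
    incl (A ⊗[ℂ] A) t = tmul (incl A a) 1 * comul b →
    tmul (incl A a) 1 * multAssoc (tensorHom comul (incl A) s) =
      tensorHom (incl A) comul t * tmul 1 (tmul 1 (incl A c))

/-- The map `ι ⊗ φ : A ⊗ A → A` for a linear functional `φ` on `A`. -/
def sliceRight {A : Type*} [AddCommGroup A] [Module ℂ A] (φ : A →ₗ[ℂ] ℂ) : A ⊗[ℂ] A →ₗ[ℂ] A :=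
  (TensorProduct.rid ℂ A).toLinearMap ∘ₗ φ.lTensor A

@[simp] theorem sliceRight_tmul {A : Type*} [AddCommGroup A] [Module ℂ A] (φ : A →ₗ[ℂ] ℂ)
    (a b : A) : sliceRight φ (a ⊗ₜ[ℂ] b) = φ b • a := by simp [sliceRight]

/-- The functional `φ ⊗ φ' : A ⊗ A' → ℂ`. -/
def tensorFunctional {A A' : Type*} [AddCommGroup A] [Module ℂ A] [AddCommGroup A'] [Module ℂ A']
    (φ : A →ₗ[ℂ] ℂ) (φ' : A' →ₗ[ℂ] ℂ) : A ⊗[ℂ] A' →ₗ[ℂ] ℂ :=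
  LinearMap.mul' ℂ ℂ ∘ₗ TensorProduct.map φ φ'

@[simp] theorem tensorFunctional_tmul {A A' : Type*} [AddCommGroup A] [Module ℂ A]
    [AddCommGroup A'] [Module ℂ A'] (φ : A →ₗ[ℂ] ℂ) (φ' : A' →ₗ[ℂ] ℂ) (a : A) (a' : A') :
    tensorFunctional φ φ' (a ⊗ₜ[ℂ] a') = φ a * φ' a' := rfl

/-- An algebraic quantum group: a regular multiplier Hopf algebra with a (fixed) left integral,
that is, a non-zero linear functional `φ` with `(ι ⊗ φ)Δ(a) = φ(a) 1` in `M(A)` for all `a`.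
The two invariance fields say that this equation holds after multiplying with any `b ∈ A` from the
right, respectively from the left. -/
structure AlgebraicQuantumGroup (A : Type*) [NonUnitalRing A] [Module ℂ A]
    [IsScalarTower ℂ A A] [SMulCommClass ℂ A A] [NondegenerateMul A]
    extends RegularMultiplierHopfAlgebra A where
  /-- The left integral `φ`. -/
  integral : A →ₗ[ℂ] ℂ
  integral_ne_zero : integral ≠ 0
  left_invariant : ∀ (a b : A) (t : A ⊗[ℂ] A),
    incl (A ⊗[ℂ] A) t = comul a * tmul (incl A b) 1 → sliceRight integral t = integral a • b
  left_invariant' : ∀ (a b : A) (t : A ⊗[ℂ] A),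
    incl (A ⊗[ℂ] A) t = tmul (incl A b) 1 * comul a → sliceRight integral t = integral a • b

namespace AlgebraicQuantumGroup

variable {A : Type*} [NonUnitalRing A] [Module ℂ A] [IsScalarTower ℂ A A] [SMulCommClass ℂ A A]
  [NondegenerateMul A] (Q : AlgebraicQuantumGroup A)

/-! ### The dual -/

/-- The linear map `c ↦ φ(· c)` from `A` to its linear dual. -/
def toDual : A →ₗ[ℂ] Module.Dual ℂ A :=
  LinearMap.mk₂ ℂ (fun c a => Q.integral (a * c)) (by simp [mul_add]) (by simp [mul_smul_comm])
    (by simp [add_mul]) (by simp [smul_mul_assoc])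

@[simp] theorem toDual_apply (c a : A) : Q.toDual c a = Q.integral (a * c) := rfl

/-- The dual `Â = {φ(· c) | c ∈ A}` as a vector space. -/
def Dual : Type _ := ↥(LinearMap.range Q.toDual)

instance : AddCommGroup Q.Dual := inferInstanceAs (AddCommGroup ↥(LinearMap.range Q.toDual))

instance : Module ℂ Q.Dual := inferInstanceAs (Module ℂ ↥(LinearMap.range Q.toDual))

/-- The element `φ(· c)` of `Â`. -/
def fourier : A →ₗ[ℂ] Q.Dual := Q.toDual.rangeRestrict

/-- The pairing `⟨a, b⟩ = b(a)` of `A` with `Â`. -/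
def pairing : A →ₗ[ℂ] Q.Dual →ₗ[ℂ] ℂ := (LinearMap.range Q.toDual).subtype.flip

@[simp] theorem pairing_fourier (a c : A) : Q.pairing a (Q.fourier c) = Q.integral (a * c) := rfl

theorem fourier_surjective : Function.Surjective Q.fourier := Q.toDual.surjective_rangeRestrict

theorem Dual.ext {b b' : Q.Dual} (h : ∀ a, Q.pairing a b = Q.pairing a b') : b = b' :=
  Subtype.ext (LinearMap.ext h)

/-- The functional `a ↦ (φ ⊗ φ)(Δ(a)(c ⊗ c'))`. -/
def convolution (c c' : A) : Module.Dual ℂ A where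
  toFun a := tensorFunctional Q.integral Q.integral ((Q.comul a).lmul (c ⊗ₜ[ℂ] c'))
  map_add' a a' := by simp
  map_smul' r a := by simp

theorem eq_of_mul {X : Type*} [NonUnitalRing X] [NondegenerateMul X] {s t : X}
    (h : ∀ x, s * x = t * x) : s = t := by
  rw [← sub_eq_zero]
  exact NondegenerateMul.eq_zero_of_mul_right _ fun x => by rw [sub_mul, h, sub_self]

theorem eq_of_mul_tmul {s t : A ⊗[ℂ] A} (h : ∀ x y, s * (x ⊗ₜ y) = t * (x ⊗ₜ y)) : s = t := by
  refine eq_of_mul fun z => ?_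
  induction z with
  | zero => simp
  | add z z' h h' => simp only [mul_add, h, h']
  | tmul x y => exact h x y

theorem rTensor_mulRight_mul (c x y : A) (s : A ⊗[ℂ] A) :
    (LinearMap.mulRight ℂ c).rTensor A s * (x ⊗ₜ y) = s * ((c * x) ⊗ₜ y) := by
  induction s with
  | zero => simp
  | add s t h h' => simp only [map_add, add_mul, h, h']
  | tmul p q => simp [mul_assoc]

theorem lTensor_mulRight_mul (c x y : A) (s : A ⊗[ℂ] A) :
    (LinearMap.mulRight ℂ c).lTensor A s * (x ⊗ₜ y) = s * (x ⊗ₜ (c * y)) := by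
  induction s with
  | zero => simp
  | add s t h h' => simp only [map_add, add_mul, h, h']
  | tmul p q => simp [mul_assoc]

theorem lmul_lTensor_mulRight (m : Mult (A ⊗[ℂ] A)) (z : A) (w : A ⊗[ℂ] A) :
    m.lmul ((LinearMap.mulRight ℂ z).lTensor A w) =
      (LinearMap.mulRight ℂ z).lTensor A (m.lmul w) := by
  refine eq_of_mul_tmul fun x y => ?_
  rw [← Mult.lmul_mul_apply, lTensor_mulRight_mul, lTensor_mulRight_mul, Mult.lmul_mul_apply]

theorem integral_slice (t : A ⊗[ℂ] A) : tensorFunctional Q.integral Q.integral t =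
    Q.integral (sliceRight Q.integral t) := by
  induction t with
  | zero => simp
  | add s t h h' => simp only [map_add, h, h']
  | tmul a b => simp [mul_comm]

/-- `φ(· c) φ(· c')` is again of the form `φ(· d)`. -/
theorem exists_convolution_eq (c c' : A) : ∃ d, Q.toDual d = Q.convolution c c' := by
  obtain ⟨T, hT⟩ := Q.exists_equiv_comul_mul_left
  have key : ∀ w : A ⊗[ℂ] A, ∃ d, ∀ a, Q.integral (a * d) =
      tensorFunctional Q.integral Q.integral ((Q.comul a).lmul (T w)) := by
    intro w
    induction w with
    | zero => exact ⟨0, by simp⟩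
    | add s t h h' =>
      obtain ⟨d, hd⟩ := h
      obtain ⟨d', hd'⟩ := h'
      exact ⟨d + d', fun a => by simp only [mul_add, map_add, hd, hd']⟩
    | tmul p q =>
      refine ⟨Q.integral q • p, fun a => ?_⟩
      have : (Q.comul a).lmul (T (p ⊗ₜ q)) = T ((a * p) ⊗ₜ q) := by
        refine eq_of_mul fun z => ?_
        rw [← Mult.lmul_mul_apply, ← lmul_incl, ← lmul_incl, hT, hT, map_mul, mul_assoc]
        rfl
      rw [this, integral_slice, Q.left_invariant (a * p) q _ (hT _ _)]
      simp [mul_smul_comm, mul_comm]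
  obtain ⟨w, hw⟩ := T.surjective (c ⊗ₜ c')
  obtain ⟨d, hd⟩ := key w
  exact ⟨d, LinearMap.ext fun a => by rw [toDual_apply, hd, hw]; rfl⟩

/-- The product `φ(· c) φ(· c')` in `Â`. -/
def conv (c c' : A) : Q.Dual := ⟨Q.convolution c c', Q.exists_convolution_eq c c'⟩

@[simp] theorem pairing_conv (a c c' : A) : Q.pairing a (Q.conv c c') =
    tensorFunctional Q.integral Q.integral ((Q.comul a).lmul (c ⊗ₜ[ℂ] c')) := rfl

theorem conv_add (c c' d : A) : Q.conv c (c' + d) = Q.conv c c' + Q.conv c d := by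
  refine Dual.ext Q fun a => ?_
  simp only [pairing_conv, map_add, TensorProduct.tmul_add]

theorem add_conv (c c' d : A) : Q.conv (c + c') d = Q.conv c d + Q.conv c' d := by
  refine Dual.ext Q fun a => ?_
  simp only [pairing_conv, map_add, TensorProduct.add_tmul]

theorem conv_smul (r : ℂ) (c c' : A) : Q.conv c (r • c') = r • Q.conv c c' := by
  refine Dual.ext Q fun a => ?_
  simp only [pairing_conv, map_smul, TensorProduct.tmul_smul]

theorem smul_conv (r : ℂ) (c c' : A) : Q.conv (r • c) c' = r • Q.conv c c' := by
  refine Dual.ext Q fun a => ?_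
  simp only [pairing_conv, map_smul, TensorProduct.smul_tmul, TensorProduct.tmul_smul]

/-- If `Δ(a)(1 ⊗ c') = s`, then `⟨a, φ(· c) φ(· c')⟩ = (φ(· c) ⊗ φ)(s)`. -/
theorem pairing_conv_of_right (a c c' : A) (s : A ⊗[ℂ] A)
    (hs : incl (A ⊗[ℂ] A) s = Q.comul a * tmul 1 (incl A c')) :
    Q.pairing a (Q.conv c c') = tensorFunctional (Q.toDual c) Q.integral s := by
  have h1 : (Q.comul a).lmul (c ⊗ₜ c') = (LinearMap.mulRight ℂ c).rTensor A s := by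
    refine eq_of_mul_tmul fun x y => ?_
    rw [← Mult.lmul_mul_apply, rTensor_mulRight_mul, ← lmul_incl s, hs]
    simp
  rw [pairing_conv, h1]
  generalize s = s
  induction s with
  | zero => simp
  | add s t h h' => simp only [map_add, h, h']
  | tmul p q => simp

/-- If `Δ(a)(c ⊗ 1) = t`, then `⟨a, φ(· c) φ(· c')⟩ = (φ ⊗ φ(· c'))(t)`. -/
theorem pairing_conv_of_left (a c c' : A) (t : A ⊗[ℂ] A)
    (ht : incl (A ⊗[ℂ] A) t = Q.comul a * tmul (incl A c) 1) :
    Q.pairing a (Q.conv c c') = tensorFunctional Q.integral (Q.toDual c') t := by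
  have h1 : (Q.comul a).lmul (c ⊗ₜ c') = (LinearMap.mulRight ℂ c').lTensor A t := by
    refine eq_of_mul_tmul fun x y => ?_
    rw [← Mult.lmul_mul_apply, lTensor_mulRight_mul, ← lmul_incl t, ht]
    simp
  rw [pairing_conv, h1]
  generalize t = t
  induction t with
  | zero => simp
  | add s t h h' => simp only [map_add, h, h']
  | tmul p q => simp

theorem exists_right (a b : A) :
    ∃ s, incl (A ⊗[ℂ] A) s = Q.comul a * tmul 1 (incl A b) := by
  obtain ⟨T, hT⟩ := Q.exists_equiv_comul_mul_right
  exact ⟨_, hT a b⟩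

theorem exists_left (a b : A) :
    ∃ s, incl (A ⊗[ℂ] A) s = Q.comul a * tmul (incl A b) 1 := by
  obtain ⟨T, hT⟩ := Q.exists_equiv_comul_mul_left
  exact ⟨_, hT a b⟩

theorem exists_left_mul (a b : A) :
    ∃ s, incl (A ⊗[ℂ] A) s = tmul (incl A a) 1 * Q.comul b := by
  obtain ⟨T, hT⟩ := Q.exists_equiv_left_mul_comul
  exact ⟨_, hT a b⟩

theorem toDual_eq_of_fourier_eq {c d : A} (h : Q.fourier c = Q.fourier d) :
    Q.toDual c = Q.toDual d := congrArg Subtype.val h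

theorem conv_congr {c c' d d' : A} (h : Q.fourier c = Q.fourier d)
    (h' : Q.fourier c' = Q.fourier d') : Q.conv c c' = Q.conv d d' := by
  refine Dual.ext Q fun a => ?_
  obtain ⟨s, hs⟩ := Q.exists_right a c'
  obtain ⟨t, ht⟩ := Q.exists_left a d
  rw [Q.pairing_conv_of_right a c c' s hs, Q.toDual_eq_of_fourier_eq h,
    ← Q.pairing_conv_of_right a d c' s hs, Q.pairing_conv_of_left a d c' t ht,
    Q.toDual_eq_of_fourier_eq h', ← Q.pairing_conv_of_left a d d' t ht]

/-- The product of `Â`, dual to the coproduct of `A`: for `b = φ(· c)` and `b' = φ(· c')`,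
`⟨a, b b'⟩ = ⟨Δ(a), b ⊗ b'⟩ = (φ ⊗ φ)(Δ(a)(c ⊗ c'))`. It does not depend on the choice of `c`
and `c'`. -/
instance : Mul Q.Dual where
  mul b b' := Q.conv (Q.fourier_surjective b).choose (Q.fourier_surjective b').choose

theorem fourier_mul_fourier (c c' : A) : Q.fourier c * Q.fourier c' = Q.conv c c' :=
  Q.conv_congr (Q.fourier_surjective _).choose_spec (Q.fourier_surjective _).choose_spec

theorem pairing_fourier_mul_fourier (a c c' : A) : Q.pairing a (Q.fourier c * Q.fourier c') =
    tensorFunctional Q.integral Q.integral ((Q.comul a).lmul (c ⊗ₜ[ℂ] c')) := by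
  rw [fourier_mul_fourier, pairing_conv]

/-- The map `x ↦ Δ(x)(p ⊗ q)`. -/
def comulL (p q : A) : A →ₗ[ℂ] A ⊗[ℂ] A where
  toFun x := (Q.comul x).lmul (p ⊗ₜ q)
  map_add' x y := by rw [map_add, Mult.lmul_add]
  map_smul' r x := by rw [map_smul, Mult.lmul_smul, RingHom.id_apply]

theorem comulL_apply (p q x : A) : Q.comulL p q x = (Q.comul x).lmul (p ⊗ₜ q) := rfl

theorem tensorFunctional_convolution (c c' : A) (s : A ⊗[ℂ] A) :
    tensorFunctional (Q.convolution c c') Q.integral s =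
      tensorFunctional Q.integral (tensorFunctional Q.integral Q.integral)
        (TensorProduct.assoc ℂ A A A ((Q.comulL c c').rTensor A s)) := by
  induction s with
  | zero => simp only [map_zero]
  | add s t h h' => simp only [map_add, h, h']
  | tmul p q =>
    rw [LinearMap.rTensor_tmul, comulL_apply, tensorFunctional_tmul]
    change tensorFunctional Q.integral Q.integral ((Q.comul p).lmul (c ⊗ₜ[ℂ] c')) * _ = _
    generalize (Q.comul p).lmul (c ⊗ₜ[ℂ] c') = w
    induction w with
    | zero => simp only [map_zero, TensorProduct.zero_tmul, zero_mul]
    | add s t h h' => simp only [map_add, TensorProduct.add_tmul, add_mul, h, h']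
    | tmul x y =>
      simp only [TensorProduct.assoc_tmul, tensorFunctional_tmul, mul_assoc]

theorem tensorFunctional_convolution' (c c' : A) (t : A ⊗[ℂ] A) :
    tensorFunctional Q.integral (Q.convolution c c') t =
      tensorFunctional Q.integral (tensorFunctional Q.integral Q.integral)
        ((Q.comulL c c').lTensor A t) := by
  induction t with
  | zero => simp only [map_zero]
  | add s t h h' => simp only [map_add, h, h']
  | tmul p q => rfl

theorem coassoc_left (x c c' z : A) (s : A ⊗[ℂ] A) :
    (tmul (incl A x) 1 * multAssoc (tensorHom Q.comul (incl A) s)).lmul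
      (c ⊗ₜ[ℂ] (c' ⊗ₜ[ℂ] z)) = (((LinearMap.mulRight ℂ z).lTensor A).lTensor A)
      ((LinearMap.mulLeft ℂ x).rTensor (A ⊗[ℂ] A)
        (TensorProduct.assoc ℂ A A A ((Q.comulL c c').rTensor A s))) := by
  induction s with
  | zero => simp only [map_zero, mul_zero, Mult.lmul_zero]
  | add s t h h' => simp only [map_add, mul_add, Mult.lmul_add, h, h']
  | tmul p q =>
    rw [LinearMap.rTensor_tmul, comulL_apply, Mult.lmul_mul]
    change (tmul (incl A x) 1).lmul (TensorProduct.assoc ℂ A A A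
      ((Q.comul p).lmul (c ⊗ₜ c') ⊗ₜ (q * z))) = _
    generalize (Q.comul p).lmul (c ⊗ₜ[ℂ] c') = w
    induction w with
    | zero => simp only [map_zero, TensorProduct.zero_tmul]
    | add s t h h' => simp only [map_add, TensorProduct.add_tmul, h, h']
    | tmul x y => rfl

theorem coassoc_right (c c' c'' z : A) (t : A ⊗[ℂ] A) :
    (tensorHom (incl A) Q.comul t * tmul 1 (tmul 1 (incl A c''))).lmul
      (c ⊗ₜ[ℂ] (c' ⊗ₜ[ℂ] z)) = (((LinearMap.mulRight ℂ z).lTensor A).lTensor A)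
      ((Q.comulL c' c'').lTensor A ((LinearMap.mulRight ℂ c).rTensor A t)) := by
  induction t with
  | zero => simp only [map_zero, zero_mul, Mult.lmul_zero]
  | add s t h h' => simp only [map_add, add_mul, Mult.lmul_add, h, h']
  | tmul p q =>
    have := lmul_lTensor_mulRight (Q.comul q) z (c' ⊗ₜ c'')
    rw [LinearMap.rTensor_tmul, LinearMap.lTensor_tmul, LinearMap.lTensor_tmul, comulL_apply,
      ← this]
    rfl

theorem conv_assoc {c c' c'' d d' : A} (hd : Q.fourier d = Q.conv c c')
    (hd' : Q.fourier d' = Q.conv c' c'') : Q.conv d c'' = Q.conv c d' := by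
  refine Dual.ext Q fun a => ?_
  obtain ⟨s, hs⟩ := Q.exists_right a c''
  obtain ⟨t', ht'⟩ := Q.exists_left a c
  rw [Q.pairing_conv_of_right a d c'' s hs, Q.pairing_conv_of_left a c d' t' ht']
  have hd : Q.toDual d = Q.convolution c c' := congrArg Subtype.val hd
  have hd' : Q.toDual d' = Q.convolution c' c'' := congrArg Subtype.val hd'
  rw [hd, hd', tensorFunctional_convolution, tensorFunctional_convolution']
  refine congrArg _ (sub_eq_zero.1 ?_)
  refine rTensor_separating (fun x : A => LinearMap.mulLeft ℂ x)
    (fun x h => NondegenerateMul.eq_zero_of_mul_left x h) _ fun x => ?_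
  refine lTensor_separating (fun z : A => (LinearMap.mulRight ℂ z).lTensor A)
    (fun w h => lTensor_separating (fun z : A => LinearMap.mulRight ℂ z)
      (fun y h => NondegenerateMul.eq_zero_of_mul_right y h) w h) _ fun z => ?_
  rw [map_sub, map_sub, sub_eq_zero]
  obtain ⟨t, ht⟩ := Q.exists_left_mul x a
  have h := congrArg (fun m => m.lmul (c ⊗ₜ[ℂ] (c' ⊗ₜ[ℂ] z))) (Q.coassoc x a c'' s t hs ht)
  have l3 : (LinearMap.mulRight ℂ c).rTensor A t = (LinearMap.mulLeft ℂ x).rTensor A t' := by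
    change _ = (tmul (incl A x) 1).lmul t'
    refine eq_of_mul_tmul fun y y' => ?_
    rw [rTensor_mulRight_mul, ← Mult.lmul_mul_apply, ← lmul_incl t, ← lmul_incl t', ht, ht']
    rfl
  have l4 : (Q.comulL c' c'').lTensor A ((LinearMap.mulLeft ℂ x).rTensor A t') =
      (LinearMap.mulLeft ℂ x).rTensor (A ⊗[ℂ] A) ((Q.comulL c' c'').lTensor A t') := by
    rw [← LinearMap.comp_apply, ← LinearMap.comp_apply, LinearMap.lTensor_comp_rTensor,
      LinearMap.rTensor_comp_lTensor]
  rw [← coassoc_left, ← l4, ← l3, ← coassoc_right]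
  exact h

/-- The algebra `Â`. -/
instance : NonUnitalRing Q.Dual where
  left_distrib b b' b'' := by
    obtain ⟨c, rfl⟩ := Q.fourier_surjective b
    obtain ⟨c', rfl⟩ := Q.fourier_surjective b'
    obtain ⟨c'', rfl⟩ := Q.fourier_surjective b''
    rw [← map_add, fourier_mul_fourier, fourier_mul_fourier, fourier_mul_fourier, conv_add]
  right_distrib b b' b'' := by
    obtain ⟨c, rfl⟩ := Q.fourier_surjective b
    obtain ⟨c', rfl⟩ := Q.fourier_surjective b'
    obtain ⟨c'', rfl⟩ := Q.fourier_surjective b''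
    rw [← map_add, fourier_mul_fourier, fourier_mul_fourier, fourier_mul_fourier, add_conv]
  zero_mul b := by
    obtain ⟨c, rfl⟩ := Q.fourier_surjective b
    rw [← map_zero Q.fourier, fourier_mul_fourier, ← zero_smul ℂ (0 : A), smul_conv, zero_smul,
      zero_smul, map_zero]
  mul_zero b := by
    obtain ⟨c, rfl⟩ := Q.fourier_surjective b
    rw [← map_zero Q.fourier, fourier_mul_fourier, ← zero_smul ℂ (0 : A), conv_smul, zero_smul,
      zero_smul, map_zero]
  mul_assoc b b' b'' := by
    obtain ⟨c, rfl⟩ := Q.fourier_surjective b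
    obtain ⟨c', rfl⟩ := Q.fourier_surjective b'
    obtain ⟨c'', rfl⟩ := Q.fourier_surjective b''
    obtain ⟨d, hd⟩ := Q.fourier_surjective (Q.conv c c')
    obtain ⟨d', hd'⟩ := Q.fourier_surjective (Q.conv c' c'')
    rw [fourier_mul_fourier, fourier_mul_fourier, ← hd, ← hd', fourier_mul_fourier,
      fourier_mul_fourier, Q.conv_assoc hd hd']

instance : IsScalarTower ℂ Q.Dual Q.Dual where
  smul_assoc r b b' := by
    obtain ⟨c, rfl⟩ := Q.fourier_surjective b
    obtain ⟨c', rfl⟩ := Q.fourier_surjective b'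
    rw [smul_eq_mul, smul_eq_mul, ← map_smul, fourier_mul_fourier, fourier_mul_fourier, smul_conv]

instance : SMulCommClass ℂ Q.Dual Q.Dual where
  smul_comm r b b' := by
    obtain ⟨c, rfl⟩ := Q.fourier_surjective b
    obtain ⟨c', rfl⟩ := Q.fourier_surjective b'
    rw [smul_eq_mul, smul_eq_mul, ← map_smul, fourier_mul_fourier, fourier_mul_fourier, conv_smul]

theorem fourier_eq_zero_of_forall {c : A}
    (h : ∀ x y : A, Q.integral (x * c) * Q.integral y = 0) : Q.fourier c = 0 := by
  refine Dual.ext Q fun a => ?_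
  by_contra hne
  refine Q.integral_ne_zero (LinearMap.ext fun y => ?_)
  have := h a y
  rw [map_zero, pairing_fourier] at hne
  simpa [hne] using this

instance : NondegenerateMul Q.Dual where
  eq_zero_of_mul_right b hb := by
    obtain ⟨c, rfl⟩ := Q.fourier_surjective b
    refine Q.fourier_eq_zero_of_forall fun x y => ?_
    obtain ⟨T, hT⟩ := Q.exists_equiv_comul_mul_right
    have key : ∀ w, tensorFunctional (Q.toDual c) Q.integral (T w) = 0 := by
      intro w
      induction w with
      | zero => simp
      | add s t h h' => simp only [map_add, h, h', add_zero]
      | tmul p q =>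
        rw [← Q.pairing_conv_of_right p c q _ (hT p q), ← fourier_mul_fourier, hb, map_zero]
    simpa using key (T.symm (x ⊗ₜ y))
  eq_zero_of_mul_left b hb := by
    obtain ⟨c, rfl⟩ := Q.fourier_surjective b
    refine Q.fourier_eq_zero_of_forall fun x y => ?_
    obtain ⟨T, hT⟩ := Q.exists_equiv_comul_mul_left
    have key : ∀ w, tensorFunctional Q.integral (Q.toDual c) (T w) = 0 := by
      intro w
      induction w with
      | zero => simp
      | add s t h h' => simp only [map_add, h, h', add_zero]
      | tmul p q =>
        rw [← Q.pairing_conv_of_left p q c _ (hT p q), ← fourier_mul_fourier, hb, map_zero]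
    have := key (T.symm (y ⊗ₜ x))
    rw [mul_comm]
    simpa using this


/-! ### Extended pairings, the dual coproduct and the duality -/

/-- The tensor product `⟨x ⊗ x', y ⊗ y'⟩ = ⟨x, y⟩ ⟨x', y'⟩` of two pairings. -/
def tensorPairing {X X' Y Y' : Type*} [AddCommGroup X] [Module ℂ X] [AddCommGroup X']
    [Module ℂ X'] [AddCommGroup Y] [Module ℂ Y] [AddCommGroup Y'] [Module ℂ Y']
    (p : X →ₗ[ℂ] Y →ₗ[ℂ] ℂ) (q : X' →ₗ[ℂ] Y' →ₗ[ℂ] ℂ) :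
    X ⊗[ℂ] X' →ₗ[ℂ] Y ⊗[ℂ] Y' →ₗ[ℂ] ℂ :=
  (TensorProduct.map₂ p q).compr₂ (LinearMap.mul' ℂ ℂ)

@[simp] theorem tensorPairing_tmul {X X' Y Y' : Type*} [AddCommGroup X] [Module ℂ X]
    [AddCommGroup X'] [Module ℂ X'] [AddCommGroup Y] [Module ℂ Y] [AddCommGroup Y'] [Module ℂ Y']
    (p : X →ₗ[ℂ] Y →ₗ[ℂ] ℂ) (q : X' →ₗ[ℂ] Y' →ₗ[ℂ] ℂ) (x : X) (x' : X') (y : Y) (y' : Y') :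
    tensorPairing p q (x ⊗ₜ x') (y ⊗ₜ y') = p x y * q x' y' := rfl

/-- Let `P` be a pairing of an algebra `X` with a vector space `Y`. The actions `x ▹ y` and
`y ◃ x` of `X` on `Y` are given by `⟨x', x ▹ y⟩ = ⟨x' x, y⟩` and `⟨x', y ◃ x⟩ = ⟨x x', y⟩`, and
the extension of the pairing to `M(X) × Y` by `⟨m, x ▹ y⟩ = ⟨m x, y⟩` and
`⟨m, y ◃ x⟩ = ⟨x m, y⟩`. The predicate says that `e` is the functional `⟨m, ·⟩` of this
extended pairing. -/
def IsExtendedPairing {X Y : Type*} [NonUnitalRing X] [Module ℂ X] [IsScalarTower ℂ X X]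
    [SMulCommClass ℂ X X] [AddCommGroup Y] [Module ℂ Y] (P : X →ₗ[ℂ] Y →ₗ[ℂ] ℂ) (m : Mult X)
    (e : Y →ₗ[ℂ] ℂ) : Prop :=
  (∀ (x : X) (y z : Y), (∀ x', P x' z = P (x' * x) y) → e z = P (m.lmul x) y) ∧
  (∀ (x : X) (y z : Y), (∀ x', P x' z = P (x * x') y) → e z = P (m.rmul x) y)

/-- `Δ` is the coproduct of `Â`: `⟨a ⊗ a', Δ(b)⟩ = ⟨a a', b⟩`, for the extension to
`(A ⊗ A) × M(Â ⊗ Â)` of the tensor product of the pairing with itself. -/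
def IsDualComul (Δ : Q.Dual →ₙₐ[ℂ] Mult (Q.Dual ⊗[ℂ] Q.Dual)) : Prop :=
  ∀ b, IsExtendedPairing (tensorPairing Q.pairing.flip Q.pairing.flip) (Δ b)
    (Q.pairing.flip b ∘ₗ LinearMap.mul' ℂ A)

/-- `V ∈ M(Â ⊗ A)` is the duality: `⟨V, a ⊗ b⟩ = ⟨a, b⟩`, for the extension to
`M(Â ⊗ A) × (A ⊗ Â)` of the tensor product of the flipped pairing with the pairing. -/
def IsDuality (V : Mult (Q.Dual ⊗[ℂ] A)) : Prop :=
  IsExtendedPairing (tensorPairing Q.pairing.flip Q.pairing) V (TensorProduct.lift Q.pairing)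

/-- The homomorphism `ι ⊗ Δ : Â ⊗ A → M(Â ⊗ (A ⊗ A))`. -/
def idTensorComul : Q.Dual ⊗[ℂ] A →ₙₐ[ℂ] Mult (Q.Dual ⊗[ℂ] (A ⊗[ℂ] A)) :=
  tensorHom (incl Q.Dual) Q.comul

/-- The homomorphism `Δ ⊗ ι : Â ⊗ A → M(Â ⊗ (Â ⊗ A))` for a coproduct `Δ` on `Â`. -/
def comulTensorId (Δ : Q.Dual →ₙₐ[ℂ] Mult (Q.Dual ⊗[ℂ] Q.Dual)) :
    Q.Dual ⊗[ℂ] A →ₙₐ[ℂ] Mult (Q.Dual ⊗[ℂ] (Q.Dual ⊗[ℂ] A)) :=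
  NonUnitalAlgHom.comp
    (AlgHom.toNonUnitalAlgHom (multAssoc (X := Q.Dual) (Y := Q.Dual) (Z := A)))
    (tensorHom Δ (incl A))

end AlgebraicQuantumGroup

end QuantumGroup

end MultiplierHopf

end

open scoped TensorProduct

noncomputable section

set_option linter.unusedSectionVars false

namespace MultiplierHopf

/-! ### Operators on triple tensor products and abstract antipodes -/

section AbstractAntipode

variable {A : Type*} [AddCommGroup A] [Module ℂ A]

/-! For a non-degenerate pairing of an algebra X with a space Y on which X acts from both sides, a
functional e on Y is ⟨m, ·⟩ for a unique multiplier m as soon as y ↦ e(x ▹ y) and y ↦ e(y ◃ x) are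
given by elements of X. These elements are m x and x m, and the multiplier axioms are the laws of
the actions (`IsActingPairing.existsUnique_isExtendedPairing`). So V and each Δ(b) are obtained by
exhibiting their products with elementary tensors.

Three facts about the integral make this possible. The pairing separates A because φ is faithful
(`eq_zero_of_integral_mul`). The right action of A on the dual exists because φ(c ·) and φ(· d)
describe the same functionals (`exists_integral_comm`, `exists_integral_comm'`). Products from the
right are computed with the right integral ψ = φ ∘ S, whose functionals ψ(· c) and ψ(c ·) again
describe the dual. All of this is extracted from the four canonical bijections: counit and antipode
are built for an abstract pair of bijections (`IsCanonicalPair`), which is then applied both to A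
and to A with the opposite product.

Let W = `can₃`, that is W(a ⊗ b) = Δ(b)(a ⊗ 1), and F(a ⊗ c) = φ(· c) ⊗ a. Left invariance gives V
F(W v) = F(v) (`IsDuality.lmul_can₃`), and Δ(φ(· c))(b₁ ⊗ φ(· c₂)) = Σ φ(· q)b₁ ⊗ φ(· p) with Σ q ⊗
p = W⁻¹(c ⊗ c₂) (`lmul_fourier_tmul`). Multiplicativity of the dual coproduct expresses that A is a
module algebra over its dual (`mul'_actL_dualComul`). Non-degeneracy of ι ⊗ Δ and Δ ⊗ ι follows from
the surjectivity of the canonical maps and from the fact that A and its dual are spanned by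
products.

In these coordinates V acts as W⁻¹, and both corepresentation identities are the pentagon equation
W₂₃W₁₃W₁₂ = W₁₂W₂₃ (`pentagon`): the first is (W₂₃W₁₃)⁻¹ = W₁₂W₂₃⁻¹W₁₂⁻¹, the second (W₁₃W₁₂)⁻¹ =
W₂₃⁻¹W₁₂⁻¹W₂₃. -/

/-- The map `φ ⊗ ι : A ⊗ A → A` for a linear functional `φ` on `A`. -/
def sliceLeft (φ : A →ₗ[ℂ] ℂ) : A ⊗[ℂ] A →ₗ[ℂ] A :=
  (TensorProduct.lid ℂ A).toLinearMap ∘ₗ φ.rTensor A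

@[simp] theorem sliceLeft_tmul (φ : A →ₗ[ℂ] ℂ) (a b : A) :
    sliceLeft φ (a ⊗ₜ[ℂ] b) = φ a • b := by simp [sliceLeft]

/-- The operator `T ⊗ ι` on `A ⊗ (A ⊗ A)`. -/
def leftLegs (T : A ⊗[ℂ] A →ₗ[ℂ] A ⊗[ℂ] A) : A ⊗[ℂ] (A ⊗[ℂ] A) →ₗ[ℂ] A ⊗[ℂ] (A ⊗[ℂ] A) :=
  (TensorProduct.assoc ℂ A A A).toLinearMap ∘ₗ T.rTensor A ∘ₗ
    (TensorProduct.assoc ℂ A A A).symm.toLinearMap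

@[simp] theorem leftLegs_assoc (T : A ⊗[ℂ] A →ₗ[ℂ] A ⊗[ℂ] A) (w : A ⊗[ℂ] A) (c : A) :
    leftLegs T (TensorProduct.assoc ℂ A A A (w ⊗ₜ c)) = TensorProduct.assoc ℂ A A A (T w ⊗ₜ c) := by
  simp [leftLegs]

theorem leftLegs_tmul (T : A ⊗[ℂ] A →ₗ[ℂ] A ⊗[ℂ] A) (a b c : A) :
    leftLegs T (a ⊗ₜ (b ⊗ₜ c)) = TensorProduct.assoc ℂ A A A (T (a ⊗ₜ b) ⊗ₜ c) := by
  simp [leftLegs]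

theorem leftLegs_comp (S T : A ⊗[ℂ] A →ₗ[ℂ] A ⊗[ℂ] A) (x : A ⊗[ℂ] (A ⊗[ℂ] A)) :
    leftLegs S (leftLegs T x) = leftLegs (S ∘ₗ T) x := by
  simp [leftLegs, LinearMap.rTensor_comp]

theorem leftLegs_id (x : A ⊗[ℂ] (A ⊗[ℂ] A)) : leftLegs LinearMap.id x = x := by
  simp [leftLegs]

theorem lTensor_sliceLeft_assoc (ε : A →ₗ[ℂ] ℂ) (w : A ⊗[ℂ] A) (b : A) :
    (sliceLeft ε).lTensor A (TensorProduct.assoc ℂ A A A (w ⊗ₜ b)) = sliceRight ε w ⊗ₜ b := by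
  induction w with
  | zero => simp
  | add s t h h' => simp only [map_add, TensorProduct.add_tmul, h, h']
  | tmul p q => simp [TensorProduct.smul_tmul]

theorem rTensor_sliceRight_assoc_symm (ε : A →ₗ[ℂ] ℂ) (x : A ⊗[ℂ] (A ⊗[ℂ] A)) :
    (sliceRight ε).rTensor A ((TensorProduct.assoc ℂ A A A).symm x) =
      (sliceLeft ε).lTensor A x := by
  obtain ⟨x, rfl⟩ := (TensorProduct.assoc ℂ A A A).surjective x
  rw [LinearEquiv.symm_apply_apply]
  induction x with
  | zero => simp
  | add s t h h' => simp only [map_add, h, h']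
  | tmul p q => rw [lTensor_sliceLeft_assoc]; rfl

/-- Two bijections `T₁`, `T₂` of `A ⊗ A`, thought of as `a ⊗ b ↦ Δ(a)(1 ⊗ b)` and
`a ⊗ b ↦ (a ⊗ 1)Δ(b)` for a coproduct `Δ` on an algebra with product `m`. -/
structure IsCanonicalPair (m : A ⊗[ℂ] A →ₗ[ℂ] A) (T₁ T₂ : A ⊗[ℂ] A ≃ₗ[ℂ] A ⊗[ℂ] A) : Prop where
  comm : ∀ x, T₁.toLinearMap.lTensor A (leftLegs T₂.toLinearMap x) =
    leftLegs T₂.toLinearMap (T₁.toLinearMap.lTensor A x)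
  mul : ∀ x, m.lTensor A (leftLegs T₂.toLinearMap x) =
    m.rTensor A ((TensorProduct.assoc ℂ A A A).symm (T₁.toLinearMap.lTensor A x))
  assoc : ∀ x, m (m.lTensor A x) = m (m.rTensor A ((TensorProduct.assoc ℂ A A A).symm x))

namespace IsCanonicalPair

variable {m : A ⊗[ℂ] A →ₗ[ℂ] A} {T₁ T₂ : A ⊗[ℂ] A ≃ₗ[ℂ] A ⊗[ℂ] A}

/-- Comparing legs, both sides must be a scalar depending only on `b` times `a ⊗ c`. This scalar is
the counit of `b`. -/
theorem tmul_mul_symm (h : IsCanonicalPair m T₁ T₂) (a b c : A) :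
    a ⊗ₜ[ℂ] m (T₁.symm (b ⊗ₜ c)) = m (T₂.symm (a ⊗ₜ b)) ⊗ₜ[ℂ] c := by
  -- At `a ⊗ T₁⁻¹(b ⊗ c)`, `comm` moves `T₁` past `T₂` and `mul` evaluates the product. Substituting
  -- `T₂⁻¹(a ⊗ b)` for `a ⊗ b` afterwards gives the claim.
  have key : ∀ a b : A, (m ∘ₗ T₁.symm.toLinearMap).lTensor A
      (TensorProduct.assoc ℂ A A A (T₂ (a ⊗ₜ b) ⊗ₜ c)) = m (a ⊗ₜ b) ⊗ₜ c := by
    intro a b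
    have h1 := h.comm (a ⊗ₜ T₁.symm (b ⊗ₜ c))
    have h2 := h.mul (a ⊗ₜ T₁.symm (b ⊗ₜ c))
    rw [LinearMap.lTensor_tmul, LinearEquiv.coe_coe, LinearEquiv.apply_symm_apply] at h1 h2
    rw [leftLegs_tmul T₂.toLinearMap a b c] at h1
    rw [LinearEquiv.coe_coe] at h1
    rw [← h1, ← LinearMap.comp_apply, ← LinearMap.lTensor_comp, LinearMap.comp_assoc]
    simpa using h2
  have key' : ∀ w, (m ∘ₗ T₁.symm.toLinearMap).lTensor A
      (TensorProduct.assoc ℂ A A A (T₂ w ⊗ₜ c)) = m w ⊗ₜ c := by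
    intro w
    induction w with
    | zero => simp
    | add s t h h' => simp only [map_add, TensorProduct.add_tmul, h, h']
    | tmul p q => exact key p q
  simpa using key' (T₂.symm (a ⊗ₜ b))

/-- The counit of a canonical pair. -/
theorem exists_counit (h : IsCanonicalPair m T₁ T₂) :
    ∃ ε : A →ₗ[ℂ] ℂ, (∀ w, sliceLeft ε (T₁ w) = m w) ∧ ∀ w, sliceRight ε (T₂ w) = m w := by
  by_cases hA : ∀ a : A, a = 0
  · exact ⟨0, fun w => (hA _).trans (hA _).symm, fun w => (hA _).trans (hA _).symm⟩
  push Not at hA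
  obtain ⟨a₀, ha₀⟩ := hA
  obtain ⟨ω, hω⟩ := Module.Projective.exists_dual_ne_zero ℂ ha₀
  -- The scalar of `tmul_mul_symm`, read off at the nonzero vector `a₀` by a functional `ω` not
  -- vanishing there. Slicing the first leg by `ω` at `a = a₀` gives `h1`, slicing the second at `c
  -- = a₀` gives `h2`.
  let ε : A →ₗ[ℂ] ℂ := (ω a₀)⁻¹ • ω ∘ₗ m ∘ₗ T₂.symm.toLinearMap ∘ₗ TensorProduct.mk ℂ A A a₀
  have h1 : ∀ b c, m (T₁.symm (b ⊗ₜ c)) = ε b • c := by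
    intro b c
    have := congrArg (fun t => (ω a₀)⁻¹ • sliceLeft ω t) (h.tmul_mul_symm a₀ b c)
    simpa [ε, hω, smul_smul] using this
  have h2 : ∀ a b, m (T₂.symm (a ⊗ₜ b)) = ε b • a := by
    intro a b
    have := congrArg (fun t => (ω a₀)⁻¹ • sliceRight ω t) (h.tmul_mul_symm a b a₀)
    rw [h1] at this
    simpa [hω, smul_smul, mul_comm] using this.symm
  have h1' : ∀ w, sliceLeft ε w = m (T₁.symm w) := by
    intro w
    induction w with
    | zero => simp
    | add s t h h' => simp only [map_add, h, h']
    | tmul p q => rw [h1, sliceLeft_tmul]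
  have h2' : ∀ w, sliceRight ε w = m (T₂.symm w) := by
    intro w
    induction w with
    | zero => simp
    | add s t h h' => simp only [map_add, h, h']
    | tmul p q => rw [h2, sliceRight_tmul]
  exact ⟨ε, fun w => by simp [h1'], fun w => by simp [h2']⟩

variable {ε : A →ₗ[ℂ] ℂ}

theorem lTensor_symm_leftLegs (h : IsCanonicalPair m T₁ T₂) (x : A ⊗[ℂ] (A ⊗[ℂ] A)) :
    T₁.symm.toLinearMap.lTensor A (leftLegs T₂.toLinearMap x) =
      leftLegs T₂.toLinearMap (T₁.symm.toLinearMap.lTensor A x) := by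
  have e : ∀ x : A ⊗[ℂ] (A ⊗[ℂ] A), T₁.symm.toLinearMap.lTensor A
      (T₁.toLinearMap.lTensor A x) = x := fun x => by
    rw [← LinearMap.comp_apply, ← LinearMap.lTensor_comp]; simp
  have e' : ∀ x : A ⊗[ℂ] (A ⊗[ℂ] A), T₁.toLinearMap.lTensor A
      (T₁.symm.toLinearMap.lTensor A x) = x := fun x => by
    rw [← LinearMap.comp_apply, ← LinearMap.lTensor_comp]; simp
  conv_lhs => rw [← e' x]
  rw [← h.comm, e]

theorem leftLegs_symm_lTensor (h : IsCanonicalPair m T₁ T₂) (x : A ⊗[ℂ] (A ⊗[ℂ] A)) :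
    leftLegs T₂.symm.toLinearMap (T₁.toLinearMap.lTensor A x) =
      T₁.toLinearMap.lTensor A (leftLegs T₂.symm.toLinearMap x) := by
  have e : ∀ x : A ⊗[ℂ] (A ⊗[ℂ] A), leftLegs T₂.symm.toLinearMap
      (leftLegs T₂.toLinearMap x) = x := fun x => by
    rw [leftLegs_comp]; simp [leftLegs_id]
  have e' : ∀ x : A ⊗[ℂ] (A ⊗[ℂ] A), leftLegs T₂.toLinearMap
      (leftLegs T₂.symm.toLinearMap x) = x := fun x => by
    rw [leftLegs_comp]; simp [leftLegs_id]
  conv_lhs => rw [← e' x]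
  rw [h.comm, e]

/-- `(z ⊗ 1) T₁⁻¹(a ⊗ b) = z a₁ ⊗ S(a₂) b`. -/
theorem mul_tmul_symm (h : IsCanonicalPair m T₁ T₂) (hε : ∀ w, sliceRight ε (T₂ w) = m w)
    (z a b : A) :
    m.rTensor A ((TensorProduct.assoc ℂ A A A).symm (z ⊗ₜ T₁.symm (a ⊗ₜ b))) =
      (sliceLeft ε ∘ₗ T₁.symm.toLinearMap).lTensor A
        (TensorProduct.assoc ℂ A A A (T₂ (z ⊗ₜ a) ⊗ₜ b)) := by
  have hm : m = sliceRight ε ∘ₗ T₂.toLinearMap := LinearMap.ext fun w => (hε w).symm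
  have h1 := h.lTensor_symm_leftLegs (z ⊗ₜ (a ⊗ₜ b))
  rw [leftLegs_tmul] at h1
  rw [LinearMap.lTensor_comp, LinearMap.comp_apply]
  erw [h1]
  rw [← rTensor_sliceRight_assoc_symm, hm, LinearMap.rTensor_comp]
  simp [leftLegs]

/-- `T₂⁻¹(z ⊗ a) (1 ⊗ b) = z S(a₁) ⊗ a₂ b`. -/
theorem symm_mul_tmul (h : IsCanonicalPair m T₁ T₂) (hε : ∀ w, sliceLeft ε (T₁ w) = m w)
    (z a b : A) :
    m.lTensor A (TensorProduct.assoc ℂ A A A (T₂.symm (z ⊗ₜ a) ⊗ₜ b)) =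
      (sliceRight ε ∘ₗ T₂.symm.toLinearMap).rTensor A
        ((TensorProduct.assoc ℂ A A A).symm (z ⊗ₜ T₁ (a ⊗ₜ b))) := by
  have hm : m = sliceLeft ε ∘ₗ T₁.toLinearMap := LinearMap.ext fun w => (hε w).symm
  have h1 := h.leftLegs_symm_lTensor (z ⊗ₜ (a ⊗ₜ b))
  rw [leftLegs_tmul] at h1
  rw [hm, LinearMap.lTensor_comp, LinearMap.comp_apply]
  erw [← h1]
  rw [← rTensor_sliceRight_assoc_symm, LinearMap.rTensor_comp]
  simp [leftLegs]

/-- `c (S(a) b) = (c S(a)) b`. -/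
theorem mul_antipode (h : IsCanonicalPair m T₁ T₂) (hε : ∀ w, sliceLeft ε (T₁ w) = m w)
    (hε' : ∀ w, sliceRight ε (T₂ w) = m w) (a b c : A) :
    m (c ⊗ₜ sliceLeft ε (T₁.symm (a ⊗ₜ b))) = m (sliceRight ε (T₂.symm (c ⊗ₜ a)) ⊗ₜ b) := by
  -- Multiplying the last two legs of this element gives `c S(a) ⊗ b` (`e1`), multiplying the first
  -- two gives `c ⊗ S(a) b` (`e2`). Associativity of `m` equates the two total products.
  have h0 := h.assoc (leftLegs T₂.symm.toLinearMap (c ⊗ₜ T₁.symm (a ⊗ₜ b)))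
  have hm : m = sliceLeft ε ∘ₗ T₁.toLinearMap := LinearMap.ext fun w => (hε w).symm
  have hm' : m = sliceRight ε ∘ₗ T₂.toLinearMap := LinearMap.ext fun w => (hε' w).symm
  have e1 : m.lTensor A (leftLegs T₂.symm.toLinearMap (c ⊗ₜ T₁.symm (a ⊗ₜ b))) =
      sliceRight ε (T₂.symm (c ⊗ₜ a)) ⊗ₜ b := by
    conv_lhs => rw [hm]
    rw [LinearMap.lTensor_comp, LinearMap.comp_apply, ← h.leftLegs_symm_lTensor,
      LinearMap.lTensor_tmul, LinearEquiv.coe_coe, LinearEquiv.apply_symm_apply, leftLegs_tmul,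
      lTensor_sliceLeft_assoc]
    rfl
  have e2 : m.rTensor A ((TensorProduct.assoc ℂ A A A).symm
      (leftLegs T₂.symm.toLinearMap (c ⊗ₜ T₁.symm (a ⊗ₜ b)))) =
      c ⊗ₜ sliceLeft ε (T₁.symm (a ⊗ₜ b)) := by
    have : ∀ x : A ⊗[ℂ] (A ⊗[ℂ] A), m.rTensor A ((TensorProduct.assoc ℂ A A A).symm
        (leftLegs T₂.symm.toLinearMap x)) = (sliceLeft ε).lTensor A x := by
      intro x
      rw [hm', LinearMap.rTensor_comp, LinearMap.comp_apply, ← rTensor_sliceRight_assoc_symm]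
      have e : leftLegs T₂.toLinearMap (leftLegs T₂.symm.toLinearMap x) = x := by
        rw [leftLegs_comp]; simp [leftLegs_id]
      conv_rhs => rw [← e]
      simp [leftLegs]
    rw [this, LinearMap.lTensor_tmul]
  rw [e1, e2] at h0
  exact h0.symm

end IsCanonicalPair

end AbstractAntipode

/-! ### The canonical maps of an algebraic quantum group -/

section CanonicalMaps

variable {A : Type*} [NonUnitalRing A] [Module ℂ A] [IsScalarTower ℂ A A] [SMulCommClass ℂ A A]

/-- `w ↦ (x ⊗ 1) w`. -/
def mulL₁ (x : A) : A ⊗[ℂ] A →ₗ[ℂ] A ⊗[ℂ] A := (LinearMap.mulLeft ℂ x).rTensor A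

/-- `w ↦ (1 ⊗ x) w`. -/
def mulL₂ (x : A) : A ⊗[ℂ] A →ₗ[ℂ] A ⊗[ℂ] A := (LinearMap.mulLeft ℂ x).lTensor A

/-- `w ↦ w (x ⊗ 1)`. -/
def mulR₁ (x : A) : A ⊗[ℂ] A →ₗ[ℂ] A ⊗[ℂ] A := (LinearMap.mulRight ℂ x).rTensor A

/-- `w ↦ w (1 ⊗ x)`. -/
def mulR₂ (x : A) : A ⊗[ℂ] A →ₗ[ℂ] A ⊗[ℂ] A := (LinearMap.mulRight ℂ x).lTensor A

@[simp] theorem mulL₁_tmul (x a b : A) : mulL₁ x (a ⊗ₜ b) = (x * a) ⊗ₜ b := rfl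

@[simp] theorem mulL₂_tmul (x a b : A) : mulL₂ x (a ⊗ₜ b) = a ⊗ₜ (x * b) := rfl

@[simp] theorem mulR₁_tmul (x a b : A) : mulR₁ x (a ⊗ₜ b) = (a * x) ⊗ₜ b := rfl

@[simp] theorem mulR₂_tmul (x a b : A) : mulR₂ x (a ⊗ₜ b) = a ⊗ₜ (b * x) := rfl

theorem incl_mulL₁ (x : A) (w : A ⊗[ℂ] A) :
    incl (A ⊗[ℂ] A) (mulL₁ x w) = tmul (incl A x) 1 * incl (A ⊗[ℂ] A) w := by
  induction w with
  | zero => simp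
  | add s t h h' => simp only [map_add, mul_add, h, h']
  | tmul p q => exact Mult.ext_tmul (by simp [mul_assoc]) (by simp [mul_assoc])

theorem incl_mulL₂ (x : A) (w : A ⊗[ℂ] A) :
    incl (A ⊗[ℂ] A) (mulL₂ x w) = tmul 1 (incl A x) * incl (A ⊗[ℂ] A) w := by
  induction w with
  | zero => simp
  | add s t h h' => simp only [map_add, mul_add, h, h']
  | tmul p q => exact Mult.ext_tmul (by simp [mul_assoc]) (by simp [mul_assoc])

theorem incl_mulR₁ (x : A) (w : A ⊗[ℂ] A) :
    incl (A ⊗[ℂ] A) (mulR₁ x w) = incl (A ⊗[ℂ] A) w * tmul (incl A x) 1 := by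
  induction w with
  | zero => simp
  | add s t h h' => simp only [map_add, add_mul, h, h']
  | tmul p q => exact Mult.ext_tmul (by simp [mul_assoc]) (by simp [mul_assoc])

theorem incl_mulR₂ (x : A) (w : A ⊗[ℂ] A) :
    incl (A ⊗[ℂ] A) (mulR₂ x w) = incl (A ⊗[ℂ] A) w * tmul 1 (incl A x) := by
  induction w with
  | zero => simp
  | add s t h h' => simp only [map_add, add_mul, h, h']
  | tmul p q => exact Mult.ext_tmul (by simp [mul_assoc]) (by simp [mul_assoc])

theorem incl_lmul {X : Type*} [NonUnitalRing X] [Module ℂ X] [IsScalarTower ℂ X X]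
    [SMulCommClass ℂ X X] (m : Mult X) (x : X) : incl X (m.lmul x) = m * incl X x :=
  Mult.ext (fun y => by simp [m.lmul_mul_apply]) (fun y => by simp [m.rmul_mul])

theorem incl_rmul {X : Type*} [NonUnitalRing X] [Module ℂ X] [IsScalarTower ℂ X X]
    [SMulCommClass ℂ X X] (m : Mult X) (x : X) : incl X (m.rmul x) = incl X x * m :=
  Mult.ext (fun y => by simp [m.rmul_mul]) (fun y => by simp [m.rmul_mul_apply])

/-- Equalities in `A ⊗ A` can thus be checked in `M(A ⊗ A)`, where factors such as Δ(a), a ⊗ 1 and 1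
⊗ b may be reassociated freely. -/
theorem incl_injective {X : Type*} [NonUnitalRing X] [Module ℂ X] [IsScalarTower ℂ X X]
    [SMulCommClass ℂ X X] [NondegenerateMul X] : Function.Injective (incl X) := fun _ _ h =>
  AlgebraicQuantumGroup.eq_of_mul fun z => congrArg (fun m => m.lmul z) h

theorem eq_of_mul_left {X : Type*} [NonUnitalRing X] [NondegenerateMul X] {s t : X}
    (h : ∀ x, x * s = x * t) : s = t := by
  rw [← sub_eq_zero]
  exact NondegenerateMul.eq_zero_of_mul_left _ fun x => by rw [mul_sub, h, sub_self]

end CanonicalMaps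

namespace AlgebraicQuantumGroup

variable {A : Type*} [NonUnitalRing A] [Module ℂ A] [IsScalarTower ℂ A A] [SMulCommClass ℂ A A]
  [NondegenerateMul A] (Q : AlgebraicQuantumGroup A)

/-- The bijection `a ⊗ b ↦ Δ(a)(1 ⊗ b)`. -/
def can₁ : A ⊗[ℂ] A ≃ₗ[ℂ] A ⊗[ℂ] A := Q.exists_equiv_comul_mul_right.choose

/-- The bijection `a ⊗ b ↦ (a ⊗ 1)Δ(b)`. -/
def can₂ : A ⊗[ℂ] A ≃ₗ[ℂ] A ⊗[ℂ] A := Q.exists_equiv_left_mul_comul.choose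

/-- The bijection `a ⊗ b ↦ Δ(b)(a ⊗ 1)`. -/
def can₃ : A ⊗[ℂ] A ≃ₗ[ℂ] A ⊗[ℂ] A :=
  TensorProduct.comm ℂ A A ≪≫ₗ Q.exists_equiv_comul_mul_left.choose

/-- The bijection `a ⊗ b ↦ (1 ⊗ b)Δ(a)`. -/
def can₄ : A ⊗[ℂ] A ≃ₗ[ℂ] A ⊗[ℂ] A :=
  TensorProduct.comm ℂ A A ≪≫ₗ Q.exists_equiv_right_mul_comul.choose

theorem incl_can₁ (a b : A) :
    incl (A ⊗[ℂ] A) (Q.can₁ (a ⊗ₜ b)) = Q.comul a * tmul 1 (incl A b) :=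
  Q.exists_equiv_comul_mul_right.choose_spec a b

theorem incl_can₂ (a b : A) :
    incl (A ⊗[ℂ] A) (Q.can₂ (a ⊗ₜ b)) = tmul (incl A a) 1 * Q.comul b :=
  Q.exists_equiv_left_mul_comul.choose_spec a b

theorem incl_can₃ (a b : A) :
    incl (A ⊗[ℂ] A) (Q.can₃ (a ⊗ₜ b)) = Q.comul b * tmul (incl A a) 1 :=
  Q.exists_equiv_comul_mul_left.choose_spec b a

theorem incl_can₄ (a b : A) :
    incl (A ⊗[ℂ] A) (Q.can₄ (a ⊗ₜ b)) = tmul 1 (incl A b) * Q.comul a :=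
  Q.exists_equiv_right_mul_comul.choose_spec b a

/-- The map `w ↦ Δ(a) w`. -/
abbrev comulLeft (a : A) : A ⊗[ℂ] A →ₗ[ℂ] A ⊗[ℂ] A := (Q.comul a).lmul

/-- The map `w ↦ w Δ(a)`. -/
abbrev comulRight (a : A) : A ⊗[ℂ] A →ₗ[ℂ] A ⊗[ℂ] A := (Q.comul a).rmul

theorem mulR₁_can₁ (a b x : A) : mulR₁ x (Q.can₁ (a ⊗ₜ b)) = Q.comulLeft a (x ⊗ₜ b) :=
  incl_injective (by
    rw [incl_mulR₁, incl_can₁, incl_lmul, mul_assoc]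
    exact congrArg _ (Mult.ext_tmul (by simp) (by simp)))

theorem mulR₂_can₃ (a b x : A) : mulR₂ x (Q.can₃ (a ⊗ₜ b)) = Q.comulLeft b (a ⊗ₜ x) :=
  incl_injective (by
    rw [incl_mulR₂, incl_can₃, incl_lmul, mul_assoc]
    exact congrArg _ (Mult.ext_tmul (by simp) (by simp)))

theorem mulL₂_can₂ (a b x : A) : mulL₂ x (Q.can₂ (a ⊗ₜ b)) = Q.comulRight b (a ⊗ₜ x) :=
  incl_injective (by
    rw [incl_mulL₂, incl_can₂, incl_rmul, ← mul_assoc]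
    exact congrArg (· * _) (Mult.ext_tmul (by simp) (by simp)))

theorem mulL₁_can₄ (a b x : A) : mulL₁ x (Q.can₄ (a ⊗ₜ b)) = Q.comulRight a (x ⊗ₜ b) :=
  incl_injective (by
    rw [incl_mulL₁, incl_can₄, incl_rmul, ← mul_assoc]
    exact congrArg (· * _) (Mult.ext_tmul (by simp) (by simp)))

/-- Both are (x ⊗ 1)Δ(a)(1 ⊗ b). This and the next three exchange rules pass from one canonical map
to another once a leg has been cut by an element of A. -/
theorem mulL₁_can₁ (a b x : A) :
    mulL₁ x (Q.can₁ (a ⊗ₜ b)) = mulR₂ b (Q.can₂ (x ⊗ₜ a)) :=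
  incl_injective (by rw [incl_mulL₁, incl_can₁, incl_mulR₂, incl_can₂, mul_assoc])

theorem mulL₂_can₃ (a b x : A) :
    mulL₂ x (Q.can₃ (a ⊗ₜ b)) = mulR₁ a (Q.can₄ (b ⊗ₜ x)) :=
  incl_injective (by rw [incl_mulL₂, incl_can₃, incl_mulR₁, incl_can₄, mul_assoc])

theorem mulL₁_can₃ (a b x : A) :
    mulL₁ x (Q.can₃ (a ⊗ₜ b)) = mulR₁ a (Q.can₂ (x ⊗ₜ b)) :=
  incl_injective (by rw [incl_mulL₁, incl_can₃, incl_mulR₁, incl_can₂, mul_assoc])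

theorem mulL₂_can₁ (a b x : A) :
    mulL₂ x (Q.can₁ (a ⊗ₜ b)) = mulR₂ b (Q.can₄ (a ⊗ₜ x)) :=
  incl_injective (by rw [incl_mulL₂, incl_can₁, incl_mulR₂, incl_can₄, mul_assoc])

/-- Multiplicativity of Δ: Δ(a)Δ(p)(1 ⊗ q) = Δ(ap)(1 ⊗ q). Each canonical map turns multiplication
by Δ(a) into multiplication on one leg; combined with an invariance property, this is how Δ is
removed in the integral computations below. -/
theorem comulLeft_can₁ (a : A) (w : A ⊗[ℂ] A) :
    Q.comulLeft a (Q.can₁ w) = Q.can₁ (mulL₁ a w) := by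
  induction w with
  | zero => simp
  | add s t h h' => simp only [map_add, h, h']
  | tmul p q =>
    exact incl_injective (by
      rw [incl_lmul, incl_can₁, mulL₁_tmul, incl_can₁, ← mul_assoc, ← map_mul])

theorem comulLeft_can₃ (a : A) (w : A ⊗[ℂ] A) :
    Q.comulLeft a (Q.can₃ w) = Q.can₃ (mulL₂ a w) := by
  induction w with
  | zero => simp
  | add s t h h' => simp only [map_add, h, h']
  | tmul p q =>
    exact incl_injective (by
      rw [incl_lmul, incl_can₃, mulL₂_tmul, incl_can₃, ← mul_assoc, ← map_mul])

theorem comulRight_can₂ (a : A) (w : A ⊗[ℂ] A) :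
    Q.comulRight a (Q.can₂ w) = Q.can₂ (mulR₂ a w) := by
  induction w with
  | zero => simp
  | add s t h h' => simp only [map_add, h, h']
  | tmul p q =>
    exact incl_injective (by
      rw [incl_rmul, incl_can₂, mulR₂_tmul, incl_can₂, mul_assoc, ← map_mul])

theorem comulRight_can₄ (a : A) (w : A ⊗[ℂ] A) :
    Q.comulRight a (Q.can₄ w) = Q.can₄ (mulR₁ a w) := by
  induction w with
  | zero => simp
  | add s t h h' => simp only [map_add, h, h']
  | tmul p q =>
    exact incl_injective (by
      rw [incl_rmul, incl_can₄, mulR₁_tmul, incl_can₄, mul_assoc, ← map_mul])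

theorem can₄_mulL₂ (a : A) (w : A ⊗[ℂ] A) : Q.can₄ (mulL₂ a w) = mulL₂ a (Q.can₄ w) := by
  induction w with
  | zero => simp
  | add s t h h' => simp only [map_add, h, h']
  | tmul p q =>
    exact incl_injective (by
      rw [incl_mulL₂, incl_can₄, mulL₂_tmul, incl_can₄, ← mul_assoc]
      exact congrArg (· * _) (Mult.ext_tmul (by simp) (by simp)))

/-! ### Coassociativity in terms of the canonical maps -/

/-- On `a ⊗ b ⊗ c` the two sides are the two ways of forming (a ⊗ 1 ⊗ 1)Δ⁽²⁾(b)(1 ⊗ 1 ⊗ c), so this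
is the coassociativity axiom freed from multipliers. -/
theorem lTensor_can₁_leftLegs_can₂ (x : A ⊗[ℂ] (A ⊗[ℂ] A)) :
    Q.can₁.toLinearMap.lTensor A (leftLegs Q.can₂.toLinearMap x) =
      leftLegs Q.can₂.toLinearMap (Q.can₁.toLinearMap.lTensor A x) := by
  have key : ∀ a b c : A, Q.can₁.toLinearMap.lTensor A (leftLegs Q.can₂.toLinearMap
      (a ⊗ₜ (b ⊗ₜ c))) = leftLegs Q.can₂.toLinearMap (a ⊗ₜ Q.can₁ (b ⊗ₜ c)) := by
    intro a b c
    apply incl_injective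
    have h := Q.coassoc a b c _ _ (Q.incl_can₁ b c) (Q.incl_can₂ a b)
    -- One side of the axiom for arbitrary `s`, by linearity, since it is needed at `s = can₁ (b ⊗
    -- c)`, which is not elementary. `h2` treats the other side likewise.
    have h1 : ∀ s : A ⊗[ℂ] A, tmul (incl A a) 1 * multAssoc (tensorHom Q.comul (incl A) s) =
        incl _ (leftLegs Q.can₂.toLinearMap (a ⊗ₜ s)) := by
      intro s
      induction s with
      | zero => simp
      | add s t h h' => simp only [map_add, mul_add, TensorProduct.tmul_add, h, h']
      | tmul p q =>
        rw [leftLegs_tmul, tensorHom_tmul, LinearEquiv.coe_coe]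
        have : ∀ w : A ⊗[ℂ] A, incl _ (TensorProduct.assoc ℂ A A A (w ⊗ₜ q)) =
            multAssoc (tmul (incl _ w) (incl A q)) := by
          intro w
          refine Mult.ext (fun y => ?_) (fun y => ?_)
          · obtain ⟨y, rfl⟩ := (TensorProduct.assoc ℂ A A A).surjective y
            rw [lmul_incl, ← assoc_mul]
            simp only [multAssoc, Mult.congr, AlgHom.coe_mk, RingHom.coe_mk, MonoidHom.coe_mk,
              OneHom.coe_mk, Mult.lmul_mk, LinearMap.comp_apply, LinearEquiv.coe_coe,
              LinearEquiv.symm_apply_apply]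
            congr 1
            induction y with
            | zero => simp
            | add s t h h' => simp only [map_add, mul_add, h, h']
            | tmul p q => simp
          · obtain ⟨y, rfl⟩ := (TensorProduct.assoc ℂ A A A).surjective y
            rw [rmul_incl, ← assoc_mul]
            simp only [multAssoc, Mult.congr, AlgHom.coe_mk, RingHom.coe_mk, MonoidHom.coe_mk,
              OneHom.coe_mk, Mult.rmul_mk, LinearMap.comp_apply, LinearEquiv.coe_coe,
              LinearEquiv.symm_apply_apply]
            congr 1
            induction y with
            | zero => simp
            | add s t h h' => simp only [map_add, add_mul, h, h']
            | tmul p q => simp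
        rw [this, incl_can₂]
        have e : (tmul (incl A a) (1 : Mult (A ⊗[ℂ] A))) =
            multAssoc (tmul (tmul (incl A a) (1 : Mult A)) (1 : Mult A)) := by
          refine Mult.ext (fun y => ?_) (fun y => ?_)
          · obtain ⟨y, rfl⟩ := (TensorProduct.assoc ℂ A A A).surjective y
            simp only [multAssoc, Mult.congr, AlgHom.coe_mk, RingHom.coe_mk, MonoidHom.coe_mk,
              OneHom.coe_mk, Mult.lmul_mk, LinearMap.comp_apply, LinearEquiv.coe_coe,
              LinearEquiv.symm_apply_apply]
            induction y with
            | zero => simp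
            | add s t h h' => simp only [map_add, h, h']
            | tmul p q =>
              induction p with
              | zero => simp
              | add s t h h' => simp only [map_add, TensorProduct.add_tmul, h, h']
              | tmul p r => simp
          · obtain ⟨y, rfl⟩ := (TensorProduct.assoc ℂ A A A).surjective y
            simp only [multAssoc, Mult.congr, AlgHom.coe_mk, RingHom.coe_mk, MonoidHom.coe_mk,
              OneHom.coe_mk, Mult.rmul_mk, LinearMap.comp_apply, LinearEquiv.coe_coe,
              LinearEquiv.symm_apply_apply]
            induction y with
            | zero => simp
            | add s t h h' => simp only [map_add, h, h']
            | tmul p q =>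
              induction p with
              | zero => simp
              | add s t h h' => simp only [map_add, TensorProduct.add_tmul, h, h']
              | tmul p r => simp
        rw [e, ← map_mul]
        exact congrArg _ (Mult.ext_tmul (by simp) (by simp))
    have h2 : ∀ t : A ⊗[ℂ] A, tensorHom (incl A) Q.comul t * tmul 1 (tmul 1 (incl A c)) =
        incl _ (Q.can₁.toLinearMap.lTensor A (TensorProduct.assoc ℂ A A A (t ⊗ₜ c))) := by
      intro t
      induction t with
      | zero => simp
      | add s t h h' => simp only [map_add, add_mul, TensorProduct.add_tmul, h, h']
      | tmul p q =>
        rw [TensorProduct.assoc_tmul, LinearMap.lTensor_tmul, LinearEquiv.coe_coe, tensorHom_tmul]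
        have : incl _ (p ⊗ₜ[ℂ] Q.can₁ (q ⊗ₜ c)) = tmul (incl A p) (incl _ (Q.can₁ (q ⊗ₜ c))) :=
          Mult.ext_tmul (by simp) (by simp)
        rw [this, incl_can₁]
        exact Mult.ext_tmul (by simp) (by simp)
    rw [leftLegs_tmul, LinearEquiv.coe_coe, ← h1, ← h2, h]
  induction x with
  | zero => simp
  | add s t h h' => simp only [map_add, h, h']
  | tmul a w =>
    induction w with
    | zero => simp
    | add s t h h' => simp only [map_add, TensorProduct.tmul_add, h, h']
    | tmul b c => exact key a b c

end AlgebraicQuantumGroup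

/-! ### Counit, antipode and faithfulness of the integral -/

section Slices

variable {A : Type*} [NonUnitalRing A] [Module ℂ A] [IsScalarTower ℂ A A] [SMulCommClass ℂ A A]

theorem sliceLeft_mulL₂ (φ : A →ₗ[ℂ] ℂ) (x : A) (w : A ⊗[ℂ] A) :
    sliceLeft φ (mulL₂ x w) = x * sliceLeft φ w := by
  induction w with
  | zero => simp
  | add s t h h' => simp only [map_add, mul_add, h, h']
  | tmul p q => simp [mul_smul_comm]

theorem sliceLeft_mulR₂ (φ : A →ₗ[ℂ] ℂ) (x : A) (w : A ⊗[ℂ] A) :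
    sliceLeft φ (mulR₂ x w) = sliceLeft φ w * x := by
  induction w with
  | zero => simp
  | add s t h h' => simp only [map_add, add_mul, h, h']
  | tmul p q => simp [smul_mul_assoc]

theorem sliceRight_mulL₁ (φ : A →ₗ[ℂ] ℂ) (x : A) (w : A ⊗[ℂ] A) :
    sliceRight φ (mulL₁ x w) = x * sliceRight φ w := by
  induction w with
  | zero => simp
  | add s t h h' => simp only [map_add, mul_add, h, h']
  | tmul p q => simp [mul_smul_comm]

theorem sliceRight_mulR₁ (φ : A →ₗ[ℂ] ℂ) (x : A) (w : A ⊗[ℂ] A) :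
    sliceRight φ (mulR₁ x w) = sliceRight φ w * x := by
  induction w with
  | zero => simp
  | add s t h h' => simp only [map_add, add_mul, h, h']
  | tmul p q => simp [smul_mul_assoc]

theorem sliceLeft_surjective {φ : A →ₗ[ℂ] ℂ} (hφ : φ ≠ 0) :
    Function.Surjective (sliceLeft φ) := by
  intro a
  obtain ⟨p, hp⟩ : ∃ p, φ p ≠ 0 := by
    by_contra! h
    exact hφ (LinearMap.ext h)
  exact ⟨p ⊗ₜ ((φ p)⁻¹ • a), by simp [hp]⟩

theorem sliceRight_surjective {φ : A →ₗ[ℂ] ℂ} (hφ : φ ≠ 0) :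
    Function.Surjective (sliceRight φ) := by
  intro a
  obtain ⟨p, hp⟩ : ∃ p, φ p ≠ 0 := by
    by_contra! h
    exact hφ (LinearMap.ext h)
  exact ⟨((φ p)⁻¹ • a) ⊗ₜ p, by simp [hp]⟩

theorem rTensor_assoc_tmul (f : A →ₗ[ℂ] A) (w : A ⊗[ℂ] A) (q : A) :
    f.rTensor (A ⊗[ℂ] A) (TensorProduct.assoc ℂ A A A (w ⊗ₜ q)) =
      TensorProduct.assoc ℂ A A A (f.rTensor A w ⊗ₜ q) := by
  induction w with
  | zero => simp
  | add s t h h' => simp only [map_add, TensorProduct.add_tmul, h, h']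
  | tmul a b => rfl

theorem leftLegs_lTensor_lTensor (T : A ⊗[ℂ] A →ₗ[ℂ] A ⊗[ℂ] A) (f : A →ₗ[ℂ] A)
    (x : A ⊗[ℂ] (A ⊗[ℂ] A)) :
    leftLegs T ((f.lTensor A).lTensor A x) = (f.lTensor A).lTensor A (leftLegs T x) := by
  have h : ∀ (w : A ⊗[ℂ] A) (q : A), (f.lTensor A).lTensor A
      (TensorProduct.assoc ℂ A A A (w ⊗ₜ q)) = TensorProduct.assoc ℂ A A A (w ⊗ₜ f q) := by
    intro w q
    induction w with
    | zero => simp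
    | add s t h h' => simp only [map_add, TensorProduct.add_tmul, h, h']
    | tmul a b => rfl
  obtain ⟨x, rfl⟩ := (TensorProduct.assoc ℂ A A A).surjective x
  induction x with
  | zero => simp
  | add s t h h' => simp only [map_add, h, h']
  | tmul w q => rw [h, leftLegs_assoc, leftLegs_assoc, h]

theorem lTensor_mul'_assoc (w : A ⊗[ℂ] A) (c : A) :
    (LinearMap.mul' ℂ A).lTensor A (TensorProduct.assoc ℂ A A A (w ⊗ₜ c)) = mulR₂ c w := by
  induction w with
  | zero => simp
  | add s t h h' => simp only [map_add, TensorProduct.add_tmul, h, h']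
  | tmul a b => rfl

theorem rTensor_mul'_assoc_symm (w : A ⊗[ℂ] A) (c : A) :
    (LinearMap.mul' ℂ A).rTensor A ((TensorProduct.assoc ℂ A A A).symm (c ⊗ₜ w)) = mulL₁ c w := by
  induction w with
  | zero => simp
  | add s t h h' => simp only [map_add, TensorProduct.tmul_add, h, h']
  | tmul a b => rfl

/-- Cutting the first leg from the left and the last from the right loses nothing, by
non-degeneracy, and brings the exchange rules into play. -/
theorem triple_ext [NondegenerateMul A] {s t : A ⊗[ℂ] (A ⊗[ℂ] A)}
    (h : ∀ x y : A, (LinearMap.mulLeft ℂ x).rTensor (A ⊗[ℂ] A) ((mulR₂ y).lTensor A s) =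
      (LinearMap.mulLeft ℂ x).rTensor (A ⊗[ℂ] A) ((mulR₂ y).lTensor A t)) : s = t := by
  refine sub_eq_zero.1 ?_
  refine lTensor_separating (fun z : A => mulR₂ z)
      (fun w h => lTensor_separating (fun z : A => LinearMap.mulRight ℂ z)
      (fun y h => NondegenerateMul.eq_zero_of_mul_right y h) w h) _ fun y => ?_
  refine rTensor_separating (fun x : A => LinearMap.mulLeft ℂ x)
    (fun x h => NondegenerateMul.eq_zero_of_mul_left x h) _ fun x => ?_
  rw [map_sub, map_sub, h, sub_self]

end Slices

/-! ### The opposite canonical pair, the counit, the antipode and faithfulness -/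

namespace AlgebraicQuantumGroup

variable {A : Type*} [NonUnitalRing A] [Module ℂ A] [IsScalarTower ℂ A A] [SMulCommClass ℂ A A]
  [NondegenerateMul A] (Q : AlgebraicQuantumGroup A)

/-- Coassociativity for the opposite product is not a separate axiom: after cutting by `x ⊗ 1 ⊗ 1`
on the left and `1 ⊗ 1 ⊗ y` on the right, `can₃` becomes `can₂` and `can₄` becomes `can₁`. -/
theorem lTensor_can₄_leftLegs_can₃ (x : A ⊗[ℂ] (A ⊗[ℂ] A)) :
    Q.can₄.toLinearMap.lTensor A (leftLegs Q.can₃.toLinearMap x) =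
      leftLegs Q.can₃.toLinearMap (Q.can₄.toLinearMap.lTensor A x) := by
  have h1 : ∀ (w : A ⊗[ℂ] A) (c y : A), (mulR₂ y).lTensor A (Q.can₄.toLinearMap.lTensor A
      (TensorProduct.assoc ℂ A A A (w ⊗ₜ c))) = (mulL₂ c).lTensor A
      (Q.can₁.toLinearMap.lTensor A (TensorProduct.assoc ℂ A A A (w ⊗ₜ y))) := by
    intro w c y
    induction w with
    | zero => simp
    | add s t h h' => simp only [map_add, TensorProduct.add_tmul, h, h']
    | tmul p q => simp [mulL₂_can₁]
  have h2 : ∀ (s : A ⊗[ℂ] A) (a x : A), (LinearMap.mulLeft ℂ x).rTensor (A ⊗[ℂ] A)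
      (leftLegs Q.can₃.toLinearMap (a ⊗ₜ s)) = (LinearMap.mulRight ℂ a).rTensor (A ⊗[ℂ] A)
      (leftLegs Q.can₂.toLinearMap (x ⊗ₜ s)) := by
    intro s a x
    induction s with
    | zero => simp
    | add s t h h' => simp only [map_add, TensorProduct.tmul_add, h, h']
    | tmul p q =>
      rw [leftLegs_tmul, leftLegs_tmul, rTensor_assoc_tmul, rTensor_assoc_tmul]
      exact congrArg (fun w => TensorProduct.assoc ℂ A A A (w ⊗ₜ q)) (Q.mulL₁_can₃ a p x)
  have hc : ∀ (f : A →ₗ[ℂ] A) (g : A ⊗[ℂ] A →ₗ[ℂ] A ⊗[ℂ] A) (x : A ⊗[ℂ] (A ⊗[ℂ] A)),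
      f.rTensor (A ⊗[ℂ] A) (g.lTensor A x) = g.lTensor A (f.rTensor (A ⊗[ℂ] A) x) := by
    intro f g x
    rw [← LinearMap.comp_apply, ← LinearMap.comp_apply, LinearMap.lTensor_comp_rTensor,
        LinearMap.rTensor_comp_lTensor]
  have key : ∀ a b c : A, Q.can₄.toLinearMap.lTensor A (leftLegs Q.can₃.toLinearMap
      (a ⊗ₜ (b ⊗ₜ c))) = leftLegs Q.can₃.toLinearMap (a ⊗ₜ Q.can₄ (b ⊗ₜ c)) := by
    intro a b c
    refine triple_ext fun x y => ?_
    have e : (mulR₂ y).lTensor A (leftLegs Q.can₃.toLinearMap (a ⊗ₜ Q.can₄ (b ⊗ₜ c))) =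
        leftLegs Q.can₃.toLinearMap (a ⊗ₜ mulL₂ c (Q.can₁ (b ⊗ₜ y))) := by
      rw [mulL₂_can₁]
      exact (leftLegs_lTensor_lTensor _ (LinearMap.mulRight ℂ y) _).symm
    have e' : leftLegs Q.can₂.toLinearMap (x ⊗ₜ mulL₂ c (Q.can₁ (b ⊗ₜ y))) =
        (mulL₂ c).lTensor A (leftLegs Q.can₂.toLinearMap (x ⊗ₜ Q.can₁ (b ⊗ₜ y))) :=
      leftLegs_lTensor_lTensor _ (LinearMap.mulLeft ℂ c) (x ⊗ₜ Q.can₁ (b ⊗ₜ y))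
    rw [e, h2, e', leftLegs_tmul, h1, ← leftLegs_tmul, hc, hc, h2, ← hc, ← hc,
      lTensor_can₁_leftLegs_can₂]
    rfl
  induction x with
  | zero => simp
  | add s t h h' => simp only [map_add, h, h']
  | tmul a w =>
    induction w with
    | zero => simp
    | add s t h h' => simp only [map_add, TensorProduct.tmul_add, h, h']
    | tmul b c => exact key a b c

theorem isCanonicalPair : IsCanonicalPair (LinearMap.mul' ℂ A) Q.can₁ Q.can₂ where
  comm := Q.lTensor_can₁_leftLegs_can₂
  mul x := by
    induction x with
    | zero => simp
    | add s t h h' => simp only [map_add, h, h']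
    | tmul a w =>
      induction w with
      | zero => simp
      | add s t h h' => simp only [map_add, TensorProduct.tmul_add, h, h']
      | tmul b c =>
        rw [leftLegs_tmul, lTensor_mul'_assoc, LinearMap.lTensor_tmul, rTensor_mul'_assoc_symm]
        exact (Q.mulL₁_can₁ b c a).symm
  assoc x := by
    induction x with
    | zero => simp
    | add s t h h' => simp only [map_add, h, h']
    | tmul a w =>
      induction w with
      | zero => simp
      | add s t h h' => simp only [map_add, TensorProduct.tmul_add, h, h']
      | tmul b c => simp [mul_assoc]

/-- The abstract antipode of this second pair plays the part of the inverse of S in the proof that φ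
is faithful. -/
theorem isCanonicalPair_op : IsCanonicalPair
    (LinearMap.mul' ℂ A ∘ₗ (TensorProduct.comm ℂ A A).toLinearMap) Q.can₄ Q.can₃ where
  comm := Q.lTensor_can₄_leftLegs_can₃
  mul x := by
    have h1 : ∀ (w : A ⊗[ℂ] A) (c : A), (LinearMap.mul' ℂ A ∘ₗ
        (TensorProduct.comm ℂ A A).toLinearMap).lTensor A
        (TensorProduct.assoc ℂ A A A (w ⊗ₜ c)) = mulL₂ c w := by
      intro w c
      induction w with
      | zero => simp
      | add s t h h' => simp only [map_add, TensorProduct.add_tmul, h, h']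
      | tmul a b => rfl
    have h2 : ∀ (w : A ⊗[ℂ] A) (c : A), (LinearMap.mul' ℂ A ∘ₗ
        (TensorProduct.comm ℂ A A).toLinearMap).rTensor A
        ((TensorProduct.assoc ℂ A A A).symm (c ⊗ₜ w)) = mulR₁ c w := by
      intro w c
      induction w with
      | zero => simp
      | add s t h h' => simp only [map_add, TensorProduct.tmul_add, h, h']
      | tmul a b => rfl
    induction x with
    | zero => simp
    | add s t h h' => simp only [map_add, h, h']
    | tmul a w =>
      induction w with
      | zero => simp
      | add s t h h' => simp only [map_add, TensorProduct.tmul_add, h, h']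
      | tmul b c =>
        rw [leftLegs_tmul, h1, LinearMap.lTensor_tmul, h2]
        exact Q.mulL₂_can₃ a b c
  assoc x := by
    induction x with
    | zero => simp
    | add s t h h' => simp only [map_add, h, h']
    | tmul a w =>
      induction w with
      | zero => simp
      | add s t h h' => simp only [map_add, TensorProduct.tmul_add, h, h']
      | tmul b c => simp [mul_assoc]

/-- The counit `ε`. -/
def counit : A →ₗ[ℂ] ℂ := Q.isCanonicalPair.exists_counit.choose

theorem sliceLeft_counit_can₁ (w : A ⊗[ℂ] A) :
    sliceLeft Q.counit (Q.can₁ w) = LinearMap.mul' ℂ A w :=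
  Q.isCanonicalPair.exists_counit.choose_spec.1 w

theorem sliceRight_counit_can₂ (w : A ⊗[ℂ] A) :
    sliceRight Q.counit (Q.can₂ w) = LinearMap.mul' ℂ A w :=
  Q.isCanonicalPair.exists_counit.choose_spec.2 w

/-- The opposite pair has the same counit: cutting the second leg by `x` replaces `can₄` by `can₁`.
-/
theorem sliceLeft_counit_can₄ (w : A ⊗[ℂ] A) : sliceLeft Q.counit (Q.can₄ w) =
    (LinearMap.mul' ℂ A ∘ₗ (TensorProduct.comm ℂ A A).toLinearMap) w := by
  induction w with
  | zero => simp
  | add s t h h' => simp only [map_add, h, h']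
  | tmul b c =>
    refine eq_of_mul fun x => ?_
    rw [← sliceLeft_mulR₂, ← mulL₂_can₁, sliceLeft_mulL₂, sliceLeft_counit_can₁]
    simp [mul_assoc]

theorem sliceRight_counit_can₃ (w : A ⊗[ℂ] A) : sliceRight Q.counit (Q.can₃ w) =
    (LinearMap.mul' ℂ A ∘ₗ (TensorProduct.comm ℂ A A).toLinearMap) w := by
  induction w with
  | zero => simp
  | add s t h h' => simp only [map_add, h, h']
  | tmul a b =>
    refine eq_of_mul_left fun x => ?_
    rw [← sliceRight_mulL₁, mulL₁_can₃, sliceRight_mulR₁, sliceRight_counit_can₂]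
    simp [mul_assoc]

/-- A zero counit makes all products vanish, hence A = 0 by non-degeneracy, contradicting φ ≠ 0. -/
theorem counit_ne_zero : Q.counit ≠ 0 := by
  intro h
  refine Q.integral_ne_zero (LinearMap.ext fun a => ?_)
  have : a = 0 := NondegenerateMul.eq_zero_of_mul_right a fun b => by
    have := Q.sliceLeft_counit_can₁ (a ⊗ₜ b)
    rw [h] at this
    simpa [sliceLeft] using this.symm
  rw [this, map_zero, map_zero]

theorem sliceLeft_counit_comulLeft (a : A) (w : A ⊗[ℂ] A) :
    sliceLeft Q.counit (Q.comulLeft a w) = a * sliceLeft Q.counit w := by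
  obtain ⟨w, rfl⟩ := Q.can₁.surjective w
  rw [comulLeft_can₁, sliceLeft_counit_can₁, sliceLeft_counit_can₁]
  induction w with
  | zero => simp
  | add s t h h' => simp only [map_add, mul_add, h, h']
  | tmul b c => simp [mul_assoc]

/-- For w = Δ(a)(1 ⊗ b) one has w(x ⊗ 1) = Δ(a)(x ⊗ b), which ε ⊗ ι sends to ε(x) ab. Taking `w`
elementary then shows that ε is multiplicative. -/
theorem sliceLeft_counit_mulR₁ (x : A) (w : A ⊗[ℂ] A) :
    sliceLeft Q.counit (mulR₁ x w) = Q.counit x • sliceLeft Q.counit w := by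
  obtain ⟨w, rfl⟩ := Q.can₁.surjective w
  induction w with
  | zero => simp
  | add s t h h' => simp only [map_add, smul_add, h, h']
  | tmul a b =>
    rw [mulR₁_can₁, sliceLeft_counit_comulLeft, sliceLeft_counit_can₁]
    simp [mul_smul_comm]

theorem counit_mul (a b : A) : Q.counit (a * b) = Q.counit a * Q.counit b := by
  have h := fun c => Q.sliceLeft_counit_mulR₁ b (a ⊗ₜ c)
  obtain ⟨c, hc⟩ : ∃ c : A, c ≠ 0 := by
    by_contra! h0
    exact Q.integral_ne_zero (LinearMap.ext fun a => by rw [h0 a, map_zero, map_zero])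
  have := h c
  simp only [mulR₁_tmul, sliceLeft_tmul, smul_smul] at this
  rw [smul_left_injective ℂ hc this, mul_comm]

theorem sliceRight_integral_can₃ (w : A ⊗[ℂ] A) :
    sliceRight Q.integral (Q.can₃ w) = sliceRight Q.integral w := by
  induction w with
  | zero => simp
  | add s t h h' => simp only [map_add, h, h']
  | tmul a b => rw [Q.left_invariant b a _ (Q.incl_can₃ a b), sliceRight_tmul]

theorem sliceRight_integral_can₂ (w : A ⊗[ℂ] A) :
    sliceRight Q.integral (Q.can₂ w) = sliceRight Q.integral w := by
  induction w with
  | zero => simp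
  | add s t h h' => simp only [map_add, h, h']
  | tmul a b => rw [Q.left_invariant' b a _ (Q.incl_can₂ a b), sliceRight_tmul]

theorem sliceRight_can₁_surjective :
    Function.Surjective fun w => sliceRight Q.integral (Q.can₁ w) :=
  (sliceRight_surjective Q.integral_ne_zero).comp Q.can₁.surjective

theorem sliceRight_can₄_surjective :
    Function.Surjective fun w => sliceRight Q.integral (Q.can₄ w) :=
  (sliceRight_surjective Q.integral_ne_zero).comp Q.can₄.surjective

/-- `z (ι ⊗ φ)((1 ⊗ a)Δ(b)) = z S((ι ⊗ φ)(Δ(a)(1 ⊗ b)))`. -/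
theorem mul_sliceRight_can₄ (z a b : A) : z * sliceRight Q.integral (Q.can₄ (b ⊗ₜ a)) =
    sliceRight Q.counit (Q.can₂.symm (z ⊗ₜ sliceRight Q.integral (Q.can₁ (a ⊗ₜ b)))) := by
  have h := Q.isCanonicalPair.symm_mul_tmul Q.sliceLeft_counit_can₁ z a b
  rw [lTensor_mul'_assoc] at h
  have h1 : ∀ w : A ⊗[ℂ] A, sliceRight Q.integral
      ((sliceRight Q.counit ∘ₗ Q.can₂.symm.toLinearMap).rTensor A
        ((TensorProduct.assoc ℂ A A A).symm (z ⊗ₜ w))) =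
      sliceRight Q.counit (Q.can₂.symm (z ⊗ₜ sliceRight Q.integral w)) := by
    intro w
    induction w with
    | zero => simp
    | add s t h h' => simp only [map_add, TensorProduct.tmul_add, h, h']
    | tmul a b => simp
  -- Left invariance allows inserting `can₂`. Since `can₂` turns multiplication by 1 ⊗ b into
  -- multiplication by Δ(b), it then cancels `can₂.symm`.
  rw [← h1, ← h, ← sliceRight_mulL₁, mulL₁_can₄,
    ← Q.sliceRight_integral_can₂ (mulR₂ b _), ← comulRight_can₂,
    LinearEquiv.apply_symm_apply]

/-- A priori z ↦ z S(a) is only a multiplier. The elements (ι ⊗ φ)(Δ(a)(1 ⊗ b)) span A, and for them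
`mul_sliceRight_can₄` exhibits S(a) as an element of A; non-degeneracy makes it unique and linear in
`a`. -/
theorem exists_antipode : ∃ S : A →ₗ[ℂ] A, ∀ z a, z * S a =
    sliceRight Q.counit (Q.can₂.symm (z ⊗ₜ a)) := by
  have h : ∀ a, ∃ s, ∀ z, z * s = sliceRight Q.counit (Q.can₂.symm (z ⊗ₜ a)) := by
    intro a
    obtain ⟨w, rfl⟩ := Q.sliceRight_can₁_surjective a
    induction w with
    | zero => exact ⟨0, by simp⟩
    | add s t h h' =>
      obtain ⟨u, hu⟩ := h
      obtain ⟨v, hv⟩ := h'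
      exact ⟨u + v, fun z => by simp only [mul_add, map_add, TensorProduct.tmul_add, hu, hv]⟩
    | tmul a b => exact ⟨_, fun z => Q.mul_sliceRight_can₄ z a b⟩
  choose S hS using h
  exact ⟨{ toFun := S
           map_add' := fun a b => eq_of_mul_left fun z => by
            simp only [hS, mul_add, TensorProduct.tmul_add, map_add]
           map_smul' := fun r a => eq_of_mul_left fun z => by
            simp only [hS, mul_smul_comm, TensorProduct.tmul_smul, map_smul, RingHom.id_apply] },
    fun z a => hS a z⟩

/-- The antipode `S`. -/
def antipode : A →ₗ[ℂ] A := Q.exists_antipode.choose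

theorem mul_antipode (z a : A) :
    z * Q.antipode a = sliceRight Q.counit (Q.can₂.symm (z ⊗ₜ a)) :=
  Q.exists_antipode.choose_spec z a

theorem antipode_mul (a b : A) :
    Q.antipode a * b = sliceLeft Q.counit (Q.can₁.symm (a ⊗ₜ b)) := by
  refine eq_of_mul_left fun c => ?_
  have := Q.isCanonicalPair.mul_antipode Q.sliceLeft_counit_can₁ Q.sliceRight_counit_can₂ a b c
  rw [← mul_assoc, mul_antipode]
  exact this.symm

theorem antipode_sliceRight (a b : A) : Q.antipode (sliceRight Q.integral (Q.can₁ (a ⊗ₜ b))) =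
    sliceRight Q.integral (Q.can₄ (b ⊗ₜ a)) :=
  eq_of_mul_left fun z => by rw [mul_antipode, mul_sliceRight_can₄]

theorem antipode_surjective : Function.Surjective Q.antipode := by
  intro a
  obtain ⟨w, rfl⟩ := Q.sliceRight_can₄_surjective a
  induction w with
  | zero => exact ⟨0, by simp⟩
  | add s t h h' =>
    obtain ⟨u, hu⟩ := h
    obtain ⟨v, hv⟩ := h'
    exact ⟨u + v, by simp only [map_add] at hu hv ⊢; rw [hu, hv]⟩
  | tmul b a => exact ⟨_, Q.antipode_sliceRight a b⟩

/-- With x ⊗ b = `can₁ v`, the tensor xy ⊗ b is `can₁ v` times y ⊗ 1. For v = p ⊗ q this is Δ(p)(y ⊗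
q), and multiplicativity of ε turns (ε ⊗ ι) `can₁`⁻¹ of it into ε(p) S(y) q. -/
theorem antipode_mul_rev (x y : A) :
    Q.antipode (x * y) = Q.antipode y * Q.antipode x := by
  refine eq_of_mul fun b => ?_
  rw [mul_assoc, antipode_mul, antipode_mul Q x]
  obtain ⟨v, hv⟩ : ∃ v, Q.can₁.symm (x ⊗ₜ b) = v := ⟨_, rfl⟩
  have hv' : x ⊗ₜ b = Q.can₁ v := by rw [← hv, LinearEquiv.apply_symm_apply]
  have h2 : ∀ v : A ⊗[ℂ] A, sliceLeft Q.counit (Q.can₁.symm (mulR₁ y (Q.can₁ v))) =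
      Q.antipode y * sliceLeft Q.counit v := by
    intro v
    induction v with
    | zero => simp
    | add s t h h' => simp only [map_add, mul_add, h, h']
    | tmul p q =>
      obtain ⟨u, hu⟩ : ∃ u, Q.can₁.symm (y ⊗ₜ q) = u := ⟨_, rfl⟩
      have hu' : y ⊗ₜ q = Q.can₁ u := by rw [← hu, LinearEquiv.apply_symm_apply]
      rw [mulR₁_can₁, hu', comulLeft_can₁, LinearEquiv.symm_apply_apply, sliceLeft_tmul,
        mul_smul_comm, antipode_mul, hu]
      clear hu hu'
      induction u with
      | zero => simp
      | add s t h h' => simp only [map_add, smul_add, h, h']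
      | tmul a b => simp [counit_mul, mul_smul]
  rw [hv, ← h2, ← hv', mulR₁_tmul]

/-! ### Faithfulness of the left integral -/

/-- If `φ(· q)` vanishes on the second leg of `w` for all `q`, then so does every functional that
factors through `a ↦ φ(a ·)`. -/
theorem lTensor_toDual_flip_eq_zero {w : A ⊗[ℂ] A}
    (h : ∀ q, sliceRight Q.integral (mulR₂ q w) = 0) : Q.toDual.flip.lTensor A w = 0 := by
  refine lTensor_separating (fun q : A => LinearMap.applyₗ q) (fun f hf => LinearMap.ext hf) _
    fun q => ?_
  apply (TensorProduct.rid ℂ A).injective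
  rw [map_zero, ← h q]
  clear h
  induction w with
  | zero => simp
  | add s t h h' => simp only [map_add, h, h']
  | tmul a b => simp

/-- The hypothesis on `n` spreads to the second leg of Δ(n): with y ⊗ q = `can₃ w`, left invariance
turns (ι ⊗ φ)(Δ(n)(y ⊗ q)) into (ι ⊗ φ)((1 ⊗ n)w) = 0. -/
theorem sliceRight_can₂_eq_zero {n : A} (hn : ∀ q, Q.integral (n * q) = 0) (p q : A) :
    sliceRight Q.integral (mulR₂ q (Q.can₂ (p ⊗ₜ n))) = 0 := by
  have h1 : sliceRight Q.integral (Q.can₁ (n ⊗ₜ q)) = 0 := by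
    refine NondegenerateMul.eq_zero_of_mul_right _ fun y => ?_
    rw [← sliceRight_mulR₁, mulR₁_can₁]
    obtain ⟨w, hw⟩ := Q.can₃.surjective (y ⊗ₜ q)
    rw [← hw, comulLeft_can₃, sliceRight_integral_can₃]
    clear hw
    induction w with
    | zero => simp
    | add s t h h' => simp only [map_add, h, h', add_zero]
    | tmul a b => simp [hn]
  rw [← mulL₁_can₁, sliceRight_mulL₁, h1, mul_zero]

theorem counit_eq_zero_of_forall {n : A} (hn : ∀ q, Q.integral (n * q) = 0) :
    Q.counit n = 0 := by
  have hop : ∀ y x q : A, sliceLeft Q.counit (Q.can₄.symm (y ⊗ₜ x)) * q =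
      x * sliceRight Q.counit (Q.can₃.symm (q ⊗ₜ y)) := fun y x q =>
    Q.isCanonicalPair_op.mul_antipode Q.sliceLeft_counit_can₄ Q.sliceRight_counit_can₃ y x q
  -- With S' the antipode of the opposite pair, this is φ(n₂ S'(p n₁) q) = 0. The left side sees n₂
  -- only through the functional φ(n₂ ·), which is what `F` encodes.
  have h1 : ∀ p q : A, Q.integral (sliceLeft Q.counit (Q.can₄.symm (Q.can₂ (p ⊗ₜ n))) * q) = 0 := by
    intro p q
    let F : A ⊗[ℂ] Module.Dual ℂ A →ₗ[ℂ] ℂ := TensorProduct.lift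
      ((LinearMap.applyₗ).comp (sliceRight Q.counit ∘ₗ Q.can₃.symm.toLinearMap ∘ₗ
        TensorProduct.mk ℂ A A q))
    have hF : ∀ w : A ⊗[ℂ] A, Q.integral (sliceLeft Q.counit (Q.can₄.symm w) * q) =
        F (Q.toDual.flip.lTensor A w) := by
      intro w
      induction w with
      | zero => simp
      | add s t h h' => simp only [map_add, add_mul, h, h']
      | tmul y x => rw [hop]; simp [F]
    rw [hF, Q.lTensor_toDual_flip_eq_zero (Q.sliceRight_can₂_eq_zero hn p), map_zero]
  -- In the same notation, n₂ S'(p n₁) q = ε(n) S'(p) q. As the elements S'(p) q span A, ε(n) ≠ 0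
  -- would force φ = 0.
  have h2 : ∀ p q : A, sliceLeft Q.counit (Q.can₄.symm (Q.can₂ (p ⊗ₜ n))) * q =
      Q.counit n • sliceRight Q.counit (Q.can₃.symm (q ⊗ₜ p)) := by
    intro p q
    refine eq_of_mul_left fun z => ?_
    have hz : ∀ w, sliceLeft Q.counit (Q.can₄.symm (mulL₂ z w)) =
        z * sliceLeft Q.counit (Q.can₄.symm w) := by
      intro w
      obtain ⟨w, rfl⟩ := Q.can₄.surjective w
      rw [← can₄_mulL₂, LinearEquiv.symm_apply_apply, LinearEquiv.symm_apply_apply,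
        sliceLeft_mulL₂]
    obtain ⟨v, hv⟩ := Q.can₄.surjective (p ⊗ₜ z)
    rw [← mul_assoc, ← hz, mulL₂_can₂, ← hv, comulRight_can₄, LinearEquiv.symm_apply_apply,
      sliceLeft_counit_mulR₁, mul_smul_comm, ← hop, ← hv, LinearEquiv.symm_apply_apply,
      smul_mul_assoc]
  by_contra hne
  refine Q.integral_ne_zero (LinearMap.ext fun a => ?_)
  obtain ⟨w, rfl⟩ := ((sliceRight_surjective Q.counit_ne_zero).comp Q.can₃.symm.surjective) a
  rw [LinearMap.zero_apply]
  induction w with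
  | zero => simp
  | add s t h h' => simp only [Function.comp_apply, map_add, h, h', add_zero] at h h' ⊢
  | tmul q p =>
    have := h1 p q
    rw [h2, map_smul, smul_eq_mul] at this
    exact (mul_eq_zero.1 this).resolve_left hne

/-- The left integral is faithful. -/
theorem eq_zero_of_integral_mul {n : A} (hn : ∀ q, Q.integral (n * q) = 0) : n = 0 := by
  -- Killing the kernel of a ↦ φ(a ·), the functional ε factors through that map. Hence x n = (ι ⊗
  -- ε)((x ⊗ 1)Δ(n)) vanishes, because φ(· q) does so on the second leg for all q.
  have hker : Q.counit ∈ (LinearMap.ker Q.toDual.flip).dualAnnihilator := by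
    rw [Submodule.mem_dualAnnihilator]
    intro x hx
    exact Q.counit_eq_zero_of_forall fun q => congrArg (fun f => f q) (LinearMap.mem_ker.1 hx)
  rw [← LinearMap.range_dualMap_eq_dualAnnihilator_ker] at hker
  obtain ⟨f, hf⟩ := hker
  refine NondegenerateMul.eq_zero_of_mul_left _ fun x => ?_
  have h1 : ∀ w : A ⊗[ℂ] A, sliceRight Q.counit w =
      TensorProduct.rid ℂ A (f.lTensor A (Q.toDual.flip.lTensor A w)) := by
    intro w
    rw [← hf]
    induction w with
    | zero => simp
    | add s t h h' => simp only [map_add, h, h']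
    | tmul a b => simp
  have := Q.sliceRight_counit_can₂ (x ⊗ₜ n)
  rw [h1, Q.lTensor_toDual_flip_eq_zero (Q.sliceRight_can₂_eq_zero hn x)] at this
  simpa using this.symm

end AlgebraicQuantumGroup

/-! ### The right integral and the descriptions of the dual -/

section TensorFunctional

variable {A : Type*} [NonUnitalRing A] [Module ℂ A] [IsScalarTower ℂ A A] [SMulCommClass ℂ A A]

theorem tensorFunctional_eq_sliceRight (φ ψ : A →ₗ[ℂ] ℂ) (w : A ⊗[ℂ] A) :
    tensorFunctional φ ψ w = φ (sliceRight ψ w) := by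
  induction w with
  | zero => simp
  | add s t h h' => simp only [map_add, h, h']
  | tmul a b => simp [mul_comm]

theorem tensorFunctional_eq_sliceLeft (φ ψ : A →ₗ[ℂ] ℂ) (w : A ⊗[ℂ] A) :
    tensorFunctional φ ψ w = ψ (sliceLeft φ w) := by
  induction w with
  | zero => simp
  | add s t h h' => simp only [map_add, h, h']
  | tmul a b => simp

end TensorFunctional

namespace AlgebraicQuantumGroup

variable {A : Type*} [NonUnitalRing A] [Module ℂ A] [IsScalarTower ℂ A A] [SMulCommClass ℂ A A]
  [NondegenerateMul A] (Q : AlgebraicQuantumGroup A)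

/-- The map `a ↦ (ι ⊗ φ)(Δ(a)(1 ⊗ c))`. -/
def conv₁ (c : A) : A →ₗ[ℂ] A :=
  sliceRight Q.integral ∘ₗ Q.can₁.toLinearMap ∘ₗ (TensorProduct.mk ℂ A A).flip c

theorem conv₁_apply (c a : A) : Q.conv₁ c a = sliceRight Q.integral (Q.can₁ (a ⊗ₜ c)) := rfl

theorem conv₁_mul (c a x : A) :
    Q.conv₁ c a * x = sliceRight Q.integral (Q.comulLeft a (x ⊗ₜ c)) := by
  rw [conv₁_apply, ← sliceRight_mulR₁, mulR₁_can₁]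

/-- Coassociativity: Δ(φ(· c) ▹ a) is obtained by letting φ(· c) act on the second leg of Δ(a). -/
theorem can₂_conv₁ (z c a : A) :
    Q.can₂ (z ⊗ₜ Q.conv₁ c a) = (Q.conv₁ c).lTensor A (Q.can₂ (z ⊗ₜ a)) := by
  have h1 : ∀ w : A ⊗[ℂ] A, (sliceRight Q.integral).lTensor A
      (leftLegs Q.can₂.toLinearMap (z ⊗ₜ w)) = Q.can₂ (z ⊗ₜ sliceRight Q.integral w) := by
    intro w
    induction w with
    | zero => simp
    | add s t h h' => simp only [map_add, TensorProduct.tmul_add, h, h']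
    | tmul p q =>
      rw [leftLegs_tmul, LinearEquiv.coe_coe, sliceRight_tmul, TensorProduct.tmul_smul, map_smul]
      generalize Q.can₂ (z ⊗ₜ p) = v
      induction v with
      | zero => simp
      | add s t h h' => simp only [map_add, TensorProduct.add_tmul, smul_add, h, h']
      | tmul a b => simp
  have h2 : ∀ w : A ⊗[ℂ] A, (sliceRight Q.integral).lTensor A
      (Q.can₁.toLinearMap.lTensor A (TensorProduct.assoc ℂ A A A (w ⊗ₜ c))) =
      (Q.conv₁ c).lTensor A w := by
    intro w
    induction w with
    | zero => simp
    | add s t h h' => simp only [map_add, TensorProduct.add_tmul, h, h']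
    | tmul p q => rfl
  rw [conv₁_apply, ← h1, ← h2]
  have := Q.lTensor_can₁_leftLegs_can₂ (z ⊗ₜ (a ⊗ₜ c))
  rw [leftLegs_tmul] at this
  exact congrArg _ this.symm

/-- The map `w ⊗ r ↦ conv₁ r a ⊗ w`. -/
def flipConv₁ (a : A) : A ⊗[ℂ] A →ₗ[ℂ] A ⊗[ℂ] A :=
  (sliceRight Q.integral ∘ₗ Q.can₁.toLinearMap ∘ₗ TensorProduct.mk ℂ A A a).rTensor A ∘ₗ
    (TensorProduct.comm ℂ A A).toLinearMap

@[simp] theorem flipConv₁_tmul (a s r : A) :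
    Q.flipConv₁ a (s ⊗ₜ r) = Q.conv₁ r a ⊗ₜ s := rfl

/-- `Δ(a₁ φ(a₂ b)) (1 ⊗ y) = a₁ φ(a₂ r) ⊗ s` if `y ⊗ b = Δ(r)(s ⊗ 1)`. -/
theorem can₁_flipConv₁ (a : A) (v : A ⊗[ℂ] A) :
    Q.can₁ (Q.flipConv₁ a (Q.can₃ v)) = Q.flipConv₁ a v := by
  have key : ∀ (z : A) (v : A ⊗[ℂ] A), mulL₁ z (Q.can₁ (Q.flipConv₁ a (Q.can₃ v))) =
      mulL₁ z (Q.flipConv₁ a v) := by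
    intro z v
    -- At w = y ⊗ b this is a ↦ `conv₁ b a * y`. Being linear in `w`, it can also be evaluated at w
    -- = `can₃ (s ⊗ r)`, where left invariance of φ applies.
    let G : A ⊗[ℂ] A →ₗ[ℂ] A →ₗ[ℂ] A :=
      LinearMap.mk₂ ℂ (fun w a => sliceRight Q.integral ((Q.comul a).lmul w)) (by simp) (by simp)
        (by simp) (by simp)
    have hG : ∀ w a, G w a = sliceRight Q.integral (Q.comulLeft a w) := fun _ _ => rfl
    have h1 : ∀ w : A ⊗[ℂ] A, mulL₁ z (Q.can₁ (Q.flipConv₁ a w)) =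
        (G w).lTensor A (Q.can₂ (z ⊗ₜ a)) := by
      intro w
      induction w with
      | zero => simp
      | add s t h h' => simp only [map_add, h, h', LinearMap.lTensor_add, LinearMap.add_apply]
      | tmul y b =>
        rw [flipConv₁_tmul, mulL₁_can₁, can₂_conv₁, mulR₂, ← LinearMap.comp_apply,
          ← LinearMap.lTensor_comp]
        congr 2
        ext p
        rw [LinearMap.comp_apply, LinearMap.mulRight_apply, conv₁_mul, hG]
    rw [h1]
    induction v with
    | zero => simp
    | add s t h h' => simp only [map_add, h, h', LinearMap.lTensor_add, LinearMap.add_apply]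
    | tmul s r =>
      have h2 : ∀ w : A ⊗[ℂ] A, (G (Q.can₃ (s ⊗ₜ r))).lTensor A w =
          sliceRight Q.integral (mulR₂ r w) ⊗ₜ s := by
        intro w
        induction w with
        | zero => simp
        | add s t h h' => simp only [map_add, TensorProduct.add_tmul, h, h']
        | tmul p q =>
          rw [LinearMap.lTensor_tmul, hG, comulLeft_can₃, sliceRight_integral_can₃]
          simp [TensorProduct.smul_tmul]
      rw [h2, flipConv₁_tmul, ← mulL₁_can₁, sliceRight_mulL₁, mulL₁_tmul, conv₁_apply]
  rw [← sub_eq_zero]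
  refine rTensor_separating (fun x : A => LinearMap.mulLeft ℂ x)
    (fun x h => NondegenerateMul.eq_zero_of_mul_left x h) _ fun x => ?_
  rw [map_sub, sub_eq_zero]
  exact key x v

/-- The right integral `ψ = φ ∘ S`. -/
def rightIntegral : A →ₗ[ℂ] ℂ := Q.integral ∘ₗ Q.antipode

theorem rightIntegral_ne_zero : Q.rightIntegral ≠ 0 := by
  intro h
  refine Q.integral_ne_zero (LinearMap.ext fun a => ?_)
  obtain ⟨b, rfl⟩ := Q.antipode_surjective a
  exact congrArg (fun f => f b) h

/-- The functional p ↦ (φ ⊗ φ)((1 ⊗ a)Δ(p)) inherits left invariance from φ: coassociativity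
transfers the comultiplication to the first leg of (1 ⊗ a)Δ(p), where φ absorbs it. -/
theorem sliceRight_tensorFunctional_can₄ (a : A) (v : A ⊗[ℂ] A) :
    sliceRight (tensorFunctional Q.integral Q.integral ∘ₗ Q.can₄.toLinearMap ∘ₗ
        (TensorProduct.mk ℂ A A).flip a) (Q.can₃ v) =
      sliceRight (tensorFunctional Q.integral Q.integral ∘ₗ Q.can₄.toLinearMap ∘ₗ
        (TensorProduct.mk ℂ A A).flip a) v := by
  let Φ : A ⊗[ℂ] (A ⊗[ℂ] A) →ₗ[ℂ] A := (TensorProduct.rid ℂ A).toLinearMap ∘ₗ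
    (tensorFunctional Q.integral Q.integral).lTensor A
  have h1 : ∀ w : A ⊗[ℂ] A, Φ (Q.can₄.toLinearMap.lTensor A
      (TensorProduct.assoc ℂ A A A (w ⊗ₜ a))) = sliceRight (tensorFunctional Q.integral
        Q.integral ∘ₗ Q.can₄.toLinearMap ∘ₗ (TensorProduct.mk ℂ A A).flip a) w := by
    intro w
    induction w with
    | zero => simp
    | add s t h h' => simp only [map_add, TensorProduct.add_tmul, h, h']
    | tmul p q => simp [Φ]
  have h2 : ∀ (s : A) (w : A ⊗[ℂ] A), Φ (leftLegs Q.can₃.toLinearMap (s ⊗ₜ w)) =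
      tensorFunctional Q.integral Q.integral w • s := by
    intro s w
    induction w with
    | zero => simp
    | add s t h h' => simp only [map_add, TensorProduct.tmul_add, add_smul, h, h']
    | tmul p q =>
      have h3 : ∀ u : A ⊗[ℂ] A, Φ (TensorProduct.assoc ℂ A A A (u ⊗ₜ q)) =
          Q.integral q • sliceRight Q.integral u := by
        intro u
        induction u with
        | zero => simp
        | add s t h h' => simp only [map_add, TensorProduct.add_tmul, smul_add, h, h']
        | tmul a b => simp [Φ, smul_smul, mul_comm]
      rw [leftLegs_tmul, h3, LinearEquiv.coe_coe, sliceRight_integral_can₃]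
      simp [smul_smul, mul_comm]
  induction v with
  | zero => simp
  | add s t h h' => simp only [map_add, h, h']
  | tmul s r =>
    have h3 := leftLegs_tmul Q.can₃.toLinearMap s r a
    rw [LinearEquiv.coe_coe] at h3
    rw [← h1, ← h3, lTensor_can₄_leftLegs_can₃,
      LinearMap.lTensor_tmul, h2]
    rfl

theorem rightIntegral_conv₁ (c a : A) : Q.rightIntegral (Q.conv₁ c a) =
    tensorFunctional Q.integral Q.integral (Q.can₄ (c ⊗ₜ a)) := by
  rw [tensorFunctional_eq_sliceRight, ← antipode_sliceRight]; rfl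

/-- The functional `ψ` is right invariant. -/
theorem sliceLeft_rightIntegral_can₁ (w : A ⊗[ℂ] A) :
    sliceLeft Q.rightIntegral (Q.can₁ w) = sliceLeft Q.rightIntegral w := by
  have h1 : ∀ (a : A) (v : A ⊗[ℂ] A), sliceLeft Q.rightIntegral (Q.flipConv₁ a v) =
      sliceRight (tensorFunctional Q.integral Q.integral ∘ₗ Q.can₄.toLinearMap ∘ₗ
        (TensorProduct.mk ℂ A A).flip a) v := by
    intro a v
    induction v with
    | zero => simp
    | add s t h h' => simp only [map_add, h, h']
    | tmul s r => rw [flipConv₁_tmul, sliceLeft_tmul, rightIntegral_conv₁]; simp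
  -- Every d ⊗ y is a sum of values of `flipConv₁`, on which `can₁` acts through the inverse of
  -- `can₃`. Right invariance of ψ thereby becomes the left invariance just proved, and no formula
  -- for Δ ∘ S is needed.
  have h2 : ∀ (a : A) (v : A ⊗[ℂ] A), sliceLeft Q.rightIntegral (Q.can₁ (Q.flipConv₁ a v)) =
      sliceLeft Q.rightIntegral (Q.flipConv₁ a v) := by
    intro a v
    obtain ⟨v, rfl⟩ := Q.can₃.surjective v
    rw [can₁_flipConv₁, h1, h1, sliceRight_tensorFunctional_can₄]
  induction w with
  | zero => simp
  | add s t h h' => simp only [map_add, h, h']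
  | tmul d y =>
    obtain ⟨v, rfl⟩ := Q.sliceRight_can₁_surjective d
    induction v with
    | zero => simp
    | add s t h h' => simp only [map_add, TensorProduct.add_tmul, h, h'] at h h' ⊢
    | tmul a b => exact h2 a (y ⊗ₜ b)

theorem sliceLeft_rightIntegral_can₄ (w : A ⊗[ℂ] A) :
    sliceLeft Q.rightIntegral (Q.can₄ w) = sliceLeft Q.rightIntegral w := by
  induction w with
  | zero => simp
  | add s t h h' => simp only [map_add, h, h']
  | tmul a b =>
    refine eq_of_mul fun x => ?_
    rw [← sliceLeft_mulR₂, ← mulL₂_can₁, sliceLeft_mulL₂, sliceLeft_rightIntegral_can₁]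
    simp [mul_smul_comm, smul_mul_assoc]

/-! ### Comparison of the functionals given by φ and ψ -/

/-- Here Δ(x)`can₁ w` = `can₁`((x ⊗ 1)w), and ψ removes `can₁`. The next lemma evaluates ψ ⊗ φ on
Δ(x)`can₃ w` with φ removing `can₃`; solving `can₁ w = can₃ w'` converts functionals φ(· c) into
functionals ψ(· d) and back. -/
theorem rightIntegral_mul_sliceRight (x : A) (w : A ⊗[ℂ] A) :
    Q.rightIntegral (x * sliceRight Q.integral w) =
      tensorFunctional Q.rightIntegral Q.integral (Q.comulLeft x (Q.can₁ w)) := by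
  rw [tensorFunctional_eq_sliceLeft, comulLeft_can₁, sliceLeft_rightIntegral_can₁,
    ← tensorFunctional_eq_sliceLeft, tensorFunctional_eq_sliceRight, sliceRight_mulL₁]

theorem integral_mul_sliceLeft (x : A) (w : A ⊗[ℂ] A) :
    Q.integral (x * sliceLeft Q.rightIntegral w) =
      tensorFunctional Q.rightIntegral Q.integral (Q.comulLeft x (Q.can₃ w)) := by
  rw [tensorFunctional_eq_sliceRight, comulLeft_can₃, sliceRight_integral_can₃,
    ← tensorFunctional_eq_sliceRight, tensorFunctional_eq_sliceLeft, sliceLeft_mulL₂]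

theorem rightIntegral_sliceRight_mul (x : A) (w : A ⊗[ℂ] A) :
    Q.rightIntegral (sliceRight Q.integral w * x) =
      tensorFunctional Q.rightIntegral Q.integral (Q.comulRight x (Q.can₄ w)) := by
  rw [tensorFunctional_eq_sliceLeft, comulRight_can₄, sliceLeft_rightIntegral_can₄,
    ← tensorFunctional_eq_sliceLeft, tensorFunctional_eq_sliceRight, sliceRight_mulR₁]

theorem integral_sliceLeft_mul (x : A) (w : A ⊗[ℂ] A) :
    Q.integral (sliceLeft Q.rightIntegral w * x) =
      tensorFunctional Q.rightIntegral Q.integral (Q.comulRight x (Q.can₂ w)) := by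
  rw [tensorFunctional_eq_sliceRight, comulRight_can₂, sliceRight_integral_can₂,
    ← tensorFunctional_eq_sliceRight, tensorFunctional_eq_sliceLeft, sliceLeft_mulR₂]

theorem exists_rightIntegral_mul_eq (c : A) :
    ∃ d, ∀ x, Q.rightIntegral (x * d) = Q.integral (x * c) := by
  obtain ⟨w, rfl⟩ := sliceLeft_surjective Q.rightIntegral_ne_zero c
  refine ⟨sliceRight Q.integral (Q.can₁.symm (Q.can₃ w)), fun x => ?_⟩
  rw [rightIntegral_mul_sliceRight, integral_mul_sliceLeft, LinearEquiv.apply_symm_apply]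

theorem exists_integral_mul_eq (c : A) :
    ∃ d, ∀ x, Q.integral (x * d) = Q.rightIntegral (x * c) := by
  obtain ⟨w, rfl⟩ := sliceRight_surjective Q.integral_ne_zero c
  refine ⟨sliceLeft Q.rightIntegral (Q.can₃.symm (Q.can₁ w)), fun x => ?_⟩
  rw [rightIntegral_mul_sliceRight, integral_mul_sliceLeft, LinearEquiv.apply_symm_apply]

theorem exists_rightIntegral_mul_eq' (c : A) :
    ∃ d, ∀ x, Q.rightIntegral (d * x) = Q.integral (c * x) := by
  obtain ⟨w, rfl⟩ := sliceLeft_surjective Q.rightIntegral_ne_zero c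
  refine ⟨sliceRight Q.integral (Q.can₄.symm (Q.can₂ w)), fun x => ?_⟩
  rw [rightIntegral_sliceRight_mul, integral_sliceLeft_mul, LinearEquiv.apply_symm_apply]

theorem exists_integral_mul_eq' (c : A) :
    ∃ d, ∀ x, Q.integral (d * x) = Q.rightIntegral (c * x) := by
  obtain ⟨w, rfl⟩ := sliceRight_surjective Q.integral_ne_zero c
  refine ⟨sliceLeft Q.rightIntegral (Q.can₂.symm (Q.can₄ w)), fun x => ?_⟩
  rw [rightIntegral_sliceRight_mul, integral_sliceLeft_mul, LinearEquiv.apply_symm_apply]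

/-- `S(ψ(x r₁) r₂) = ψ(x₁ r) x₂`. -/
theorem antipode_sliceLeft (x r : A) : Q.antipode (sliceLeft Q.rightIntegral (Q.can₂ (x ⊗ₜ r))) =
    sliceLeft Q.rightIntegral (Q.can₃ (r ⊗ₜ x)) := by
  refine eq_of_mul fun y => ?_
  have h := Q.isCanonicalPair.mul_tmul_symm Q.sliceRight_counit_can₂ x r y
  rw [rTensor_mul'_assoc_symm] at h
  have h1 : ∀ w : A ⊗[ℂ] A, sliceLeft Q.rightIntegral
      ((sliceLeft Q.counit ∘ₗ Q.can₁.symm.toLinearMap).lTensor A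
        (TensorProduct.assoc ℂ A A A (w ⊗ₜ y))) =
      Q.antipode (sliceLeft Q.rightIntegral w) * y := by
    intro w
    rw [antipode_mul]
    induction w with
    | zero => simp
    | add s t h h' => simp only [map_add, TensorProduct.add_tmul, h, h']
    | tmul a b =>
      simp only [TensorProduct.assoc_tmul, LinearMap.lTensor_tmul, sliceLeft_tmul,
        ← TensorProduct.smul_tmul', map_smul]
      rfl
  rw [← h1, ← h, ← sliceLeft_mulR₂, mulR₂_can₃, ← Q.sliceLeft_rightIntegral_can₁ (mulL₁ x _),
    ← comulLeft_can₁, LinearEquiv.apply_symm_apply]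

/-- Both sides are (ψ ⊗ φ)((1 ⊗ S(a))Δ(x)(S(r) ⊗ 1)) for w = r ⊗ a. Integrating the second leg first
leaves `x` on the right (`h1`), integrating the first leg first leaves it on the left (`h2`). This
exchange of sides replaces a modular automorphism of φ. -/
theorem integral_mul_eq_rightIntegral_mul (w : A ⊗[ℂ] A) (x : A) :
    Q.integral (sliceLeft (Q.rightIntegral ∘ₗ Q.antipode)
      (Q.can₂ (Q.antipode.lTensor A w)) * x) =
    Q.rightIntegral (x * sliceRight Q.rightIntegral (Q.can₁ (Q.antipode.rTensor A w))) := by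
  induction w with
  | zero => simp
  | add s t h h' => simp only [map_add, add_mul, mul_add, h, h']
  | tmul r a =>
    rw [LinearMap.lTensor_tmul, LinearMap.rTensor_tmul]
    have h1 : tensorFunctional Q.rightIntegral Q.integral
        (mulL₂ (Q.antipode a) (Q.can₃ (Q.antipode r ⊗ₜ x))) =
        Q.integral (sliceLeft (Q.rightIntegral ∘ₗ Q.antipode)
          (Q.can₂ (r ⊗ₜ Q.antipode a)) * x) := by
      rw [mulL₂_can₃, tensorFunctional_eq_sliceRight, sliceRight_mulR₁, ← antipode_sliceRight,
        ← antipode_mul_rev, ← sliceRight_mulL₁, mulL₁_can₁, ← sliceLeft_mulR₂,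
        ← tensorFunctional_eq_sliceLeft, tensorFunctional_eq_sliceRight]
      rfl
    have h2 : tensorFunctional Q.rightIntegral Q.integral
        (mulL₂ (Q.antipode a) (Q.can₃ (Q.antipode r ⊗ₜ x))) =
        Q.rightIntegral (x * sliceRight Q.rightIntegral (Q.can₁ (Q.antipode r ⊗ₜ a))) := by
      rw [tensorFunctional_eq_sliceLeft, sliceLeft_mulL₂, ← antipode_sliceLeft,
        ← antipode_mul_rev, ← sliceLeft_mulR₂, ← mulL₁_can₁, ← sliceRight_mulL₁,
        ← tensorFunctional_eq_sliceRight, tensorFunctional_eq_sliceLeft]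
      rfl
    rw [← h1, h2]

theorem rightIntegral_comp_antipode_ne_zero : Q.rightIntegral ∘ₗ Q.antipode ≠ 0 := by
  intro h
  refine Q.rightIntegral_ne_zero (LinearMap.ext fun a => ?_)
  obtain ⟨b, rfl⟩ := Q.antipode_surjective a
  exact congrArg (fun f => f b) h

/-- Every functional `φ(c ·)` is of the form `φ(· d)`. -/
theorem exists_integral_comm (c : A) : ∃ d, ∀ x, Q.integral (x * d) = Q.integral (c * x) := by
  obtain ⟨w, hw⟩ := ((sliceLeft_surjective Q.rightIntegral_comp_antipode_ne_zero).comp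
    (Q.can₂.surjective.comp (LinearMap.lTensor_surjective A Q.antipode_surjective))) c
  obtain ⟨d, hd⟩ := Q.exists_integral_mul_eq
    (sliceRight Q.rightIntegral (Q.can₁ (Q.antipode.rTensor A w)))
  exact ⟨d, fun x => by rw [hd, ← integral_mul_eq_rightIntegral_mul, ← hw]; rfl⟩

/-- Every functional `φ(· c)` is of the form `φ(d ·)`. -/
theorem exists_integral_comm' (c : A) : ∃ d, ∀ x, Q.integral (d * x) = Q.integral (x * c) := by
  obtain ⟨e, he⟩ := Q.exists_rightIntegral_mul_eq c
  obtain ⟨w, hw⟩ := ((sliceRight_surjective Q.rightIntegral_ne_zero).comp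
    (Q.can₁.surjective.comp (LinearMap.rTensor_surjective A Q.antipode_surjective))) e
  exact ⟨_, fun x => by rw [integral_mul_eq_rightIntegral_mul, ← he, ← hw]; rfl⟩

end AlgebraicQuantumGroup

/-! ### Pairings with actions and extended pairings -/

section ActingPairing

open AlgebraicQuantumGroup

variable {X : Type*} [NonUnitalRing X] [Module ℂ X] [IsScalarTower ℂ X X] [SMulCommClass ℂ X X]
variable {Y : Type*} [AddCommGroup Y] [Module ℂ Y]
variable {X' : Type*} [NonUnitalRing X'] [Module ℂ X'] [IsScalarTower ℂ X' X']
  [SMulCommClass ℂ X' X']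
variable {Y' : Type*} [AddCommGroup Y'] [Module ℂ Y']

/-- A non-degenerate pairing of an algebra `X` with a vector space `Y` on which the actions of `X`
dual to the multiplications exist. -/
structure IsActingPairing (P : X →ₗ[ℂ] Y →ₗ[ℂ] ℂ) : Prop where
  sep_left : ∀ x, (∀ y, P x y = 0) → x = 0
  sep_right : ∀ y, (∀ x, P x y = 0) → y = 0
  exists_left : ∀ x y, ∃ z, ∀ x', P x' z = P (x' * x) y
  exists_right : ∀ x y, ∃ z, ∀ x', P x' z = P (x * x') y

namespace IsActingPairing

variable {P : X →ₗ[ℂ] Y →ₗ[ℂ] ℂ}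

theorem eq_left {x z : X} (h : IsActingPairing P) (hxz : ∀ y, P x y = P z y) : x = z :=
  sub_eq_zero.1 (h.sep_left _ fun y => by rw [map_sub, LinearMap.sub_apply, hxz, sub_self])

theorem eq_right {y z : Y} (h : IsActingPairing P) (hyz : ∀ x, P x y = P x z) : y = z :=
  sub_eq_zero.1 (h.sep_right _ fun x => by rw [map_sub, hyz, sub_self])

/-- The action `x ▹ y`. -/
def actL (h : IsActingPairing P) : X →ₗ[ℂ] Y →ₗ[ℂ] Y :=
  LinearMap.mk₂ ℂ (fun x y => (h.exists_left x y).choose)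
    (fun x x' y => h.eq_right fun u => by
      rw [map_add, (h.exists_left _ _).choose_spec, (h.exists_left _ _).choose_spec,
        (h.exists_left _ _).choose_spec, mul_add, map_add, LinearMap.add_apply])
    (fun r x y => h.eq_right fun u => by
      rw [map_smul, (h.exists_left _ _).choose_spec, (h.exists_left _ _).choose_spec,
        mul_smul_comm, map_smul, LinearMap.smul_apply])
    (fun x y y' => h.eq_right fun u => by
      rw [map_add, (h.exists_left _ _).choose_spec, (h.exists_left _ _).choose_spec,
        (h.exists_left _ _).choose_spec, map_add])
    (fun r x y => h.eq_right fun u => by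
      rw [map_smul, (h.exists_left _ _).choose_spec, (h.exists_left _ _).choose_spec,
        map_smul])

/-- The action `y ◃ x`. -/
def actR (h : IsActingPairing P) : X →ₗ[ℂ] Y →ₗ[ℂ] Y :=
  LinearMap.mk₂ ℂ (fun x y => (h.exists_right x y).choose)
    (fun x x' y => h.eq_right fun u => by
      rw [map_add, (h.exists_right _ _).choose_spec, (h.exists_right _ _).choose_spec,
        (h.exists_right _ _).choose_spec, add_mul, map_add, LinearMap.add_apply])
    (fun r x y => h.eq_right fun u => by
      rw [map_smul, (h.exists_right _ _).choose_spec, (h.exists_right _ _).choose_spec,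
        smul_mul_assoc, map_smul, LinearMap.smul_apply])
    (fun x y y' => h.eq_right fun u => by
      rw [map_add, (h.exists_right _ _).choose_spec, (h.exists_right _ _).choose_spec,
        (h.exists_right _ _).choose_spec, map_add])
    (fun r x y => h.eq_right fun u => by
      rw [map_smul, (h.exists_right _ _).choose_spec, (h.exists_right _ _).choose_spec,
        map_smul])

theorem pairing_actL (h : IsActingPairing P) (x' x : X) (y : Y) :
    P x' (h.actL x y) = P (x' * x) y :=
  (h.exists_left x y).choose_spec x'

theorem pairing_actR (h : IsActingPairing P) (x' x : X) (y : Y) :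
    P x' (h.actR x y) = P (x * x') y :=
  (h.exists_right x y).choose_spec x'

theorem actL_mul (h : IsActingPairing P) (x x' : X) (y : Y) :
    h.actL (x * x') y = h.actL x (h.actL x' y) :=
  h.eq_right fun u => by simp only [pairing_actL, mul_assoc]

theorem actR_mul (h : IsActingPairing P) (x x' : X) (y : Y) :
    h.actR (x * x') y = h.actR x' (h.actR x y) :=
  h.eq_right fun u => by simp only [pairing_actR, mul_assoc]

theorem actL_actR (h : IsActingPairing P) (x x' : X) (y : Y) :
    h.actL x (h.actR x' y) = h.actR x' (h.actL x y) :=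
  h.eq_right fun u => by simp only [pairing_actR, pairing_actL, mul_assoc]

/-- Non-degeneracy leaves x ▹ y and y ◃ x as the only possible `z`, so the implications of the
definition become equations. -/
theorem isExtendedPairing_iff (h : IsActingPairing P) (m : Mult X) (e : Y →ₗ[ℂ] ℂ) :
    IsExtendedPairing P m e ↔ (∀ x y, P (m.lmul x) y = e (h.actL x y)) ∧
      ∀ x y, P (m.rmul x) y = e (h.actR x y) := by
  constructor
  · rintro ⟨h1, h2⟩
    exact ⟨fun x y => (h1 x y _ fun x' => h.pairing_actL x' x y).symm,
      fun x y => (h2 x y _ fun x' => h.pairing_actR x' x y).symm⟩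
  · rintro ⟨h1, h2⟩
    refine ⟨fun x y z hz => ?_, fun x y z hz => ?_⟩
    · rw [h1, h.eq_right fun x' => (hz x').trans (h.pairing_actL x' x y).symm]
    · rw [h2, h.eq_right fun x' => (hz x').trans (h.pairing_actR x' x y).symm]

/-- A functional on `Y` comes from a unique multiplier of `X` as soon as it is given on
`x ▹ Y` and `Y ◃ x` by elements of `X`. -/
theorem existsUnique_isExtendedPairing (h : IsActingPairing P) (e : Y →ₗ[ℂ] ℂ)
    (hL : ∀ x, ∃ z, ∀ y, P z y = e (h.actL x y)) (hR : ∀ x, ∃ z, ∀ y, P z y = e (h.actR x y)) :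
    ∃! m, IsExtendedPairing P m e := by
  choose L hL using hL
  choose R hR using hR
  let L' : X →ₗ[ℂ] X :=
    { toFun := L
      map_add' := fun x x' => h.eq_left fun y => by simp [hL]
      map_smul' := fun r x => h.eq_left fun y => by simp [hL] }
  let R' : X →ₗ[ℂ] X :=
    { toFun := R
      map_add' := fun x x' => h.eq_left fun y => by simp [hR]
      map_smul' := fun r x => h.eq_left fun y => by simp [hR] }
  have hL' : ∀ x y, P (L' x) y = e (h.actL x y) := hL
  have hR' : ∀ x y, P (R' x) y = e (h.actR x y) := hR
  -- The three multiplier axioms are the two action laws and the commutation of the left with the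
  -- right action, tested against `Y`.
  refine ⟨Mult.mk L' R' (fun x x' => h.eq_left fun y => ?_) (fun x x' => h.eq_left fun y => ?_)
    (fun x x' => h.eq_left fun y => ?_), (h.isExtendedPairing_iff _ _).2 ⟨hL', hR'⟩,
    fun m hm => ?_⟩
  · rw [hL', actL_mul, ← hL', pairing_actL]
  · rw [hR', actR_mul, ← hR', pairing_actR]
  · rw [← h.pairing_actL, hR', ← h.pairing_actR, hL', actL_actR]
  · replace hm := (h.isExtendedPairing_iff _ _).1 hm
    exact Mult.ext (fun x => h.eq_left fun y => by rw [hm.1, Mult.lmul_mk, hL'])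
      (fun x => h.eq_left fun y => by rw [hm.2, Mult.rmul_mk, hR'])

theorem tensor {P' : X' →ₗ[ℂ] Y' →ₗ[ℂ] ℂ} (h : IsActingPairing P) (h' : IsActingPairing P') :
    IsActingPairing (tensorPairing P P') where
  sep_left t ht := by
    refine rTensor_separating (fun y : Y => P.flip y) (fun x hx => h.sep_left x hx) t fun y => ?_
    refine lTensor_separating (fun y : Y' => P'.flip y) (fun x hx => h'.sep_left x hx) _
      fun y' => ?_
    apply (TensorProduct.lid ℂ ℂ).injective
    rw [map_zero, ← ht (y ⊗ₜ y')]
    clear ht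
    induction t with
    | zero => simp
    | add s t h h' => simp only [map_add, LinearMap.add_apply, h, h']
    | tmul a b => simp
  sep_right t ht := by
    refine rTensor_separating (fun x : X => P x) (fun y hy => h.sep_right y hy) t fun y => ?_
    refine lTensor_separating (fun x : X' => P' x) (fun y hy => h'.sep_right y hy) _ fun y' => ?_
    apply (TensorProduct.lid ℂ ℂ).injective
    rw [map_zero, ← ht (y ⊗ₜ y')]
    clear ht
    induction t with
    | zero => simp
    | add s t h h' => simp only [map_add, h, h']
    | tmul a b => simp
  exists_left x y := by
    induction x with
    | zero => exact ⟨0, by simp⟩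
    | add s t h h' =>
      obtain ⟨u, hu⟩ := h
      obtain ⟨v, hv⟩ := h'
      exact ⟨u + v, fun x' => by simp only [map_add, mul_add, LinearMap.add_apply, hu, hv]⟩
    | tmul a b =>
      refine ⟨TensorProduct.map (h.actL a) (h'.actL b) y, fun x' => ?_⟩
      induction y with
      | zero => simp
      | add s t h h' => simp only [map_add, h, h']
      | tmul y y' =>
        induction x' with
        | zero => simp
        | add s t h h' => simp only [map_add, add_mul, LinearMap.add_apply, h, h']
        | tmul c d => simp [pairing_actL]
  exists_right x y := by
    induction x with
    | zero => exact ⟨0, by simp⟩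
    | add s t h h' =>
      obtain ⟨u, hu⟩ := h
      obtain ⟨v, hv⟩ := h'
      exact ⟨u + v, fun x' => by simp only [map_add, add_mul, LinearMap.add_apply, hu, hv]⟩
    | tmul a b =>
      refine ⟨TensorProduct.map (h.actR a) (h'.actR b) y, fun x' => ?_⟩
      induction y with
      | zero => simp
      | add s t h h' => simp only [map_add, h, h']
      | tmul y y' =>
        induction x' with
        | zero => simp
        | add s t h h' => simp only [map_add, mul_add, LinearMap.add_apply, h, h']
        | tmul c d => simp [pairing_actR]

theorem tensor_actL_tmul {P' : X' →ₗ[ℂ] Y' →ₗ[ℂ] ℂ} (h : IsActingPairing P)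
    (h' : IsActingPairing P') (x : X) (x' : X') (y : Y) (y' : Y') :
    (h.tensor h').actL (x ⊗ₜ x') (y ⊗ₜ y') = h.actL x y ⊗ₜ h'.actL x' y' :=
  (h.tensor h').eq_right fun u => by
    rw [pairing_actL]
    induction u with
    | zero => simp
    | add s t h h' => simp only [map_add, add_mul, LinearMap.add_apply, h, h']
    | tmul c d => simp [pairing_actL]

theorem tensor_actR_tmul {P' : X' →ₗ[ℂ] Y' →ₗ[ℂ] ℂ} (h : IsActingPairing P)
    (h' : IsActingPairing P') (x : X) (x' : X') (y : Y) (y' : Y') :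
    (h.tensor h').actR (x ⊗ₜ x') (y ⊗ₜ y') = h.actR x y ⊗ₜ h'.actR x' y' :=
  (h.tensor h').eq_right fun u => by
    rw [pairing_actR]
    induction u with
    | zero => simp
    | add s t h h' => simp only [map_add, mul_add, LinearMap.add_apply, h, h']
    | tmul c d => simp [pairing_actR]

/-- It suffices to give a functional on `Y ⊗ Y'` on the images of elementary tensors. -/
theorem existsUnique_isExtendedPairing_tensor {P' : X' →ₗ[ℂ] Y' →ₗ[ℂ] ℂ} (h : IsActingPairing P)
    (h' : IsActingPairing P') (e : Y ⊗[ℂ] Y' →ₗ[ℂ] ℂ)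
    (hL : ∀ x x', ∃ z, ∀ y y', tensorPairing P P' z (y ⊗ₜ y') =
      e (h.actL x y ⊗ₜ h'.actL x' y'))
    (hR : ∀ x x', ∃ z, ∀ y y', tensorPairing P P' z (y ⊗ₜ y') =
      e (h.actR x y ⊗ₜ h'.actR x' y')) :
    ∃! m, IsExtendedPairing (tensorPairing P P') m e := by
  refine (h.tensor h').existsUnique_isExtendedPairing e (fun t => ?_) (fun t => ?_)
  · induction t with
    | zero => exact ⟨0, by simp⟩
    | add s t h h' =>
      obtain ⟨u, hu⟩ := h
      obtain ⟨v, hv⟩ := h'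
      exact ⟨u + v, fun y => by simp only [map_add, LinearMap.add_apply, hu, hv]⟩
    | tmul x x' =>
      obtain ⟨z, hz⟩ := hL x x'
      refine ⟨z, fun t => ?_⟩
      induction t with
      | zero => simp
      | add s t h h' => simp only [map_add, h, h']
      | tmul y y' => rw [hz, tensor_actL_tmul]
  · induction t with
    | zero => exact ⟨0, by simp⟩
    | add s t h h' =>
      obtain ⟨u, hu⟩ := h
      obtain ⟨v, hv⟩ := h'
      exact ⟨u + v, fun y => by simp only [map_add, LinearMap.add_apply, hu, hv]⟩
    | tmul x x' =>
      obtain ⟨z, hz⟩ := hR x x'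
      refine ⟨z, fun t => ?_⟩
      induction t with
      | zero => simp
      | add s t h h' => simp only [map_add, h, h']
      | tmul y y' => rw [hz, tensor_actR_tmul]

end IsActingPairing

/-- Left multiplication determines right multiplication through (x m) y = x (m y). -/
theorem Mult.ext_lmul [NondegenerateMul X] {m n : Mult X} (h : ∀ x, m.lmul x = n.lmul x) :
    m = n :=
  Mult.ext h fun x => AlgebraicQuantumGroup.eq_of_mul fun y => by
    rw [Mult.rmul_mul, Mult.rmul_mul, h]

end ActingPairing

/-! ### The pairings of A with its dual, the duality and the dual coproduct -/

namespace AlgebraicQuantumGroup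

variable {A : Type*} [NonUnitalRing A] [Module ℂ A] [IsScalarTower ℂ A A] [SMulCommClass ℂ A A]
  [NondegenerateMul A] (Q : AlgebraicQuantumGroup A)

theorem pairing_conv₁ (a c : A) (b : Q.Dual) :
    Q.pairing (Q.conv₁ c a) b = Q.pairing a (b * Q.fourier c) := by
  obtain ⟨c', rfl⟩ := Q.fourier_surjective b
  rw [fourier_mul_fourier, Q.pairing_conv_of_right a c' c _ (Q.incl_can₁ a c),
    tensorFunctional_eq_sliceRight]
  rfl

/-- Separation of points of A is the faithfulness of φ. The actions of φ(· c) slice Δ(a)(1 ⊗ c) and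
Δ(a)(c ⊗ 1) by φ. -/
theorem isActingPairing_flip : IsActingPairing Q.pairing.flip where
  sep_left b hb := Dual.ext Q fun a => by rw [map_zero]; exact hb a
  sep_right a ha := Q.eq_zero_of_integral_mul fun q => ha (Q.fourier q)
  exists_left b a := by
    obtain ⟨c, rfl⟩ := Q.fourier_surjective b
    exact ⟨Q.conv₁ c a, fun b' => Q.pairing_conv₁ a c b'⟩
  exists_right b a := by
    obtain ⟨c, rfl⟩ := Q.fourier_surjective b
    refine ⟨sliceLeft Q.integral (Q.can₃ (c ⊗ₜ a)), fun b' => ?_⟩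
    obtain ⟨c', rfl⟩ := Q.fourier_surjective b'
    rw [LinearMap.flip_apply, LinearMap.flip_apply, fourier_mul_fourier,
      Q.pairing_conv_of_left a c c' _ (Q.incl_can₃ c a), tensorFunctional_eq_sliceLeft]
    rfl

/-- The right action uses both directions of the exchange between φ(· c) and φ(d ·): first φ(a a' c)
= φ(d a a'), then φ(d a ·) is brought back to the form φ(· d'). -/
theorem isActingPairing : IsActingPairing Q.pairing where
  sep_left a ha := Q.isActingPairing_flip.sep_right a ha
  sep_right b hb := Q.isActingPairing_flip.sep_left b hb
  exists_left a b := by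
    obtain ⟨c, rfl⟩ := Q.fourier_surjective b
    exact ⟨Q.fourier (a * c), fun a' => by simp [mul_assoc]⟩
  exists_right a b := by
    obtain ⟨c, rfl⟩ := Q.fourier_surjective b
    obtain ⟨d, hd⟩ := Q.exists_integral_comm' c
    obtain ⟨d', hd'⟩ := Q.exists_integral_comm (d * a)
    exact ⟨Q.fourier d', fun a' => by
      rw [pairing_fourier, pairing_fourier, hd', ← hd, mul_assoc]⟩

theorem actL_fourier (c a : A) : Q.isActingPairing_flip.actL (Q.fourier c) a = Q.conv₁ c a :=
  Q.isActingPairing_flip.eq_right fun b => by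
    rw [IsActingPairing.pairing_actL]; exact (Q.pairing_conv₁ a c b).symm

theorem actR_fourier (c a : A) : Q.isActingPairing_flip.actR (Q.fourier c) a =
    sliceLeft Q.integral (Q.can₃ (c ⊗ₜ a)) :=
  Q.isActingPairing_flip.eq_right fun b => by
    obtain ⟨c', rfl⟩ := Q.fourier_surjective b
    rw [IsActingPairing.pairing_actR, LinearMap.flip_apply, LinearMap.flip_apply,
      fourier_mul_fourier, Q.pairing_conv_of_left a c c' _ (Q.incl_can₃ c a),
      tensorFunctional_eq_sliceLeft]
    rfl

theorem sliceLeft_pairing_fourier (c : A) (w : A ⊗[ℂ] A) :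
    sliceLeft (Q.pairing.flip (Q.fourier c)) w = sliceLeft Q.integral (mulR₁ c w) := by
  induction w with
  | zero => simp
  | add s t h h' => simp only [map_add, h, h']
  | tmul a b => simp

theorem actR_mul (b : Q.Dual) (a x : A) : Q.isActingPairing_flip.actR b a * x =
    sliceLeft (Q.pairing.flip b) (Q.can₁ (a ⊗ₜ x)) := by
  obtain ⟨c, rfl⟩ := Q.fourier_surjective b
  rw [actR_fourier, sliceLeft_pairing_fourier, ← sliceLeft_mulR₂, mulR₂_can₃, mulR₁_can₁]

theorem mul_actR (b : Q.Dual) (a x : A) : x * Q.isActingPairing_flip.actR b a =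
    sliceLeft (Q.pairing.flip b) (Q.can₄ (a ⊗ₜ x)) := by
  obtain ⟨c, rfl⟩ := Q.fourier_surjective b
  rw [actR_fourier, sliceLeft_pairing_fourier, ← sliceLeft_mulL₂, mulL₂_can₃]

theorem exists_pairing_eq_rightIntegral' (b : Q.Dual) :
    ∃ c, ∀ a, Q.pairing a b = Q.rightIntegral (c * a) := by
  obtain ⟨c, rfl⟩ := Q.fourier_surjective b
  obtain ⟨d, hd⟩ := Q.exists_integral_comm' c
  obtain ⟨d', hd'⟩ := Q.exists_rightIntegral_mul_eq' d
  exact ⟨d', fun a => by rw [hd', hd, pairing_fourier]⟩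

theorem exists_dual_eq_rightIntegral (c : A) :
    ∃ b : Q.Dual, ∀ a, Q.pairing a b = Q.rightIntegral (a * c) := by
  obtain ⟨d, hd⟩ := Q.exists_integral_mul_eq c
  exact ⟨Q.fourier d, hd⟩

/-- The element `ψ(· c)` of the dual. -/
def rightFourier : A →ₗ[ℂ] Q.Dual where
  toFun c := (Q.exists_dual_eq_rightIntegral c).choose
  map_add' c d := Dual.ext Q fun a => by
    rw [map_add, (Q.exists_dual_eq_rightIntegral _).choose_spec,
      (Q.exists_dual_eq_rightIntegral _).choose_spec,
      (Q.exists_dual_eq_rightIntegral _).choose_spec, mul_add, map_add]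
  map_smul' r c := Dual.ext Q fun a => by
    rw [map_smul, (Q.exists_dual_eq_rightIntegral _).choose_spec,
      (Q.exists_dual_eq_rightIntegral _).choose_spec, mul_smul_comm, map_smul, RingHom.id_apply]

@[simp] theorem pairing_rightFourier (a c : A) :
    Q.pairing a (Q.rightFourier c) = Q.rightIntegral (a * c) :=
  (Q.exists_dual_eq_rightIntegral c).choose_spec a

theorem rightFourier_surjective : Function.Surjective Q.rightFourier := by
  intro b
  obtain ⟨c, rfl⟩ := Q.fourier_surjective b
  obtain ⟨d, hd⟩ := Q.exists_rightIntegral_mul_eq c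
  exact ⟨d, Dual.ext Q fun a => by rw [pairing_rightFourier, hd, pairing_fourier]⟩

theorem exists_dual_eq_rightIntegral' (c : A) :
    ∃ b : Q.Dual, ∀ a, Q.pairing a b = Q.rightIntegral (c * a) := by
  obtain ⟨d, hd⟩ := Q.exists_integral_mul_eq' c
  obtain ⟨d', hd'⟩ := Q.exists_integral_comm d
  exact ⟨Q.fourier d', fun a => by rw [pairing_fourier, hd', hd]⟩

/-! ### The duality -/

/-- Since Δ(a')(a ⊗ c) = `can₃`((1 ⊗ a')v), left invariance of φ removes the coproduct. This one
formula computes the left multiplications by V and by the dual coproduct. -/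
theorem conv₁_mul_of_can₃ {a c a' : A} {v : A ⊗[ℂ] A} (hv : Q.can₃ v = a ⊗ₜ c) :
    Q.conv₁ c a' * a = sliceRight Q.integral (mulL₂ a' v) := by
  rw [conv₁_mul, ← hv, comulLeft_can₃, sliceRight_integral_can₃]

theorem tensorPairing_fourier_rTensor_comm (a : A) (b : Q.Dual) (v : A ⊗[ℂ] A) :
    tensorPairing Q.pairing.flip Q.pairing
      (Q.fourier.rTensor A (TensorProduct.comm ℂ A A v)) (a ⊗ₜ b) =
    Q.pairing (sliceRight Q.integral (mulL₂ a v)) b := by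
  induction v with
  | zero => simp
  | add s t h h' => simp only [map_add, LinearMap.add_apply, h, h']
  | tmul q p => simp

theorem tensorPairing_duality_left {a c a' : A} {b : Q.Dual} {v : A ⊗[ℂ] A}
    (hv : Q.can₃ v = a ⊗ₜ c) :
    tensorPairing Q.pairing.flip Q.pairing
      (Q.fourier.rTensor A (TensorProduct.comm ℂ A A v)) (a' ⊗ₜ b) =
    TensorProduct.lift Q.pairing (Q.isActingPairing_flip.actL (Q.fourier c) a' ⊗ₜ
      Q.isActingPairing.actL a b) := by
  rw [tensorPairing_fourier_rTensor_comm, TensorProduct.lift.tmul, IsActingPairing.pairing_actL,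
    actL_fourier, Q.conv₁_mul_of_can₃ hv]

theorem existsUnique_duality : ∃! V : Mult (Q.Dual ⊗[ℂ] A), Q.IsDuality V := by
  refine Q.isActingPairing_flip.existsUnique_isExtendedPairing_tensor Q.isActingPairing _
    (fun b a => ?_) (fun b a => ?_)
  · obtain ⟨c, rfl⟩ := Q.fourier_surjective b
    obtain ⟨v, hv⟩ := Q.can₃.surjective (a ⊗ₜ c)
    exact ⟨_, fun a' b' => Q.tensorPairing_duality_left hv⟩
  -- With b = ψ(c ·), the product a(a' ◃ b) is (ψ ⊗ ι)((c ⊗ a)Δ(a')). Writing c ⊗ a = `can₄ v` and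
  -- using right invariance leaves (ψ ⊗ ι)(v(a' ⊗ 1)), which is represented because each ψ(p ·) lies
  -- in the dual.
  · obtain ⟨c, hc⟩ := Q.exists_pairing_eq_rightIntegral' b
    obtain ⟨v, hv⟩ := Q.can₄.surjective (c ⊗ₜ a)
    have h1 : ∀ v : A ⊗[ℂ] A, ∃ z, ∀ a' b', tensorPairing Q.pairing.flip Q.pairing z (a' ⊗ₜ b') =
        Q.pairing (sliceLeft Q.rightIntegral (mulR₁ a' v)) b' := by
      intro v
      induction v with
      | zero => exact ⟨0, by simp⟩
      | add s t h h' =>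
        obtain ⟨u, hu⟩ := h
        obtain ⟨v, hv⟩ := h'
        exact ⟨u + v, fun a' b' => by simp only [map_add, LinearMap.add_apply, hu, hv]⟩
      | tmul p q =>
        obtain ⟨d, hd⟩ := Q.exists_dual_eq_rightIntegral' p
        exact ⟨d ⊗ₜ q, fun a' b' => by simp [hd]⟩
    obtain ⟨z, hz⟩ := h1 v
    refine ⟨z, fun a' b' => ?_⟩
    have h2 : ∀ w, sliceLeft (Q.pairing.flip b) w = sliceLeft Q.rightIntegral (mulL₁ c w) := by
      intro w
      induction w with
      | zero => simp
      | add s t h h' => simp only [map_add, h, h']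
      | tmul p q => simp [hc]
    rw [hz, TensorProduct.lift.tmul, IsActingPairing.pairing_actR, mul_actR, h2, mulL₁_can₄, ← hv,
      comulRight_can₄, sliceLeft_rightIntegral_can₄]

/-- Identifying a ⊗ c with φ(· c) ⊗ a, the duality acts from the left as the inverse of `can₃`. -/
theorem IsDuality.lmul_can₃ {V : Mult (Q.Dual ⊗[ℂ] A)} (hV : Q.IsDuality V) (v : A ⊗[ℂ] A) :
    V.lmul (Q.fourier.rTensor A (TensorProduct.comm ℂ A A (Q.can₃ v))) =
      Q.fourier.rTensor A (TensorProduct.comm ℂ A A v) := by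
  have hP := Q.isActingPairing_flip.tensor Q.isActingPairing
  have h := ((hP.isExtendedPairing_iff V _).1 hV).1
  obtain ⟨w, rfl⟩ := Q.can₃.symm.surjective v
  rw [LinearEquiv.apply_symm_apply]
  induction w with
  | zero => simp
  | add s t h h' => simp only [map_add, h, h']
  | tmul a c =>
    refine hP.eq_left fun y => ?_
    rw [h]
    induction y with
    | zero => simp
    | add s t h h' => simp only [map_add, h, h']
    | tmul a' b' =>
      rw [Q.tensorPairing_duality_left (LinearEquiv.apply_symm_apply _ _),
        ← IsActingPairing.tensor_actL_tmul]
      rfl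

/-! ### The coproduct of the dual -/

/-- `(b₁ ⊗ 1)` acting from the right on the Fourier transform of an element of `A ⊗ A`. -/
def fourierMul (b₁ : Q.Dual) : A ⊗[ℂ] A →ₗ[ℂ] Q.Dual ⊗[ℂ] Q.Dual :=
  TensorProduct.map (LinearMap.mulRight ℂ b₁ ∘ₗ Q.fourier) Q.fourier

@[simp] theorem fourierMul_tmul (b₁ : Q.Dual) (q p : A) :
    Q.fourierMul b₁ (q ⊗ₜ p) = (Q.fourier q * b₁) ⊗ₜ Q.fourier p := rfl

/-- The right side is φ((b₁ ▹ a)(φ(· c₂) ▹ a')c), and `conv₁_mul_of_can₃` rewrites the product of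
the last two factors. -/
theorem tensorPairing_dualComul_left {c c₂ a a' : A} {b₁ : Q.Dual} {v : A ⊗[ℂ] A}
    (hv : Q.can₃ v = c ⊗ₜ c₂) :
    tensorPairing Q.pairing.flip Q.pairing.flip (Q.fourierMul b₁ v) (a ⊗ₜ a') =
    (Q.pairing.flip (Q.fourier c) ∘ₗ LinearMap.mul' ℂ A)
      (Q.isActingPairing_flip.actL b₁ a ⊗ₜ Q.isActingPairing_flip.actL (Q.fourier c₂) a') := by
  have h1 : ∀ v : A ⊗[ℂ] A, tensorPairing Q.pairing.flip Q.pairing.flip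
      (Q.fourierMul b₁ v) (a ⊗ₜ a') = Q.integral (Q.isActingPairing_flip.actL b₁ a *
        sliceRight Q.integral (mulL₂ a' v)) := by
    intro v
    induction v with
    | zero => simp
    | add s t h h' => simp only [map_add, LinearMap.add_apply, mul_add, h, h']
    | tmul q p =>
      rw [fourierMul_tmul, tensorPairing_tmul, ← Q.isActingPairing_flip.pairing_actL]
      simp [mul_comm, mul_smul_comm]
  rw [h1, ← Q.conv₁_mul_of_can₃ hv, actL_fourier]
  simp [mul_assoc]

/-- `(b₁ ⊗ 1)` acting from the left on the flipped right Fourier transform of an element of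
`A ⊗ A`. -/
def mulRightFourier (b₁ : Q.Dual) : A ⊗[ℂ] A →ₗ[ℂ] Q.Dual ⊗[ℂ] Q.Dual :=
  TensorProduct.map (LinearMap.mulLeft ℂ b₁ ∘ₗ Q.rightFourier) Q.rightFourier ∘ₗ
    (TensorProduct.comm ℂ A A).toLinearMap

@[simp] theorem mulRightFourier_tmul (b₁ : Q.Dual) (p q : A) :
    Q.mulRightFourier b₁ (p ⊗ₜ q) = (b₁ * Q.rightFourier q) ⊗ₜ Q.rightFourier p := rfl

theorem sliceLeft_pairing_rightFourier (c : A) (w : A ⊗[ℂ] A) :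
    sliceLeft (Q.pairing.flip (Q.rightFourier c)) w = sliceLeft Q.rightIntegral (mulR₁ c w) := by
  induction w with
  | zero => simp
  | add s t h h' => simp only [map_add, h, h']
  | tmul p q => simp

/-- The mirror image with ψ and `can₁`: the product of a' ◃ ψ(· c₂) with c is (ψ ⊗ ι)(Δ(a')(c₂ ⊗
c)), from which right invariance removes the coproduct. -/
theorem tensorPairing_dualComul_right {c c₂ a a' : A} {b₁ : Q.Dual} {v : A ⊗[ℂ] A}
    (hv : Q.can₁ v = c₂ ⊗ₜ c) :
    tensorPairing Q.pairing.flip Q.pairing.flip (Q.mulRightFourier b₁ v) (a ⊗ₜ a') =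
    (Q.pairing.flip (Q.rightFourier c) ∘ₗ LinearMap.mul' ℂ A)
      (Q.isActingPairing_flip.actR b₁ a ⊗ₜ
        Q.isActingPairing_flip.actR (Q.rightFourier c₂) a') := by
  have h1 : ∀ v : A ⊗[ℂ] A, tensorPairing Q.pairing.flip Q.pairing.flip
      (Q.mulRightFourier b₁ v) (a ⊗ₜ a') = Q.rightIntegral (Q.isActingPairing_flip.actR b₁ a *
        sliceLeft Q.rightIntegral (mulL₁ a' v)) := by
    intro v
    induction v with
    | zero => simp
    | add s t h h' => simp only [map_add, LinearMap.add_apply, mul_add, h, h']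
    | tmul p q =>
      rw [mulRightFourier_tmul, tensorPairing_tmul, ← Q.isActingPairing_flip.pairing_actR]
      simp [mul_comm, mul_smul_comm]
  rw [h1, LinearMap.comp_apply, LinearMap.mul'_apply, LinearMap.flip_apply, pairing_rightFourier,
    mul_assoc, Q.actR_mul (Q.rightFourier c₂), sliceLeft_pairing_rightFourier, mulR₁_can₁, ← hv,
    comulLeft_can₁, sliceLeft_rightIntegral_can₁]

theorem existsUnique_dualComul_apply (b : Q.Dual) : ∃! m : Mult (Q.Dual ⊗[ℂ] Q.Dual),
    IsExtendedPairing (tensorPairing Q.pairing.flip Q.pairing.flip) m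
      (Q.pairing.flip b ∘ₗ LinearMap.mul' ℂ A) := by
  refine Q.isActingPairing_flip.existsUnique_isExtendedPairing_tensor Q.isActingPairing_flip _
    (fun b₁ b₂ => ?_) (fun b₁ b₂ => ?_)
  · obtain ⟨c, rfl⟩ := Q.fourier_surjective b
    obtain ⟨c₂, rfl⟩ := Q.fourier_surjective b₂
    obtain ⟨v, hv⟩ := Q.can₃.surjective (c ⊗ₜ c₂)
    exact ⟨_, fun a a' => Q.tensorPairing_dualComul_left hv⟩
  · obtain ⟨c, rfl⟩ := Q.rightFourier_surjective b
    obtain ⟨c₂, rfl⟩ := Q.rightFourier_surjective b₂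
    obtain ⟨v, hv⟩ := Q.can₁.surjective (c₂ ⊗ₜ c)
    exact ⟨_, fun a a' => Q.tensorPairing_dualComul_right hv⟩

theorem rmul_rightFourier_tmul {m : Mult (Q.Dual ⊗[ℂ] Q.Dual)} {c c₂ : A} {v : A ⊗[ℂ] A}
    (hm : IsExtendedPairing (tensorPairing Q.pairing.flip Q.pairing.flip) m
      (Q.pairing.flip (Q.rightFourier c) ∘ₗ LinearMap.mul' ℂ A)) (b₁ : Q.Dual)
    (hv : Q.can₁ v = c₂ ⊗ₜ c) :
    m.rmul (b₁ ⊗ₜ Q.rightFourier c₂) = Q.mulRightFourier b₁ v := by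
  have hP := Q.isActingPairing_flip.tensor Q.isActingPairing_flip
  have h := ((hP.isExtendedPairing_iff m _).1 hm).2
  refine hP.eq_left fun y => ?_
  rw [h]
  induction y with
  | zero => simp
  | add s t h h' => simp only [map_add, h, h']
  | tmul a a' =>
    rw [Q.tensorPairing_dualComul_right hv, ← IsActingPairing.tensor_actR_tmul]

theorem lmul_fourier_tmul {m : Mult (Q.Dual ⊗[ℂ] Q.Dual)} {c c₂ : A} {v : A ⊗[ℂ] A}
    (hm : IsExtendedPairing (tensorPairing Q.pairing.flip Q.pairing.flip) m
      (Q.pairing.flip (Q.fourier c) ∘ₗ LinearMap.mul' ℂ A)) (b₁ : Q.Dual)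
    (hv : Q.can₃ v = c ⊗ₜ c₂) : m.lmul (b₁ ⊗ₜ Q.fourier c₂) = Q.fourierMul b₁ v := by
  have hP := Q.isActingPairing_flip.tensor Q.isActingPairing_flip
  have h := ((hP.isExtendedPairing_iff m _).1 hm).1
  refine hP.eq_left fun y => ?_
  rw [h]
  induction y with
  | zero => simp
  | add s t h h' => simp only [map_add, h, h']
  | tmul a a' =>
    rw [Q.tensorPairing_dualComul_left hv, ← IsActingPairing.tensor_actL_tmul]

/-- `A` is a module algebra for the action of its dual. -/
theorem conv₁_mul_conv₁ (a a' : A) {c c₂ : A} {v : A ⊗[ℂ] A} (hv : Q.can₃ v = c ⊗ₜ c₂) :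
    Q.conv₁ c (a * Q.conv₁ c₂ a') = LinearMap.mul' ℂ A
      (TensorProduct.map (Q.isActingPairing_flip.actL.flip a ∘ₗ Q.fourier)
        (Q.isActingPairing_flip.actL.flip a' ∘ₗ Q.fourier) v) := by
  have h1 : Q.can₁ (Q.conv₁ c₂ a' ⊗ₜ c) = Q.flipConv₁ a' v := by
    rw [← can₁_flipConv₁, hv]; rfl
  have h2 := Q.comulLeft_can₁ a (Q.conv₁ c₂ a' ⊗ₜ c)
  rw [h1, mulL₁_tmul] at h2
  rw [conv₁_apply, ← h2]
  clear hv h1 h2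
  induction v with
  | zero => simp
  | add s t h h' => simp only [map_add, h, h']
  | tmul q p =>
    rw [flipConv₁_tmul, ← conv₁_mul]
    simp [actL_fourier]

/-- The module algebra rule for A, with `x` inserted because Δ(b) is only a multiplier. Dually it
says that Δ is multiplicative. -/
theorem mul'_actL_dualComul {m : Mult (Q.Dual ⊗[ℂ] Q.Dual)} {b : Q.Dual}
    (hm : IsExtendedPairing (tensorPairing Q.pairing.flip Q.pairing.flip) m
      (Q.pairing.flip b ∘ₗ LinearMap.mul' ℂ A)) (x : Q.Dual ⊗[ℂ] Q.Dual) (y : A ⊗[ℂ] A) :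
    LinearMap.mul' ℂ A
      ((Q.isActingPairing_flip.tensor Q.isActingPairing_flip).actL (m.lmul x) y) =
    Q.isActingPairing_flip.actL b (LinearMap.mul' ℂ A
      ((Q.isActingPairing_flip.tensor Q.isActingPairing_flip).actL x y)) := by
  induction y with
  | zero => simp
  | add s t h h' => simp only [map_add, h, h']
  | tmul a a' =>
    induction x with
    | zero => simp
    | add s t h h' => simp only [map_add, LinearMap.add_apply, h, h']
    | tmul b₁ b₂ =>
      obtain ⟨c, rfl⟩ := Q.fourier_surjective b
      obtain ⟨c₂, rfl⟩ := Q.fourier_surjective b₂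
      obtain ⟨v, hv⟩ := Q.can₃.surjective (c ⊗ₜ c₂)
      rw [Q.lmul_fourier_tmul hm b₁ hv,
        Q.isActingPairing_flip.tensor_actL_tmul Q.isActingPairing_flip, LinearMap.mul'_apply,
        actL_fourier, actL_fourier, Q.conv₁_mul_conv₁ _ _ hv]
      clear hv
      induction v with
      | zero => simp
      | add s t h h' => simp only [map_add, LinearMap.add_apply, h, h']
      | tmul q p =>
        rw [fourierMul_tmul, Q.isActingPairing_flip.tensor_actL_tmul Q.isActingPairing_flip,
          IsActingPairing.actL_mul]
        simp

theorem isExtendedPairing_unique {m n : Mult (Q.Dual ⊗[ℂ] Q.Dual)} {b : Q.Dual}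
    (hm : IsExtendedPairing (tensorPairing Q.pairing.flip Q.pairing.flip) m
      (Q.pairing.flip b ∘ₗ LinearMap.mul' ℂ A))
    (hn : IsExtendedPairing (tensorPairing Q.pairing.flip Q.pairing.flip) n
      (Q.pairing.flip b ∘ₗ LinearMap.mul' ℂ A)) : m = n :=
  (Q.existsUnique_dualComul_apply b).unique hm hn

theorem existsUnique_dualComul :
    ∃! Δ : Q.Dual →ₙₐ[ℂ] Mult (Q.Dual ⊗[ℂ] Q.Dual), Q.IsDualComul Δ := by
  have hP := Q.isActingPairing_flip.tensor Q.isActingPairing_flip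
  choose D hD using fun b => (Q.existsUnique_dualComul_apply b).exists
  have hD' := fun b => (hP.isExtendedPairing_iff _ _).1 (hD b)
  let Δ : Q.Dual →ₙₐ[ℂ] Mult (Q.Dual ⊗[ℂ] Q.Dual) :=
    { toFun := D
      map_smul' := fun r b => Mult.ext_lmul fun x => hP.eq_left fun y => by
        rw [(hD' _).1, MonoidHom.id_apply, Mult.lmul_smul, LinearMap.comp_apply,
          map_smul Q.pairing.flip, map_smul (tensorPairing _ _), LinearMap.smul_apply,
          LinearMap.smul_apply, (hD' _).1]
        rfl
      map_zero' := Mult.ext_lmul fun x => hP.eq_left fun y => by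
        rw [(hD' _).1]
        simp
      map_add' := fun b b' => Mult.ext_lmul fun x => hP.eq_left fun y => by
        rw [(hD' _).1, Mult.lmul_add, LinearMap.comp_apply, map_add Q.pairing.flip,
          map_add (tensorPairing _ _), LinearMap.add_apply, LinearMap.add_apply, (hD' _).1,
          (hD' _).1]
        rfl
      -- Pairing Δ(bb')x with y gives ⟨b' ▹ μ(x ▹ y), b⟩, where μ is the product of A. The module
      -- algebra rule absorbs b' into Δ(b')x.
      map_mul' := fun b b' => Mult.ext_lmul fun x => hP.eq_left fun y => by
        rw [(hD' _).1, Mult.lmul_mul, (hD' _).1, LinearMap.comp_apply, LinearMap.comp_apply,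
          Q.mul'_actL_dualComul (hD b'), IsActingPairing.pairing_actL] }
  exact ⟨Δ, hD, fun Δ' h' => NonUnitalAlgHom.ext fun b => Q.isExtendedPairing_unique (h' b) (hD b)⟩

end AlgebraicQuantumGroup

/-! ### The pentagon equation and non-degeneracy -/

section Auxiliary

variable {X : Type*} [NonUnitalRing X] [Module ℂ X] [IsScalarTower ℂ X X] [SMulCommClass ℂ X X]
variable {Y : Type*} [NonUnitalRing Y] [Module ℂ Y] [IsScalarTower ℂ Y Y] [SMulCommClass ℂ Y Y]
variable {Z : Type*} [NonUnitalRing Z] [Module ℂ Z] [IsScalarTower ℂ Z Z] [SMulCommClass ℂ Z Z]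

/-- Used to move products of legs of V past the right factors that appear when ι ⊗ Δ and Δ ⊗ ι are
evaluated. -/
theorem Mult.lmul_rmul_comm [NondegenerateMul X] (m n : Mult X) (x : X) :
    m.lmul (n.rmul x) = n.rmul (m.lmul x) :=
  AlgebraicQuantumGroup.eq_of_mul fun y => by
    rw [← Mult.lmul_mul_apply, Mult.rmul_mul, Mult.rmul_mul, Mult.lmul_mul_apply]

theorem isNondegenerateHom_of_surjective {α : X →ₙₐ[ℂ] Mult Y}
    (hl : Function.Surjective (IsNondegenerateHom.lact α))
    (hr : Function.Surjective (IsNondegenerateHom.ract α)) : IsNondegenerateHom α where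
  span_lmul := by
    refine eq_top_iff.2 fun z _ => ?_
    obtain ⟨t, rfl⟩ := hl z
    induction t with
    | zero => simp
    | add s t h h' => rw [map_add]; exact add_mem (h trivial) (h' trivial)
    | tmul x y => exact Submodule.subset_span ⟨x, y, rfl⟩
  span_rmul := by
    refine eq_top_iff.2 fun z _ => ?_
    obtain ⟨t, rfl⟩ := hr z
    induction t with
    | zero => simp
    | add s t h h' => rw [map_add]; exact add_mem (h trivial) (h' trivial)
    | tmul x y => exact Submodule.subset_span ⟨x, y, rfl⟩

theorem lmul_multAssoc (m : Mult ((X ⊗[ℂ] Y) ⊗[ℂ] Z)) (t : (X ⊗[ℂ] Y) ⊗[ℂ] Z) :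
    (multAssoc m).lmul (TensorProduct.assoc ℂ X Y Z t) =
      TensorProduct.assoc ℂ X Y Z (m.lmul t) := by
  change TensorProduct.assoc ℂ X Y Z (m.lmul ((TensorProduct.assoc ℂ X Y Z).symm _)) = _
  rw [LinearEquiv.symm_apply_apply]

theorem rmul_multAssoc (m : Mult ((X ⊗[ℂ] Y) ⊗[ℂ] Z)) (t : (X ⊗[ℂ] Y) ⊗[ℂ] Z) :
    (multAssoc m).rmul (TensorProduct.assoc ℂ X Y Z t) =
      TensorProduct.assoc ℂ X Y Z (m.rmul t) := by
  change TensorProduct.assoc ℂ X Y Z (m.rmul ((TensorProduct.assoc ℂ X Y Z).symm _)) = _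
  rw [LinearEquiv.symm_apply_apply]

theorem lmul_leg12 (E : Mult (X ⊗[ℂ] Y)) (x : X) (y : Y) (z : Z) :
    (leg12 Z E).lmul (x ⊗ₜ (y ⊗ₜ z)) = TensorProduct.assoc ℂ X Y Z (E.lmul (x ⊗ₜ y) ⊗ₜ z) :=
  lmul_multAssoc (tmul E 1) ((x ⊗ₜ y) ⊗ₜ z)

theorem lmul_leg13 (E : Mult (X ⊗[ℂ] Y)) (x : X) (y : Y) (z : Z) :
    (leg13 Z E).lmul (x ⊗ₜ (z ⊗ₜ y)) = (TensorProduct.comm ℂ Y Z).toLinearMap.lTensor X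
      (TensorProduct.assoc ℂ X Y Z (E.lmul (x ⊗ₜ y) ⊗ₜ z)) := by
  rw [← lmul_leg12]
  rfl

theorem surjective_of_tmul_tmul {M : Type*} [AddCommGroup M] [Module ℂ M]
    (f : M →ₗ[ℂ] X ⊗[ℂ] (Y ⊗[ℂ] Z)) (h : ∀ x y z, x ⊗ₜ (y ⊗ₜ z) ∈ LinearMap.range f) :
    Function.Surjective f := by
  intro t
  change t ∈ LinearMap.range f
  induction t with
  | zero => exact zero_mem _
  | add s t h h' => exact add_mem h h'
  | tmul x w =>
    induction w with
    | zero => rw [TensorProduct.tmul_zero]; exact zero_mem _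
    | add s t h h' => rw [TensorProduct.tmul_add]; exact add_mem h h'
    | tmul y z => exact h x y z

end Auxiliary

namespace AlgebraicQuantumGroup

variable {A : Type*} [NonUnitalRing A] [Module ℂ A] [IsScalarTower ℂ A A] [SMulCommClass ℂ A A]
  [NondegenerateMul A] (Q : AlgebraicQuantumGroup A)

/-- The operator `T₁₃` on `A ⊗ (A ⊗ A)`. -/
def outerLegs (T : A ⊗[ℂ] A →ₗ[ℂ] A ⊗[ℂ] A) : A ⊗[ℂ] (A ⊗[ℂ] A) →ₗ[ℂ] A ⊗[ℂ] (A ⊗[ℂ] A) :=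
  (TensorProduct.comm ℂ A A).toLinearMap.lTensor A ∘ₗ leftLegs T ∘ₗ
    (TensorProduct.comm ℂ A A).toLinearMap.lTensor A

theorem outerLegs_tmul (T : A ⊗[ℂ] A →ₗ[ℂ] A ⊗[ℂ] A) (a b c : A) :
    outerLegs T (a ⊗ₜ (b ⊗ₜ c)) = (TensorProduct.comm ℂ A A).toLinearMap.lTensor A
      (TensorProduct.assoc ℂ A A A (T (a ⊗ₜ c) ⊗ₜ b)) := by
  simp [outerLegs, leftLegs_tmul]

theorem lTensor_mulL₂_leftLegs (T : A ⊗[ℂ] A →ₗ[ℂ] A ⊗[ℂ] A) (z : A) (x : A ⊗[ℂ] (A ⊗[ℂ] A)) :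
    (mulL₂ z).lTensor A (leftLegs T x) = leftLegs T ((mulL₂ z).lTensor A x) :=
  (leftLegs_lTensor_lTensor T (LinearMap.mulLeft ℂ z) x).symm

/-- The map `h ↦ (Δ(g) w) ⊗ h` for `g ⊗ h` in `A ⊗ A`. -/
def comulLeftTensor (w : A ⊗[ℂ] A) : A ⊗[ℂ] A →ₗ[ℂ] A ⊗[ℂ] (A ⊗[ℂ] A) :=
  (TensorProduct.assoc ℂ A A A).toLinearMap ∘ₗ
    LinearMap.rTensor A
      { toFun := fun g => (Q.comul g).lmul w
        map_add' := by simp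
        map_smul' := by simp }

theorem comulLeftTensor_tmul (w : A ⊗[ℂ] A) (g h : A) : Q.comulLeftTensor w (g ⊗ₜ h) =
    TensorProduct.assoc ℂ A A A (Q.comulLeft g w ⊗ₜ h) := rfl

/-- Cutting the last leg by `z` trades the `can₃` on legs 2, 3 for `can₄`, which commutes with
`can₃` on legs 1, 2 by coassociativity. What remains is Σ Δ(g)w ⊗ h with Σ g ⊗ h = (1 ⊗ z)Δ(r). -/
theorem lTensor_mulL₂_outerLegs (w : A ⊗[ℂ] A) (r z : A) :
    (mulL₂ z).lTensor A (Q.can₃.toLinearMap.lTensor A (outerLegs Q.can₃.toLinearMap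
      (TensorProduct.assoc ℂ A A A (w ⊗ₜ r)))) = Q.comulLeftTensor w (Q.can₄ (r ⊗ₜ z)) := by
  induction w with
  | zero =>
    simp only [TensorProduct.zero_tmul, map_zero]
    induction Q.can₄ (r ⊗ₜ z) with
    | zero => simp
    | add s t h h' => rw [map_add, ← h, ← h', add_zero]
    | tmul g h => simp [comulLeftTensor_tmul]
  | add s t h h' =>
    simp only [map_add, TensorProduct.add_tmul, h, h']
    induction Q.can₄ (r ⊗ₜ z) with
    | zero => simp
    | add u v h h' => simp only [map_add, ← h, ← h']; abel
    | tmul g h => simp [comulLeftTensor_tmul, TensorProduct.add_tmul]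
  | tmul x y =>
    have h1 : ∀ w : A ⊗[ℂ] A, (mulL₂ z).lTensor A (Q.can₃.toLinearMap.lTensor A
        ((TensorProduct.comm ℂ A A).toLinearMap.lTensor A
          (TensorProduct.assoc ℂ A A A (w ⊗ₜ y)))) = (mulR₁ y).lTensor A
        (Q.can₄.toLinearMap.lTensor A (TensorProduct.assoc ℂ A A A (w ⊗ₜ z))) := by
      intro w
      induction w with
      | zero => simp
      | add s t h h' => simp only [map_add, TensorProduct.add_tmul, h, h']
      | tmul e f => simp [mulL₂_can₃]
    have h2 : ∀ w : A ⊗[ℂ] A, (mulR₁ y).lTensor A (leftLegs Q.can₃.toLinearMap (x ⊗ₜ w)) =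
        Q.comulLeftTensor (x ⊗ₜ y) w := by
      intro w
      induction w with
      | zero => simp
      | add s t h h' => simp only [map_add, TensorProduct.tmul_add, h, h']
      | tmul g k =>
        rw [leftLegs_tmul, comulLeftTensor_tmul, ← mulR₂_can₃, LinearEquiv.coe_coe]
        generalize Q.can₃ (x ⊗ₜ g) = v
        induction v with
        | zero => simp
        | add s t h h' => simp only [map_add, TensorProduct.add_tmul, h, h']
        | tmul e f => simp
    have h3 := Q.lTensor_can₄_leftLegs_can₃ (x ⊗ₜ (r ⊗ₜ z))
    rw [leftLegs_tmul] at h3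
    rw [TensorProduct.assoc_tmul, outerLegs_tmul, h1, h3, LinearMap.lTensor_tmul, h2]
    rfl

/-- The pentagon equation for `a ⊗ b ↦ Δ(b)(a ⊗ 1)`. -/
theorem pentagon (x : A ⊗[ℂ] (A ⊗[ℂ] A)) :
    Q.can₃.toLinearMap.lTensor A (outerLegs Q.can₃.toLinearMap
      (leftLegs Q.can₃.toLinearMap x)) =
    leftLegs Q.can₃.toLinearMap (Q.can₃.toLinearMap.lTensor A x) := by
  refine sub_eq_zero.1 (lTensor_separating (fun z : A => mulL₂ z)
    (fun w h => lTensor_separating (fun z : A => LinearMap.mulLeft ℂ z)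
      (fun y h => NondegenerateMul.eq_zero_of_mul_left y h) w h) _ fun z => ?_)
  rw [map_sub, sub_eq_zero, lTensor_mulL₂_leftLegs]
  induction x with
  | zero => simp
  | add s t h h' => simp only [map_add, h, h']
  | tmul q w =>
    induction w with
    | zero => simp
    | add s t h h' => simp only [map_add, TensorProduct.tmul_add, h, h']
    | tmul s r =>
      -- Both sides now depend on `r` only through Σ g ⊗ k = (1 ⊗ z)Δ(r), and agree because
      -- Δ(g)`can₃`(q ⊗ s) = `can₃`(q ⊗ gs).
      rw [leftLegs_tmul, lTensor_mulL₂_outerLegs, LinearMap.lTensor_tmul, LinearMap.lTensor_tmul,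
        LinearEquiv.coe_coe, mulL₂_can₃]
      generalize Q.can₄ (r ⊗ₜ z) = v
      induction v with
      | zero => simp
      | add s t h h' => simp only [map_add, TensorProduct.tmul_add, h, h']
      | tmul g k =>
        rw [comulLeftTensor_tmul, comulLeft_can₃, mulR₁_tmul, leftLegs_tmul, mulL₂_tmul]
        rfl

/-! ### Non-degeneracy of ι ⊗ Δ and Δ ⊗ ι -/

/-- The product is (ε ⊗ ι) ∘ `can₁`, a composite of surjections. -/
theorem mul'_surjective (Q : AlgebraicQuantumGroup A) : Function.Surjective (LinearMap.mul' ℂ A) := by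
  intro a
  obtain ⟨w, rfl⟩ := ((sliceLeft_surjective Q.counit_ne_zero).comp Q.can₁.surjective) a
  exact ⟨w, (Q.sliceLeft_counit_can₁ w).symm⟩

/-- By left invariance (φ ⊗ φ)(Δ(a)`can₃ v`) = φ(a (φ ⊗ ι)(v)), so the Fourier transform of (φ ⊗
ι)(v) is a sum of products, and φ ⊗ ι is onto. -/
theorem mul'_dual_surjective : Function.Surjective (LinearMap.mul' ℂ Q.Dual) := by
  intro b
  obtain ⟨c, rfl⟩ := Q.fourier_surjective b
  obtain ⟨v, rfl⟩ := sliceLeft_surjective Q.integral_ne_zero c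
  refine ⟨TensorProduct.map Q.fourier Q.fourier (Q.can₃ v), Dual.ext Q fun a => ?_⟩
  have h1 : ∀ w : A ⊗[ℂ] A, Q.pairing a (LinearMap.mul' ℂ Q.Dual
      (TensorProduct.map Q.fourier Q.fourier w)) =
      tensorFunctional Q.integral Q.integral (Q.comulLeft a w) := by
    intro w
    induction w with
    | zero => simp
    | add s t h h' => simp only [map_add, h, h']
    | tmul p q =>
      rw [TensorProduct.map_tmul, LinearMap.mul'_apply, pairing_fourier_mul_fourier]
  rw [h1, comulLeft_can₃, tensorFunctional_eq_sliceRight, sliceRight_integral_can₃,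
    ← tensorFunctional_eq_sliceRight, tensorFunctional_eq_sliceLeft, sliceLeft_mulL₂,
    pairing_fourier]

theorem lmul_idTensorComul (b b₁ : Q.Dual) (a a₁ a₂ : A) :
    (Q.idTensorComul (b ⊗ₜ a)).lmul (b₁ ⊗ₜ (a₁ ⊗ₜ a₂)) =
      (b * b₁) ⊗ₜ mulR₂ a₂ (Q.can₃ (a₁ ⊗ₜ a)) := by
  rw [mulR₂_can₃]; rfl

theorem rmul_idTensorComul (b b₁ : Q.Dual) (a a₁ a₂ : A) :
    (Q.idTensorComul (b ⊗ₜ a)).rmul (b₁ ⊗ₜ (a₁ ⊗ₜ a₂)) =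
      (b₁ * b) ⊗ₜ mulL₂ a₂ (Q.can₂ (a₁ ⊗ₜ a)) := by
  rw [mulL₂_can₂]; rfl

/-- Products span A, so the last leg may be taken as pq. Then x ⊗ p is a value of a canonical map,
with q multiplied on afterwards, and the first leg is a sum of products in the dual. -/
theorem isNondegenerateHom_idTensorComul : IsNondegenerateHom Q.idTensorComul := by
  refine isNondegenerateHom_of_surjective (surjective_of_tmul_tmul _ fun b x y => ?_)
    (surjective_of_tmul_tmul _ fun b x y => ?_)
  · obtain ⟨u, rfl⟩ := Q.mul'_dual_surjective b
    obtain ⟨t, rfl⟩ := Q.mul'_surjective y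
    induction t with
    | zero => simp
    | add s t h h' => simp only [map_add, TensorProduct.tmul_add]; exact add_mem h h'
    | tmul p q =>
      change _ ⊗ₜ mulR₂ q (x ⊗ₜ p) ∈ _
      obtain ⟨v, hv⟩ := Q.can₃.surjective (x ⊗ₜ p)
      rw [← hv]
      clear hv
      induction v with
      | zero => simp
      | add s t h h' => simp only [map_add, TensorProduct.tmul_add]; exact add_mem h h'
      | tmul a₁ a =>
        induction u with
        | zero => simp
        | add s t h h' => simp only [map_add, TensorProduct.add_tmul]; exact add_mem h h'
        | tmul b b₁ => exact ⟨(b ⊗ₜ a) ⊗ₜ (b₁ ⊗ₜ (a₁ ⊗ₜ q)), Q.lmul_idTensorComul b b₁ a a₁ q⟩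
  · obtain ⟨u, rfl⟩ := Q.mul'_dual_surjective b
    obtain ⟨t, rfl⟩ := Q.mul'_surjective y
    induction t with
    | zero => simp
    | add s t h h' => simp only [map_add, TensorProduct.tmul_add]; exact add_mem h h'
    | tmul q p =>
      change _ ⊗ₜ mulL₂ q (x ⊗ₜ p) ∈ _
      obtain ⟨v, hv⟩ := Q.can₂.surjective (x ⊗ₜ p)
      rw [← hv]
      clear hv
      induction v with
      | zero => simp
      | add s t h h' => simp only [map_add, TensorProduct.tmul_add]; exact add_mem h h'
      | tmul a₁ a =>
        induction u with
        | zero => simp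
        | add s t h h' => simp only [map_add, TensorProduct.add_tmul]; exact add_mem h h'
        | tmul b₁ b => exact ⟨(b ⊗ₜ a) ⊗ₜ (b₁ ⊗ₜ (a₁ ⊗ₜ q)), Q.rmul_idTensorComul b b₁ a a₁ q⟩

variable {Q} {Δ : Q.Dual →ₙₐ[ℂ] Mult (Q.Dual ⊗[ℂ] Q.Dual)}

theorem lmul_comulTensorId (b b₁ b₂ : Q.Dual) (a a' : A) :
    (Q.comulTensorId Δ (b ⊗ₜ a)).lmul (b₁ ⊗ₜ (b₂ ⊗ₜ a')) =
      TensorProduct.assoc ℂ _ _ _ ((Δ b).lmul (b₁ ⊗ₜ b₂) ⊗ₜ (a * a')) :=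
  lmul_multAssoc (tmul (Δ b) (incl A a)) ((b₁ ⊗ₜ b₂) ⊗ₜ a')

theorem rmul_comulTensorId (b b₁ b₂ : Q.Dual) (a a' : A) :
    (Q.comulTensorId Δ (b ⊗ₜ a)).rmul (b₁ ⊗ₜ (b₂ ⊗ₜ a')) =
      TensorProduct.assoc ℂ _ _ _ ((Δ b).rmul (b₁ ⊗ₜ b₂) ⊗ₜ (a' * a)) :=
  rmul_multAssoc (tmul (Δ b) (incl A a)) ((b₁ ⊗ₜ b₂) ⊗ₜ a')

/-- By `lmul_fourier_tmul` and surjectivity of the inverse of `can₃`, all φ(· q)b₁ ⊗ φ(· p) are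
reached. They span because the dual is spanned by products. -/
theorem IsDualComul.lact_surjective (hΔ : Q.IsDualComul Δ) :
    Function.Surjective (IsNondegenerateHom.lact Δ) := by
  have h1 : ∀ (b₁ : Q.Dual) (v : A ⊗[ℂ] A),
      Q.fourierMul b₁ v ∈ LinearMap.range (IsNondegenerateHom.lact Δ) := by
    intro b₁ v
    obtain ⟨w, rfl⟩ := Q.can₃.symm.surjective v
    induction w with
    | zero => simp
    | add s t h h' => simp only [map_add]; exact add_mem h h'
    | tmul c c₂ => exact ⟨Q.fourier c ⊗ₜ (b₁ ⊗ₜ Q.fourier c₂),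
        Q.lmul_fourier_tmul (hΔ _) b₁ (LinearEquiv.apply_symm_apply _ _)⟩
  intro t
  change t ∈ LinearMap.range _
  induction t with
  | zero => simp
  | add s t h h' => exact add_mem h h'
  | tmul b b' =>
    obtain ⟨u, rfl⟩ := Q.mul'_dual_surjective b
    induction u with
    | zero => simp
    | add s t h h' => simp only [map_add, TensorProduct.add_tmul]; exact add_mem h h'
    | tmul b b₁ =>
      obtain ⟨q, rfl⟩ := Q.fourier_surjective b
      obtain ⟨p, rfl⟩ := Q.fourier_surjective b'
      exact h1 b₁ (q ⊗ₜ p)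

theorem IsDualComul.ract_surjective (hΔ : Q.IsDualComul Δ) :
    Function.Surjective (IsNondegenerateHom.ract Δ) := by
  have h1 : ∀ (b₁ : Q.Dual) (v : A ⊗[ℂ] A),
      Q.mulRightFourier b₁ v ∈ LinearMap.range (IsNondegenerateHom.ract Δ) := by
    intro b₁ v
    obtain ⟨w, rfl⟩ := Q.can₁.symm.surjective v
    induction w with
    | zero => simp
    | add s t h h' => simp only [map_add]; exact add_mem h h'
    | tmul c₂ c => exact ⟨Q.rightFourier c ⊗ₜ (b₁ ⊗ₜ Q.rightFourier c₂),
        Q.rmul_rightFourier_tmul (hΔ _) b₁ (LinearEquiv.apply_symm_apply _ _)⟩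
  intro t
  change t ∈ LinearMap.range _
  induction t with
  | zero => simp
  | add s t h h' => exact add_mem h h'
  | tmul b b' =>
    obtain ⟨u, rfl⟩ := Q.mul'_dual_surjective b
    induction u with
    | zero => simp
    | add s t h h' => simp only [map_add, TensorProduct.add_tmul]; exact add_mem h h'
    | tmul b₁ b =>
      obtain ⟨q, rfl⟩ := Q.rightFourier_surjective b
      obtain ⟨p, rfl⟩ := Q.rightFourier_surjective b'
      exact h1 b₁ (p ⊗ₜ q)

theorem IsDualComul.isNondegenerateHom_comulTensorId (hΔ : Q.IsDualComul Δ) :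
    IsNondegenerateHom (Q.comulTensorId Δ) := by
  refine isNondegenerateHom_of_surjective (surjective_of_tmul_tmul _ fun b b' y => ?_)
    (surjective_of_tmul_tmul _ fun b b' y => ?_)
  · obtain ⟨t, rfl⟩ := Q.mul'_surjective y
    obtain ⟨u, hu⟩ := hΔ.lact_surjective (b ⊗ₜ b')
    change TensorProduct.assoc ℂ _ _ _ ((b ⊗ₜ b') ⊗ₜ _) ∈ _
    rw [← hu]
    clear hu
    induction t with
    | zero => simp
    | add s t h h' => simp only [map_add, TensorProduct.tmul_add]; exact add_mem h h'
    | tmul a a' =>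
      induction u with
      | zero => simp
      | add s t h h' => simp only [map_add, TensorProduct.add_tmul]; exact add_mem h h'
      | tmul b w =>
        induction w with
        | zero => simp
        | add s t h h' =>
          simp only [map_add, TensorProduct.tmul_add, TensorProduct.add_tmul]
          exact add_mem h h'
        | tmul b₁ b₂ =>
          exact ⟨(b ⊗ₜ a) ⊗ₜ (b₁ ⊗ₜ (b₂ ⊗ₜ a')), lmul_comulTensorId b b₁ b₂ a a'⟩
  · obtain ⟨t, rfl⟩ := Q.mul'_surjective y
    obtain ⟨u, hu⟩ := hΔ.ract_surjective (b ⊗ₜ b')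
    change TensorProduct.assoc ℂ _ _ _ ((b ⊗ₜ b') ⊗ₜ _) ∈ _
    rw [← hu]
    clear hu
    induction t with
    | zero => simp
    | add s t h h' => simp only [map_add, TensorProduct.tmul_add]; exact add_mem h h'
    | tmul a' a =>
      induction u with
      | zero => simp
      | add s t h h' => simp only [map_add, TensorProduct.add_tmul]; exact add_mem h h'
      | tmul b w =>
        induction w with
        | zero => simp
        | add s t h h' =>
          simp only [map_add, TensorProduct.tmul_add, TensorProduct.add_tmul]
          exact add_mem h h'
        | tmul b₁ b₂ =>
          exact ⟨(b ⊗ₜ a) ⊗ₜ (b₁ ⊗ₜ (b₂ ⊗ₜ a')), rmul_comulTensorId b b₁ b₂ a a'⟩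

/-! ### The corepresentation identities -/

variable (Q) in
/-- The map `x ⊗ y ⊗ c ↦ φ(· c) ⊗ x ⊗ y`. -/
def fourierLast : A ⊗[ℂ] (A ⊗[ℂ] A) →ₗ[ℂ] Q.Dual ⊗[ℂ] (A ⊗[ℂ] A) :=
  Q.fourier.rTensor (A ⊗[ℂ] A) ∘ₗ (TensorProduct.comm ℂ (A ⊗[ℂ] A) A).toLinearMap ∘ₗ
    (TensorProduct.assoc ℂ A A A).symm.toLinearMap

@[simp] theorem fourierLast_tmul (x y c : A) :
    Q.fourierLast (x ⊗ₜ (y ⊗ₜ c)) = Q.fourier c ⊗ₜ (x ⊗ₜ y) := rfl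

variable (Q) in
/-- The map `x ⊗ y ⊗ z ↦ φ(· y) ⊗ φ(· z) ⊗ x`. -/
def fourierTwo : A ⊗[ℂ] (A ⊗[ℂ] A) →ₗ[ℂ] Q.Dual ⊗[ℂ] (Q.Dual ⊗[ℂ] A) :=
  (TensorProduct.assoc ℂ Q.Dual Q.Dual A).toLinearMap ∘ₗ
    (TensorProduct.map Q.fourier Q.fourier).rTensor A ∘ₗ
    (TensorProduct.comm ℂ A (A ⊗[ℂ] A)).toLinearMap

@[simp] theorem fourierTwo_tmul (x y z : A) :
    Q.fourierTwo (x ⊗ₜ (y ⊗ₜ z)) = Q.fourier y ⊗ₜ (Q.fourier z ⊗ₜ x) := rfl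

variable {V : Mult (Q.Dual ⊗[ℂ] A)}

theorem IsDuality.lmul_fourier_tmul (hV : Q.IsDuality V) (a c : A) :
    V.lmul (Q.fourier c ⊗ₜ a) =
      Q.fourier.rTensor A (TensorProduct.comm ℂ A A (Q.can₃.symm (a ⊗ₜ c))) := by
  rw [← IsDuality.lmul_can₃ Q hV, LinearEquiv.apply_symm_apply]
  rfl

theorem lTensor_symm_lTensor (T : A ⊗[ℂ] A ≃ₗ[ℂ] A ⊗[ℂ] A) (x : A ⊗[ℂ] (A ⊗[ℂ] A)) :
    T.symm.toLinearMap.lTensor A (T.toLinearMap.lTensor A x) = x := by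
  rw [← LinearMap.comp_apply, ← LinearMap.lTensor_comp]; simp

theorem leftLegs_symm_leftLegs (T : A ⊗[ℂ] A ≃ₗ[ℂ] A ⊗[ℂ] A) (x : A ⊗[ℂ] (A ⊗[ℂ] A)) :
    leftLegs T.symm.toLinearMap (leftLegs T.toLinearMap x) = x := by
  rw [leftLegs_comp]; simp [leftLegs_id]

theorem outerLegs_symm_outerLegs (T : A ⊗[ℂ] A ≃ₗ[ℂ] A ⊗[ℂ] A) (x : A ⊗[ℂ] (A ⊗[ℂ] A)) :
    outerLegs T.symm.toLinearMap (outerLegs T.toLinearMap x) = x := by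
  have h : ∀ x : A ⊗[ℂ] (A ⊗[ℂ] A), (TensorProduct.comm ℂ A A).toLinearMap.lTensor A
      ((TensorProduct.comm ℂ A A).toLinearMap.lTensor A x) = x := fun x => by
    rw [← LinearMap.comp_apply, ← LinearMap.lTensor_comp]; simp
  rw [outerLegs, outerLegs, LinearMap.comp_apply, LinearMap.comp_apply, LinearMap.comp_apply,
    LinearMap.comp_apply, h, leftLegs_symm_leftLegs, h]

/-- `fourierLast` carries legs 3 and 1 to the first two positions, so V₁₂ is the inverse of `can₃`
on the outer legs. Likewise V₁₃ is its inverse on legs 2, 3. -/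
theorem IsDuality.leg12_fourierLast (hV : Q.IsDuality V) (t : A ⊗[ℂ] (A ⊗[ℂ] A)) :
    (leg12 A V).lmul (Q.fourierLast (outerLegs Q.can₃.toLinearMap t)) = Q.fourierLast t := by
  have h : ∀ t, (leg12 A V).lmul (Q.fourierLast t) =
      Q.fourierLast (outerLegs Q.can₃.symm.toLinearMap t) := by
    intro t
    induction t with
    | zero => simp
    | add s t h h' => simp only [map_add, h, h']
    | tmul x w =>
      induction w with
      | zero => simp
      | add s t h h' => simp only [map_add, TensorProduct.tmul_add, h, h']
      | tmul y c =>
        rw [fourierLast_tmul, lmul_leg12, hV.lmul_fourier_tmul, outerLegs_tmul,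
          LinearEquiv.coe_coe]
        generalize Q.can₃.symm (x ⊗ₜ c) = v
        induction v with
        | zero => simp
        | add s t h h' => simp only [map_add, TensorProduct.add_tmul, h, h']
        | tmul p q => simp
  rw [h, outerLegs_symm_outerLegs]

theorem IsDuality.leg13_fourierLast (hV : Q.IsDuality V) (t : A ⊗[ℂ] (A ⊗[ℂ] A)) :
    (leg13 A V).lmul (Q.fourierLast (Q.can₃.toLinearMap.lTensor A t)) = Q.fourierLast t := by
  have h : ∀ t, (leg13 A V).lmul (Q.fourierLast t) =
      Q.fourierLast (Q.can₃.symm.toLinearMap.lTensor A t) := by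
    intro t
    induction t with
    | zero => simp
    | add s t h h' => simp only [map_add, h, h']
    | tmul x w =>
      induction w with
      | zero => simp
      | add s t h h' => simp only [map_add, TensorProduct.tmul_add, h, h']
      | tmul y c =>
        rw [fourierLast_tmul, lmul_leg13, hV.lmul_fourier_tmul, LinearMap.lTensor_tmul,
          LinearEquiv.coe_coe]
        generalize Q.can₃.symm (y ⊗ₜ c) = v
        induction v with
        | zero => simp
        | add s t h h' => simp only [map_add, TensorProduct.add_tmul, TensorProduct.tmul_add, h, h']
        | tmul p q => simp
  rw [h, lTensor_symm_lTensor]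

/-- In the coordinates of `fourierTwo` the element of A comes from leg 1, so V₂₃ inverts `can₃` on
the outer legs and V₁₃ inverts it on legs 1, 2. -/
theorem IsDuality.leg23_fourierTwo (hV : Q.IsDuality V) (t : A ⊗[ℂ] (A ⊗[ℂ] A)) :
    (leg23 Q.Dual V).lmul (Q.fourierTwo (outerLegs Q.can₃.toLinearMap t)) = Q.fourierTwo t := by
  have h : ∀ t, (leg23 Q.Dual V).lmul (Q.fourierTwo t) =
      Q.fourierTwo (outerLegs Q.can₃.symm.toLinearMap t) := by
    intro t
    induction t with
    | zero => simp
    | add s t h h' => simp only [map_add, h, h']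
    | tmul x w =>
      induction w with
      | zero => simp
      | add s t h h' => simp only [map_add, TensorProduct.tmul_add, h, h']
      | tmul y z =>
        rw [fourierTwo_tmul, leg23, lmul_tmul, hV.lmul_fourier_tmul, outerLegs_tmul,
          LinearEquiv.coe_coe]
        generalize Q.can₃.symm (x ⊗ₜ z) = v
        induction v with
        | zero => simp
        | add s t h h' => simp only [map_add, TensorProduct.add_tmul, TensorProduct.tmul_add, h, h']
        | tmul p q => simp
  rw [h, outerLegs_symm_outerLegs]

theorem IsDuality.leg13_fourierTwo (hV : Q.IsDuality V) (t : A ⊗[ℂ] (A ⊗[ℂ] A)) :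
    (leg13 Q.Dual V).lmul (Q.fourierTwo (leftLegs Q.can₃.toLinearMap t)) = Q.fourierTwo t := by
  have h : ∀ t, (leg13 Q.Dual V).lmul (Q.fourierTwo t) =
      Q.fourierTwo (leftLegs Q.can₃.symm.toLinearMap t) := by
    intro t
    induction t with
    | zero => simp
    | add s t h h' => simp only [map_add, h, h']
    | tmul x w =>
      induction w with
      | zero => simp
      | add s t h h' => simp only [map_add, TensorProduct.tmul_add, h, h']
      | tmul y z =>
        rw [fourierTwo_tmul, lmul_leg13, hV.lmul_fourier_tmul, leftLegs_tmul,
          LinearEquiv.coe_coe]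
        generalize Q.can₃.symm (x ⊗ₜ y) = v
        induction v with
        | zero => simp
        | add s t h h' => simp only [map_add, TensorProduct.add_tmul, h, h']
        | tmul p q => simp
  rw [h, leftLegs_symm_leftLegs]

theorem exists_fourier_eq (s : Q.Dual ⊗[ℂ] A) : ∃ v, s =
    Q.fourier.rTensor A (TensorProduct.comm ℂ A A (Q.can₃ v)) := by
  obtain ⟨w, rfl⟩ := LinearMap.rTensor_surjective A Q.fourier_surjective s
  refine ⟨Q.can₃.symm ((TensorProduct.comm ℂ A A).symm w), ?_⟩
  rw [LinearEquiv.apply_symm_apply, LinearEquiv.apply_symm_apply]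

theorem IsDuality.lmul_leg12_mul_leg13 (hV : Q.IsDuality V) (t : A ⊗[ℂ] (A ⊗[ℂ] A)) :
    (leg12 A V * leg13 A V).lmul (Q.fourierLast (leftLegs Q.can₃.toLinearMap
      (Q.can₃.toLinearMap.lTensor A t))) = Q.fourierLast (leftLegs Q.can₃.toLinearMap t) := by
  rw [← pentagon, Mult.lmul_mul, hV.leg13_fourierLast, hV.leg12_fourierLast]

theorem IsDuality.lmul_leg13_mul_leg23 (hV : Q.IsDuality V) (t : A ⊗[ℂ] (A ⊗[ℂ] A)) :
    (leg13 Q.Dual V * leg23 Q.Dual V).lmul (Q.fourierTwo (Q.can₃.symm.toLinearMap.lTensor A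
      (leftLegs Q.can₃.toLinearMap t))) =
      Q.fourierTwo (Q.can₃.symm.toLinearMap.lTensor A t) := by
  -- Writing t = W₂₃ t' makes W₁₂ t the right side of the pentagon; W₂₃⁻¹ then leaves W₁₃W₁₂ t',
  -- which V₁₃V₂₃ undoes.
  have ht : t = Q.can₃.toLinearMap.lTensor A (Q.can₃.symm.toLinearMap.lTensor A t) :=
    (lTensor_symm_lTensor Q.can₃.symm t).symm
  conv_lhs => rw [ht]
  rw [← pentagon, lTensor_symm_lTensor, Mult.lmul_mul, hV.leg23_fourierTwo, hV.leg13_fourierTwo]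

/-- Isolating b₁ and a₂ as right factors leaves W₁₂ as the only trace of the coproduct. -/
theorem lmul_idTensorComul_fourier (b₁ : Q.Dual) (a₁ a₂ : A) (w : A ⊗[ℂ] A) :
    (Q.idTensorComul (Q.fourier.rTensor A (TensorProduct.comm ℂ A A w))).lmul
      (b₁ ⊗ₜ (a₁ ⊗ₜ a₂)) = (tmul (incl _ b₁) (tmul 1 (incl A a₂))).rmul
        (Q.fourierLast (leftLegs Q.can₃.toLinearMap (a₁ ⊗ₜ w))) := by
  induction w with
  | zero => simp
  | add s t h h' => simp only [map_add, Mult.lmul_add, TensorProduct.tmul_add, h, h']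
  | tmul a c =>
    rw [TensorProduct.comm_tmul, LinearMap.rTensor_tmul, lmul_idTensorComul, leftLegs_tmul,
      LinearEquiv.coe_coe]
    generalize Q.can₃ (a₁ ⊗ₜ a) = v
    induction v with
    | zero => simp
    | add s t h h' => simp only [map_add, TensorProduct.add_tmul, TensorProduct.tmul_add, h, h']
    | tmul p q => simp

/-- It suffices to test on the vectors (ι ⊗ Δ)(F(W v))y. There the extension replaces W v by v,
while V₁₂V₁₃ takes W₁₂W₂₃ to W₁₂ by the pentagon. -/
theorem IsDuality.extend_idTensorComul (hV : Q.IsDuality V)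
    (h : IsNondegenerateHom Q.idTensorComul) : h.extend V = leg12 A V * leg13 A V := by
  refine Mult.ext_lmul fun z => ?_
  obtain ⟨t, rfl⟩ := h.lact_surjective z
  induction t with
  | zero => simp
  | add s t h h' => simp only [map_add, h, h']
  | tmul s y =>
    rw [IsNondegenerateHom.lact_tmul, h.extend_lmul]
    obtain ⟨v, rfl⟩ := exists_fourier_eq s
    rw [IsDuality.lmul_can₃ Q hV]
    induction y with
    | zero => simp
    | add s t h h' => simp only [map_add, h, h']
    | tmul b₁ w =>
      induction w with
      | zero => simp
      | add s t h h' => simp only [map_add, TensorProduct.tmul_add, h, h']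
      | tmul a₁ a₂ =>
        rw [lmul_idTensorComul_fourier, lmul_idTensorComul_fourier, Mult.lmul_rmul_comm,
          ← hV.lmul_leg12_mul_leg13]
        rfl

/-- The dual coproduct enters through W₂₃⁻¹. Again the remaining factors stand on the right, out of
the way of V₁₃V₂₃. -/
theorem IsDualComul.lmul_comulTensorId_fourier (hΔ : Q.IsDualComul Δ) (b₁ : Q.Dual) (c₂ a' : A)
    (w : A ⊗[ℂ] A) :
    (Q.comulTensorId Δ (Q.fourier.rTensor A (TensorProduct.comm ℂ A A w))).lmul
      (b₁ ⊗ₜ (Q.fourier c₂ ⊗ₜ a')) = (tmul (incl _ b₁) (tmul 1 (incl A a'))).rmul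
        (Q.fourierTwo (Q.can₃.symm.toLinearMap.lTensor A
          (TensorProduct.assoc ℂ A A A (w ⊗ₜ c₂)))) := by
  induction w with
  | zero => simp
  | add s t h h' => simp only [map_add, Mult.lmul_add, TensorProduct.add_tmul, h, h']
  | tmul a c =>
    rw [TensorProduct.comm_tmul, LinearMap.rTensor_tmul, lmul_comulTensorId,
      Q.lmul_fourier_tmul (hΔ _) b₁ (LinearEquiv.apply_symm_apply Q.can₃ (c ⊗ₜ c₂)),
      TensorProduct.assoc_tmul, LinearMap.lTensor_tmul, LinearEquiv.coe_coe]
    generalize Q.can₃.symm (c ⊗ₜ c₂) = v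
    induction v with
    | zero => simp
    | add s t h h' => simp only [map_add, TensorProduct.add_tmul, TensorProduct.tmul_add, h, h']
    | tmul p q => simp

theorem IsDuality.extend_comulTensorId (hV : Q.IsDuality V) (hΔ : Q.IsDualComul Δ)
    (h : IsNondegenerateHom (Q.comulTensorId Δ)) :
    h.extend V = leg13 Q.Dual V * leg23 Q.Dual V := by
  refine Mult.ext_lmul fun z => ?_
  obtain ⟨t, rfl⟩ := h.lact_surjective z
  induction t with
  | zero => simp
  | add s t h h' => simp only [map_add, h, h']
  | tmul s y =>
    rw [IsNondegenerateHom.lact_tmul, h.extend_lmul]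
    obtain ⟨v, rfl⟩ := exists_fourier_eq s
    rw [IsDuality.lmul_can₃ Q hV]
    induction y with
    | zero => simp
    | add s t h h' => simp only [map_add, h, h']
    | tmul b₁ w =>
      induction w with
      | zero => simp
      | add s t h h' => simp only [map_add, TensorProduct.tmul_add, h, h']
      | tmul b₂ a' =>
        obtain ⟨c₂, rfl⟩ := Q.fourier_surjective b₂
        rw [hΔ.lmul_comulTensorId_fourier, hΔ.lmul_comulTensorId_fourier, Mult.lmul_rmul_comm,
          ← LinearEquiv.coe_coe Q.can₃, ← leftLegs_assoc, hV.lmul_leg13_mul_leg23]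

end AlgebraicQuantumGroup

end MultiplierHopf

end

open MultiplierHopf in
theorem mainTheorem3 {A : Type*} [NonUnitalRing A] [Module ℂ A] [IsScalarTower ℂ A A]
    [SMulCommClass ℂ A A] [NondegenerateMul A] (Q : AlgebraicQuantumGroup A) :
    (∃! Δ : Q.Dual →ₙₐ[ℂ] Mult (Q.Dual ⊗[ℂ] Q.Dual), Q.IsDualComul Δ) ∧
    (∃! V : Mult (Q.Dual ⊗[ℂ] A), Q.IsDuality V) ∧
    ∀ (Δ : Q.Dual →ₙₐ[ℂ] Mult (Q.Dual ⊗[ℂ] Q.Dual)) (V : Mult (Q.Dual ⊗[ℂ] A)),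
      Q.IsDualComul Δ → Q.IsDuality V →
      (∃ h : IsNondegenerateHom Q.idTensorComul,
        h.extend V = leg12 A V * leg13 A V) ∧
      (∃ h : IsNondegenerateHom (Q.comulTensorId Δ),
        h.extend V = leg13 Q.Dual V * leg23 Q.Dual V) := by
  exact ⟨Q.existsUnique_dualComul, Q.existsUnique_duality, fun Δ V hΔ hV =>
    ⟨⟨Q.isNondegenerateHom_idTensorComul, hV.extend_idTensorComul _⟩,
      ⟨hΔ.isNondegenerateHom_comulTensorId, hV.extend_comulTensorId hΔ _⟩⟩⟩
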